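/- Let $c>0$ and let $\mathscr Z$ be the space of real-valued $u\in L^2(\mathbb R^2)$ with $D_x^{1/2}u,\ D_x^{-1/2}u_y\in L^2(\mathbb R^2)$, where $D_x^{\pm1/2}$ is the Fourier multiplier with symbol $|\xi|^{\pm1/2}$ ($\xi$ being the frequency dual to $x$), with the Hilbert norm $$\|u\|_{\mathscr Z}^2=\int_{\mathbb R^2}\big(cu^2+|D_x^{1/2}u|^2+|D_x^{-1/2}u_y|^2\big)\,dx\,dy .$$ Let $f:\mathbb R\to\mathbb R$, $F(u)=\int_0^u f(s)\,ds$, and assume: (A1) $f$ is continuous and $f(0)=0$. (A2) There are $p\in(2,4)$ and $C>0$ such that $|f(u)|\le C(|u|+|u|^{p-1})$ for all $u\in\mathbb R$; moreover $f(u)=o(|u|)$ as $u\to0$. (A3) There is $\mu>2$ such that $0<\mu F(u)\le uf(u)$ for all $u\in\mathbb R\setminus\{0\}$. (A4) There is $\omega\in\mathscr Z$ such that $\lambda^{-2}\int_{\mathbb R^2}F(\lambda\omega)\,dx\,dy\to+\infty$ as $\lambda\to+\infty$. (A5) For every $u\in\mathscr Z\setminus\{0\}$ the function $t\mapsto t^{-1}\int_{\mathbb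 R^2}uf(tu)\,dx\,dy$ is strictly increasing on $(0,+\infty)$ and tends to $+\infty$ as $t\to+\infty$. Set $$S(u)=\tfrac12\|u\|_{\mathscr Z}^2-\int_{\mathbb R^2}F(u)\,dx\,dy,\qquad I(u)=\|u\|_{\mathscr Z}^2-\int_{\mathbb R^2}uf(u)\,dx\,dy,$$ $$\tilde\Gamma=\{u\in\mathscr Z:\ I(u)=0,\ u\ne0\},\qquad \Gamma=\{\gamma\in C([0,1];\mathscr Z):\ \gamma(0)=0,\ S(\gamma(1))<0\},$$ $$d=\inf_{\gamma\in\Gamma}\sup_{t\in[0,1]}S(\gamma(t)),\qquad \tilde d=\inf_{u\in\tilde\Gamma}S(u),\qquad d^*=\inf_{u\in\mathscr Z\setminus\{0\}}\ \sup_{t\ge0}S(tu).$$ A solution is a $\varphi\in\mathscr Z$ that satisfies, in the sense of tempered distributions, $$-c\varphi_x-\mathscr H\Delta\varphi+(f(\varphi))_x=0,$$ where $\mathscr H$ is the Hilbert transform in $x$ (symbol $-i\,\mathrm{sgn}\,\xi$). Then there is $u\in\tilde\Gamma$ with $S(u)=\tilde d$, and this $u$ is a ground state: $u$ is a nontrivial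 solution, and $S(u)\le S(v)$ for every nontrivial solution $v$. Moreover $d=\tilde d=d^*$. -/

import Mathlib

open MeasureTheory Filter Topology Set
open scoped FourierTransform SchwartzMap LineDeriv Laplacian

noncomputable section

namespace Shrira

/-- The plane `ℝ²`; the coordinates of a point `z` are `x = z 0` and `y = z 1`, those of a
frequency `ζ` are `ξ = ζ 0` and `η = ζ 1`. -/
abbrev Plane : Type := EuclideanSpace ℝ (Fin 2)

/-- Real-valued square integrable functions on the plane. -/
abbrev L2R : Type := Lp (α := Plane) ℝ 2 volume

/-- Complex-valued square integrable functions on the plane. -/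
abbrev L2C : Type := Lp (α := Plane) ℂ 2 volume

/-- The Fourier transform of a real `L²` function, with Mathlib's normalization
`û(ζ) = ∫ e^{-2πi z·ζ} u(z) dz`, for which `∂_x` has the symbol `2πi ξ`. -/
def fourierL2 (u : L2R) : L2C := 𝓕 ((Complex.ofRealCLM.compLpL 2 (volume : Measure Plane)) u)

theorem fourierL2_add (u v : L2R) : fourierL2 (u + v) = fourierL2 u + fourierL2 v := by
  simp only [fourierL2, map_add]
  exact FourierTransform.fourier_add _ _

theorem fourierL2_smul (a : ℝ) (u : L2R) : fourierL2 (a • u) = (a : ℂ) • fourierL2 u := by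
  simp only [fourierL2, map_smul]
  rw [← FourierTransform.fourier_smul]
  congr 1

theorem fourierL2_add_ae (u v : L2R) :
    (fourierL2 (u + v) : Plane → ℂ) =ᵐ[volume] fun ζ => fourierL2 u ζ + fourierL2 v ζ := by
  rw [fourierL2_add]
  exact Lp.coeFn_add _ _

theorem fourierL2_smul_ae (a : ℝ) (u : L2R) :
    (fourierL2 (a • u) : Plane → ℂ) =ᵐ[volume] fun ζ => (a : ℂ) * fourierL2 u ζ := by
  rw [fourierL2_smul]
  exact Lp.coeFn_smul _ _

/-- The `L²` domain of the Fourier multiplier with symbol `m`: all `u ∈ L²` with `m û ∈ L²`. -/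
def multiplierDomain (m : Plane → ℂ) : Submodule ℝ L2R where
  carrier := {u | MemLp (fun ζ => m ζ * fourierL2 u ζ) 2 volume}
  add_mem' := by
    intro u v hu hv
    refine (MemLp.add hu hv).ae_eq ?_
    filter_upwards [fourierL2_add_ae u v] with ζ h
    simp only [Pi.add_apply, h, mul_add]
  zero_mem' := by
    have h : (fourierL2 0 : Plane → ℂ) =ᵐ[volume] 0 := by
      have := fourierL2_smul 0 0
      simp only [smul_zero, Complex.ofReal_zero, zero_smul] at this
      rw [this]
      exact Lp.coeFn_zero _ _ _
    refine (MemLp.zero (ε := ℂ)).ae_eq ?_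
    filter_upwards [h] with ζ h
    simp [h]
  smul_mem' := by
    intro a u hu
    refine (MemLp.const_mul hu (a : ℂ)).ae_eq ?_
    filter_upwards [fourierL2_smul_ae a u] with ζ h
    simp only [h]
    ring

theorem multiplierDomain_memLp {m : Plane → ℂ} {u : L2R} (hu : u ∈ multiplierDomain m) :
    MemLp (fun ζ => m ζ * fourierL2 u ζ) 2 volume := hu

/-- The Fourier multiplier with symbol `m`, `u ↦ 𝓕⁻¹ (m û)`, on its `L²` domain. -/
def multiplier (m : Plane → ℂ) : multiplierDomain m →ₗ[ℝ] L2C where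
  toFun u := 𝓕⁻ ((multiplierDomain_memLp u.2).toLp : L2C)
  map_add' := by
    intro u v
    rw [← FourierTransform.fourierInv_add]
    congr 1
    refine Eq.trans (MemLp.toLp_congr _ ((multiplierDomain_memLp u.2).add
      (multiplierDomain_memLp v.2)) ?_) (MemLp.toLp_add _ _)
    filter_upwards [fourierL2_add_ae (u : L2R) v] with ζ h
    simp only [Submodule.coe_add, Pi.add_apply, h, mul_add]
  map_smul' := by
    intro a u
    have e : ∀ w : L2C, a • w = (a : ℂ) • w := fun w => (Complex.coe_smul a w).symm
    rw [RingHom.id_apply, e, ← FourierTransform.fourierInv_smul]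
    congr 1
    refine Eq.trans (MemLp.toLp_congr _ ((multiplierDomain_memLp u.2).const_smul (a : ℂ)) ?_)
      (MemLp.toLp_const_smul _ _)
    filter_upwards [fourierL2_smul_ae a (u : L2R)] with ζ h
    simp only [Submodule.coe_smul, Pi.smul_apply, smul_eq_mul, h]
    ring

/-- The symbol `|2πξ|^{1/2}` of `D_x^{1/2}`. -/
def symbolHalf (ζ : Plane) : ℂ := ((|2 * Real.pi * ζ 0| ^ (1 / 2 : ℝ) : ℝ) : ℂ)

/-- The symbol `|2πξ|^{-1/2} (2πi η)` of `D_x^{-1/2} ∂_y`. -/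
def symbolNegHalfDy (ζ : Plane) : ℂ :=
  ((|2 * Real.pi * ζ 0| ^ (-(1 / 2) : ℝ) : ℝ) : ℂ) * (2 * Real.pi * Complex.I * (ζ 1 : ℂ))

/-- The symbol `-i sgn ξ` of the Hilbert transform in the variable `x`. -/
def symbolHilbert (ζ : Plane) : ℂ := -Complex.I * (Real.sign (ζ 0) : ℂ)

theorem mem_domain_hilbert (u : L2R) : u ∈ multiplierDomain symbolHilbert := by
  have hs : Measurable Real.sign := by
    have : Real.sign = fun r : ℝ => if r < 0 then (-1 : ℝ) else if 0 < r then 1 else 0 := by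
      funext r; rfl
    rw [this]
    exact Measurable.ite measurableSet_Iio measurable_const
      (Measurable.ite measurableSet_Ioi measurable_const measurable_const)
  have hm : Measurable symbolHilbert := by
    unfold symbolHilbert
    exact measurable_const.mul (Complex.measurable_ofReal.comp (hs.comp (by fun_prop)))
  refine (Lp.memLp (fourierL2 u)).mono (hm.aestronglyMeasurable.mul (Lp.aestronglyMeasurable _)) ?_
  refine Eventually.of_forall fun ζ => ?_
  have h1 : ‖symbolHilbert ζ‖ ≤ 1 := by
    rcases Real.sign_apply_eq (ζ 0) with h | h | h <;> simp [symbolHilbert, h]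
  rw [norm_mul]
  exact mul_le_of_le_one_left (norm_nonneg _) h1

/-- The Hilbert transform `𝓗 u` in the variable `x` of `u ∈ L²(ℝ²)`, that is, the convolution in
`x` with `p.v. 1/(πx)`. It is real-valued, but stored as a complex-valued `L²` function. -/
def hilbertTransform (u : L2R) : L2C := multiplier symbolHilbert ⟨u, mem_domain_hilbert u⟩

/-- The real-valued `u ∈ L²(ℝ²)` with `D_x^{1/2} u ∈ L²` and `D_x^{-1/2} u_y ∈ L²`. -/
def energySubmodule : Submodule ℝ L2R :=
  multiplierDomain symbolHalf ⊓ multiplierDomain symbolNegHalfDy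

/-- The energy space `𝒵`; the wave speed `c` enters only through the norm defined below. -/
def EnergySpace (_c : ℝ) : Type := energySubmodule

variable {c : ℝ}

instance : AddCommGroup (EnergySpace c) := inferInstanceAs (AddCommGroup energySubmodule)

instance : Module ℝ (EnergySpace c) := inferInstanceAs (Module ℝ energySubmodule)

/-- The inclusion of `𝒵` in `L²`. -/
def EnergySpace.toL2 : EnergySpace c →ₗ[ℝ] L2R := energySubmodule.subtype

/-- Elements of `𝒵` are used as functions on the plane (defined almost everywhere). -/
instance : CoeFun (EnergySpace c) (fun _ => Plane → ℝ) := ⟨fun u => (u.toL2 : Plane → ℝ)⟩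

/-- `D_x^{1/2} u` for `u ∈ 𝒵`. -/
def halfDx : EnergySpace c →ₗ[ℝ] L2C :=
  multiplier symbolHalf ∘ₗ Submodule.inclusion
    (inf_le_left : energySubmodule ≤ multiplierDomain symbolHalf)

/-- `D_x^{-1/2} u_y` for `u ∈ 𝒵`. -/
def negHalfDxDy : EnergySpace c →ₗ[ℝ] L2C :=
  multiplier symbolNegHalfDy ∘ₗ Submodule.inclusion
    (inf_le_right : energySubmodule ≤ multiplierDomain symbolNegHalfDy)

/-- The scalar product
`(u, v)_𝒵 = ∫ (c u v + D_x^{1/2} u D_x^{1/2} v + D_x^{-1/2} u_y D_x^{-1/2} v_y) dx dy`. -/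
def energyInner (u v : EnergySpace c) : ℝ :=
  c * inner ℝ u.toL2 v.toL2 + (inner ℂ (halfDx u) (halfDx v)).re
    + (inner ℂ (negHalfDxDy u) (negHalfDxDy v)).re

/-- For `c > 0` the scalar product is positive definite. -/
@[reducible] def energyCore [hc : Fact (0 < c)] : InnerProductSpace.Core ℝ (EnergySpace c) where
  inner := energyInner
  conj_inner_symm u v := by
    have h : ∀ a b : L2C, (inner ℂ a b).re = (inner ℂ b a).re := fun a b => inner_re_symm (𝕜 := ℂ) a b
    simp only [energyInner, conj_trivial]
    rw [real_inner_comm, h (halfDx v), h (negHalfDxDy v)]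
  re_inner_nonneg u := by
    have h : ∀ a : L2C, 0 ≤ (inner ℂ a a).re := fun a => inner_self_nonneg (𝕜 := ℂ)
    have := mul_nonneg hc.out.le (real_inner_self_nonneg (x := u.toL2))
    simpa [energyInner] using add_nonneg (add_nonneg this (h _)) (h _)
  add_left u v w := by
    simp only [energyInner, map_add, inner_add_left, Complex.add_re]
    ring
  smul_left u v a := by
    have e : ∀ w w' : L2C, (inner ℂ (a • w) w').re = a * (inner ℂ w w').re := by
      intro w w'
      have h : a • w = (a : ℂ) • w := (Complex.coe_smul a w).symm
      rw [h, inner_smul_left]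
      simp
    simp only [energyInner, map_smul, e, real_inner_smul_left, conj_trivial]
    ring
  definite u hu := by
    have h : ∀ a : L2C, 0 ≤ (inner ℂ a a).re := fun a => inner_self_nonneg (𝕜 := ℂ)
    have h0 := mul_nonneg hc.out.le (real_inner_self_nonneg (x := u.toL2))
    have h1 := h (halfDx u)
    have h2 := h (negHalfDxDy u)
    have hu' : energyInner u u = 0 := hu
    unfold energyInner at hu'
    have h3 : c * inner ℝ u.toL2 u.toL2 = 0 := by linarith
    have h4 : u.toL2 = 0 :=
      inner_self_eq_zero.1 ((mul_eq_zero.1 h3).resolve_left hc.out.ne')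
    exact Subtype.ext h4

instance [Fact (0 < c)] : NormedAddCommGroup (EnergySpace c) :=
  InnerProductSpace.Core.toNormedAddCommGroup (cd := energyCore)

instance [Fact (0 < c)] : InnerProductSpace ℝ (EnergySpace c) :=
  InnerProductSpace.ofCore energyCore.toCore

/-- `‖u‖²_𝒵 = ∫ (c u² + |D_x^{1/2} u|² + |D_x^{-1/2} u_y|²)`. -/
theorem energy_norm_sq [Fact (0 < c)] (u : EnergySpace c) :
    ‖u‖ ^ 2 = c * ‖u.toL2‖ ^ 2 + ‖halfDx u‖ ^ 2 + ‖negHalfDxDy u‖ ^ 2 := by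
  have h : ∀ a : L2C, (inner ℂ a a).re = ‖a‖ ^ 2 := fun a => inner_self_eq_norm_sq (𝕜 := ℂ) a
  rw [← real_inner_self_eq_norm_sq]
  change energyInner u u = _
  rw [energyInner, h, h, real_inner_self_eq_norm_sq]

/-- The primitive `F(u) = ∫₀ᵘ f(s) ds`. -/
def primitive (f : ℝ → ℝ) (u : ℝ) : ℝ := ∫ s in (0 : ℝ)..u, f s

/-- The action `S(u) = ½‖u‖²_𝒵 - ∫ F(u)`. -/
def action [Fact (0 < c)] (f : ℝ → ℝ) (u : EnergySpace c) : ℝ :=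
  1 / 2 * ‖u‖ ^ 2 - ∫ z, primitive f (u z)

/-- `I(u) = ⟨S'(u), u⟩ = ‖u‖²_𝒵 - ∫ u f(u)`. -/
def nehariFunctional [Fact (0 < c)] (f : ℝ → ℝ) (u : EnergySpace c) : ℝ :=
  ‖u‖ ^ 2 - ∫ z, u z * f (u z)

/-- The Nehari manifold `{u ∈ 𝒵 ; I(u) = 0, u ≠ 0}`. -/
def nehariManifold (c : ℝ) [Fact (0 < c)] (f : ℝ → ℝ) : Set (EnergySpace c) :=
  {u | nehariFunctional f u = 0 ∧ u ≠ 0}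

/-- The continuous paths `γ : [0,1] → 𝒵` with `γ(0) = 0` and `S(γ(1)) < 0`. -/
def mountainPassPaths (c : ℝ) [Fact (0 < c)] (f : ℝ → ℝ) : Set C(unitInterval, EnergySpace c) :=
  {γ | γ 0 = 0 ∧ action f (γ 1) < 0}

/-- The Nehari level, the infimum of `S` on the Nehari manifold. All levels are taken in the
extended reals, so that no infimum or supremum is a junk value. -/
def nehariLevel (c : ℝ) [Fact (0 < c)] (f : ℝ → ℝ) : EReal :=
  ⨅ u ∈ nehariManifold c f, (action f u : EReal)

/-- The mountain-pass level. -/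
def mountainPassLevel (c : ℝ) [Fact (0 < c)] (f : ℝ → ℝ) : EReal :=
  ⨅ γ ∈ mountainPassPaths c f, ⨆ t : unitInterval, (action f (γ t) : EReal)

/-- The minimax level, the infimum over the nonzero `u ∈ 𝒵` of `sup_{t ≥ 0} S(tu)`. -/
def minimaxLevel (c : ℝ) [Fact (0 < c)] (f : ℝ → ℝ) : EReal :=
  ⨅ u ∈ {u : EnergySpace c | u ≠ 0}, ⨆ t ∈ Ici (0 : ℝ), (action f (t • u) : EReal)

/-- `u ∈ 𝒵` solves `-c u_x - 𝓗 Δ u + (f(u))_x = 0` in the sense of tempered distributions; the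
derivatives are moved to the test function, and `𝓗 Δ u = Δ 𝓗 u` with `𝓗 u ∈ L²`. -/
def IsSolution (f : ℝ → ℝ) (u : EnergySpace c) : Prop :=
  ∀ ψ : 𝓢(Plane, ℂ),
    (c : ℂ) * (∫ z, (u z : ℂ) * (∂_{(EuclideanSpace.single 0 1 : Plane)} ψ) z)
      - (∫ z, hilbertTransform u.toL2 z * (Δ ψ) z)
      - (∫ z, (f (u z) : ℂ) * (∂_{(EuclideanSpace.single 0 1 : Plane)} ψ) z) = 0

/-- A ground state: a nontrivial solution of least action among all nontrivial solutions. -/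
def IsGroundState [Fact (0 < c)] (f : ℝ → ℝ) (u : EnergySpace c) : Prop :=
  u ≠ 0 ∧ IsSolution f u ∧
    ∀ v : EnergySpace c, v ≠ 0 → IsSolution f v → action f u ≤ action f v

end Shrira

end

open Shrira

/-! The equation is the x-derivative of the Euler–Lagrange equation of S. On the Fourier side
(|ζ|²/|ξ|)·ξ = sgn(ξ)|ζ|², so the energy scalar product with ∂_xψ is the linear part of the equation
tested with ψ (`ofReal_inner_xDeriv`, `weakResidual_toComplex`). Hence u is a solution exactly when
S'(u) vanishes on all ∂_xψ with ψ real Schwartz. These are dense in the energy space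
(`topologicalClosure_range_xDeriv`), so S'(u)u = 0 and every nontrivial solution lies on the Nehari
manifold. A minimizer of S on that manifold which is also a solution is therefore a ground state.

Along a ray, d/dt S(tu) = t⁻¹ I(tu), and by (A5) the sign of I(tu) changes exactly once, from plus
to minus. So each nonzero u has exactly one positive multiple on the manifold, and it maximizes S on
the ray (`action_smul_le`). Moreover I is positive near the origin and I ≤ 2S, so each mountain-pass
path crosses the manifold (`exists_mem_nehariManifold_of_path`). The equality of the three levels
follows.

For existence, f is only continuous and the manifold need not be C¹. The map u ↦ S(τ(u)u), with τ(u)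
the factor that projects u to the manifold, is studied on the unit sphere; τ only has to be
continuous. Ekeland's principle then gives a minimizing sequence of almost critical points
(`exists_almost_critical`), which is bounded by (A3) and bounded below in L^p.

Compactness comes from |ζ|²/|ξ| ≥ |ζ|: the norm controls H^{1/2}(ℝ²). Cutting at frequency R leaves
a low part of size √R pointwise and a high part of size R^{-1/2} in L². This splitting yields the
embedding in L^q for 2 < q < 4 (`exists_integral_rpow_le`), non-vanishing
(`exists_le_norm_lowPass`), and almost everywhere convergence along weakly convergent sequences
(`exists_subseq_tendsto_ae`). After translations the weak limit is nonzero and critical, and Fatou's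
lemma for ½ s f(s) - F(s) ≥ 0 bounds its action by the infimum (`exists_minimizer`). -/

noncomputable section

/-! ### Ekeland's principle and convergence of integrals. -/

/-- **Ekeland's variational principle** for a continuous function. -/
theorem exists_ekeland_point {X : Type*} [MetricSpace X] [CompleteSpace X] {Ψ : X → ℝ}
    (hΨ : Continuous Ψ) {m : ℝ} (hm : ∀ x, m ≤ Ψ x) {ε : ℝ} (hε : 0 < ε) (x₀ : X) :
    ∃ w, Ψ w ≤ Ψ x₀ ∧ ∀ v, Ψ w - ε * dist v w ≤ Ψ v := by
  -- The sets S x are the upper segments of Ekeland's order. The iteration moves to a point whose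
  -- segment is small, by choosing a value of Ψ close to the infimum over the current segment.
  let S : X → Set X := fun x => {y | Ψ y + ε * dist x y ≤ Ψ x}
  have hself : ∀ x, x ∈ S x := fun x => by simp [S]
  have htrans : ∀ x y z, y ∈ S x → z ∈ S y → z ∈ S x := by
    intro x y z hy hz
    simp only [S, mem_ofPred_eq] at *
    nlinarith [dist_triangle x y z]
  have hclosed : ∀ x, IsClosed (S x) := fun x =>
    isClosed_le (by fun_prop) continuous_const
  have hstep : ∀ (n : ℕ) (x : X), ∃ y ∈ S x, ∀ z ∈ S y, dist y z ≤ (1 / 2) ^ n := by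
    intro n x
    have hb : BddBelow (Ψ '' S x) := ⟨m, by rintro _ ⟨y, -, rfl⟩; exact hm y⟩
    have hne : (Ψ '' S x).Nonempty := ⟨_, x, hself x, rfl⟩
    have hδ : 0 < ε * (1 / 2) ^ n := by positivity
    obtain ⟨_, ⟨y, hy, rfl⟩, hlt⟩ := Real.lt_sInf_add_pos hne hδ
    refine ⟨y, hy, fun z hz => ?_⟩
    have h1 : sInf (Ψ '' S x) ≤ Ψ z := csInf_le hb ⟨z, htrans x y z hy hz, rfl⟩
    have h2 : Ψ z + ε * dist y z ≤ Ψ y := hz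
    by_contra! h3
    nlinarith [mul_lt_mul_of_pos_left h3 hε]
  choose next hnext hdist using hstep
  let x : ℕ → X := fun n => Nat.rec x₀ (fun k y => next k y) n
  have hx : ∀ n, x (n + 1) = next n (x n) := fun n => rfl
  have hmem : ∀ n k, x (n + k) ∈ S (x n) := by
    intro n k
    induction k with
    | zero => exact hself _
    | succ k ih =>
      refine htrans _ _ _ ih ?_
      rw [← add_assoc, hx]
      exact hnext _ _
  have hsmall : ∀ n, ∀ z ∈ S (x (n + 1)), dist (x (n + 1)) z ≤ (1 / 2) ^ n := fun n => by
    rw [hx]; exact hdist n (x n)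
  have hcau : CauchySeq (fun n => x (n + 1)) := by
    refine cauchySeq_of_le_geometric (1 / 2) 1 (by norm_num) fun n => ?_
    rw [one_mul]
    exact hsmall n _ (hmem (n + 1) 1)
  obtain ⟨w, hw⟩ := cauchySeq_tendsto_of_complete hcau
  have hwS : ∀ n, w ∈ S (x n) := by
    intro n
    refine (hclosed (x n)).mem_of_tendsto hw (eventually_atTop.2 ⟨n, fun k hk => ?_⟩)
    obtain ⟨j, rfl⟩ := Nat.exists_eq_add_of_le hk
    exact hmem n (j + 1)
  refine ⟨w, ?_, fun v => ?_⟩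
  · have h : Ψ w + ε * dist x₀ w ≤ Ψ x₀ := hwS 0
    nlinarith [dist_nonneg (x := x₀) (y := w)]
  -- A point v that violates the inequality belongs to S w, hence to every S (x n). Their diameters
  -- tend to zero, so x n also tends to v and v = w.
  · by_contra! h
    have hv : v ∈ S w := by
      simp only [S, mem_ofPred_eq, dist_comm w v]; linarith
    have hlim : Tendsto (fun n => x (n + 1)) atTop (𝓝 v) := by
      rw [tendsto_iff_dist_tendsto_zero]
      refine squeeze_zero (fun _ => dist_nonneg)
        (fun n => hsmall n v (htrans _ _ _ (hwS (n + 1)) hv)) ?_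
      exact tendsto_pow_atTop_nhds_zero_of_lt_one (by norm_num) (by norm_num)
    have : v = w := tendsto_nhds_unique hlim hw
    simp [this] at h

/-- Dominated convergence where the domination holds up to functions of small integral. -/
theorem tendsto_integral_of_dominated_up_to {α : Type*} [MeasurableSpace α] {ν : Measure α}
    {k : ℕ → α → ℝ} {k₀ : α → ℝ} (hk : ∀ n, Integrable (k n) ν) (hk₀ : Integrable k₀ ν)
    (hdom : ∀ δ > (0 : ℝ), ∃ (H : α → ℝ) (e : ℕ → α → ℝ), Integrable H ν ∧
      (∀ n, Integrable (e n) ν) ∧ (∀ n z, 0 ≤ e n z) ∧ (∀ᶠ n in atTop, ∫ z, e n z ∂ν ≤ δ) ∧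
      ∀ n, ∀ᵐ z ∂ν, |k n z - k₀ z| ≤ H z + e n z)
    (hlim : ∀ᵐ z ∂ν, Tendsto (fun n => k n z) atTop (𝓝 (k₀ z))) :
    Tendsto (fun n => ∫ z, k n z ∂ν) atTop (𝓝 (∫ z, k₀ z ∂ν)) := by
  have hdiff : ∀ n, Integrable (fun z => |k n z - k₀ z|) ν := fun n => ((hk n).sub hk₀).abs
  rw [Metric.tendsto_nhds]
  intro ε hε
  obtain ⟨H, e, hH, he, he0, helim, hbound⟩ := hdom (ε / 2) (half_pos hε)
  -- |k n - k₀| ≤ min(|k n - k₀|, |H|) + e n, and the minimum is dominated by |H| alone, so that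
  -- ordinary dominated convergence applies to it.
  have hmin : Tendsto (fun n => ∫ z, min |k n z - k₀ z| |H z| ∂ν) atTop (𝓝 0) := by
    rw [← integral_zero α ℝ (μ := ν)]
    refine tendsto_integral_of_dominated_convergence (fun z => |H z|)
      (fun n => ((hdiff n).inf hH.abs).aestronglyMeasurable) hH.abs (fun n => ?_) ?_
    · refine Eventually.of_forall fun z => ?_
      rw [Real.norm_of_nonneg (le_min (abs_nonneg _) (abs_nonneg _))]
      exact min_le_right _ _
    · filter_upwards [hlim] with z hz
      have h1 : Tendsto (fun n => |k n z - k₀ z|) atTop (𝓝 0) := by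
        simpa using (hz.sub_const (k₀ z)).abs
      exact squeeze_zero (fun n => le_min (abs_nonneg _) (abs_nonneg _))
        (fun n => min_le_left _ _) h1
  filter_upwards [helim, hmin.eventually (gt_mem_nhds (half_pos hε))] with n h1 h2
  have hi : Integrable (fun z => min |k n z - k₀ z| |H z|) ν := (hdiff n).inf hH.abs
  rw [Real.dist_eq, ← integral_sub (hk n) hk₀]
  have h3 : ∫ z, |k n z - k₀ z| ∂ν ≤ ∫ z, (min |k n z - k₀ z| |H z| + e n z) ∂ν := by
    refine integral_mono_ae (hdiff n) (hi.add (he n)) ?_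
    filter_upwards [hbound n] with z hz
    have := he0 n z
    rcases le_total |k n z - k₀ z| |H z| with h | h
    · simp only [min_eq_left h]; linarith
    · simp only [min_eq_right h]; linarith [le_abs_self (H z)]
  rw [integral_add hi (he n)] at h3
  linarith [abs_integral_le_integral_abs (f := fun z => k n z - k₀ z) (μ := ν)]

theorem abs_rpow_le_two_rpow_mul {p : ℝ} (hp : 0 ≤ p) (a b : ℝ) :
    |a| ^ p ≤ 2 ^ p * (|b| ^ p + |a - b| ^ p) := by
  have h1 : |a| ≤ 2 * max |b| |a - b| := by
    have : |a| ≤ |b| + |a - b| := by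
      calc |a| = |b + (a - b)| := by ring_nf
        _ ≤ _ := abs_add_le _ _
    linarith [le_max_left |b| |a - b|, le_max_right |b| |a - b|]
  have h2 : (max |b| |a - b|) ^ p ≤ |b| ^ p + |a - b| ^ p := by
    have := Real.rpow_nonneg (abs_nonneg b) p
    have := Real.rpow_nonneg (abs_nonneg (a - b)) p
    rcases le_total |b| |a - b| with h | h
    · rw [max_eq_right h]; linarith
    · rw [max_eq_left h]; linarith
  calc |a| ^ p ≤ (2 * max |b| |a - b|) ^ p := Real.rpow_le_rpow (abs_nonneg _) h1 hp
    _ = 2 ^ p * (max |b| |a - b|) ^ p := Real.mul_rpow (by norm_num) (by positivity)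
    _ ≤ _ := by gcongr

/-- Along sequences that converge in `L²` and in `Lᵖ`, the integrals of a continuous function of at
most quadratic and `p`-th power growth converge. -/
theorem tendsto_integral_comp_of_growth {α : Type*} [MeasurableSpace α] {ν : Measure α}
    {κ : ℝ → ℝ → ℝ} (hκ : Continuous fun q : ℝ × ℝ => κ q.1 q.2) {C p : ℝ} (hp : 0 < p)
    (hC : 0 ≤ C)
    (hgrowth : ∀ a b, |κ a b| ≤ C * (a ^ 2 + |a| ^ p + (b ^ 2 + |b| ^ p)))
    {u v : ℕ → Lp ℝ 2 ν} {u₀ v₀ : Lp ℝ 2 ν}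
    (hu : Tendsto u atTop (𝓝 u₀)) (hv : Tendsto v atTop (𝓝 v₀))
    (hup₀ : Integrable (fun z => |u₀ z| ^ p) ν) (hvp₀ : Integrable (fun z => |v₀ z| ^ p) ν)
    (hup : ∀ n, Integrable (fun z => |u n z - u₀ z| ^ p) ν)
    (hvp : ∀ n, Integrable (fun z => |v n z - v₀ z| ^ p) ν)
    (hupl : Tendsto (fun n => ∫ z, |u n z - u₀ z| ^ p ∂ν) atTop (𝓝 0))
    (hvpl : Tendsto (fun n => ∫ z, |v n z - v₀ z| ^ p ∂ν) atTop (𝓝 0)) :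
    Tendsto (fun n => ∫ z, κ (u n z) (v n z) ∂ν) atTop (𝓝 (∫ z, κ (u₀ z) (v₀ z) ∂ν)) := by
  have hsq : ∀ w : Lp ℝ 2 ν, Integrable (fun z => w z ^ 2) ν := fun w =>
    (Lp.memLp w).integrable_sq
  have hsqd : ∀ w w' : Lp ℝ 2 ν, Integrable (fun z => (w z - w' z) ^ 2) ν := fun w w' =>
    ((Lp.memLp w).sub (Lp.memLp w')).integrable_sq
  have hnsq : ∀ w w' : Lp ℝ 2 ν, ∫ z, (w z - w' z) ^ 2 ∂ν = ‖w - w'‖ ^ 2 := by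
    intro w w'
    rw [← real_inner_self_eq_norm_sq, L2.inner_def]
    refine integral_congr_ae ?_
    filter_upwards [Lp.coeFn_sub w w'] with z hz
    simp only [RCLike.inner_apply, conj_trivial, hz, Pi.sub_apply, sq]
  have hsql : ∀ {w : ℕ → Lp ℝ 2 ν} {w₀ : Lp ℝ 2 ν}, Tendsto w atTop (𝓝 w₀) →
      Tendsto (fun n => ∫ z, (w n z - w₀ z) ^ 2 ∂ν) atTop (𝓝 0) := by
    intro w w₀ hw
    simp only [hnsq]
    have := (tendsto_iff_norm_sub_tendsto_zero.1 hw).pow 2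
    simpa using this
  have hcomp : ∀ w w' : Lp ℝ 2 ν, AEStronglyMeasurable (fun z => κ (w z) (w' z)) ν := fun w w' =>
    hκ.comp_aestronglyMeasurable
      ((Lp.aestronglyMeasurable w).prodMk (Lp.aestronglyMeasurable w'))
  let H : α → ℝ := fun z => (1 + (2 + 2 ^ p)) * C *
    (u₀ z ^ 2 + |u₀ z| ^ p + (v₀ z ^ 2 + |v₀ z| ^ p))
  let e : ℕ → α → ℝ := fun n z => (2 + 2 ^ p) * C * ((u n z - u₀ z) ^ 2 + |u n z - u₀ z| ^ p +
    ((v n z - v₀ z) ^ 2 + |v n z - v₀ z| ^ p))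
  have h2p : (0 : ℝ) < 2 ^ p := by positivity
  have hH : Integrable H ν := (((hsq u₀).add hup₀).add ((hsq v₀).add hvp₀)).const_mul _
  have he : ∀ n, Integrable (e n) ν := fun n =>
    (((hsqd _ _).add (hup n)).add ((hsqd _ _).add (hvp n))).const_mul _
  -- The constant 2 + 2^p serves both powers: 2 for the squares, 2^p for the p-th powers.
  have hone : ∀ a b : ℝ, a ^ 2 + |a| ^ p ≤ (2 + 2 ^ p) * (b ^ 2 + |b| ^ p) +
      (2 + 2 ^ p) * ((a - b) ^ 2 + |a - b| ^ p) := by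
    intro a b
    have h1 := abs_rpow_le_two_rpow_mul hp.le a b
    have h3 : 0 ≤ |b| ^ p := by positivity
    have h4 : 0 ≤ |a - b| ^ p := by positivity
    have h5 : a ^ 2 ≤ 2 * b ^ 2 + 2 * (a - b) ^ 2 := by nlinarith [sq_nonneg (a - 2 * b)]
    nlinarith [mul_nonneg h2p.le (sq_nonneg b), mul_nonneg h2p.le (sq_nonneg (a - b))]
  have hk₀ : Integrable (fun z => κ (u₀ z) (v₀ z)) ν := by
    refine ((((hsq u₀).add hup₀).add ((hsq v₀).add hvp₀)).const_mul C).mono' (hcomp _ _) ?_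
    exact Eventually.of_forall fun z => hgrowth _ _
  have hbd : ∀ n z, |κ (u n z) (v n z) - κ (u₀ z) (v₀ z)| ≤ H z + e n z := by
    intro n z
    have h1 := hgrowth (u n z) (v n z)
    have h2 := hgrowth (u₀ z) (v₀ z)
    have h3 := mul_le_mul_of_nonneg_left (add_le_add (hone (u n z) (u₀ z)) (hone (v n z) (v₀ z))) hC
    have h4 := abs_sub (κ (u n z) (v n z)) (κ (u₀ z) (v₀ z))
    simp only [H, e]
    linarith
  have hk : ∀ n, Integrable (fun z => κ (u n z) (v n z)) ν := by
    intro n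
    refine ((hH.add (he n)).add hk₀.abs).mono' (hcomp _ _) (Eventually.of_forall fun z => ?_)
    have := hbd n z
    have h2 := abs_sub_abs_le_abs_sub (κ (u n z) (v n z)) (κ (u₀ z) (v₀ z))
    simp only [Pi.add_apply, Real.norm_eq_abs]
    linarith
  have helim : Tendsto (fun n => ∫ z, e n z ∂ν) atTop (𝓝 0) := by
    have h1 : ∀ n, ∫ z, e n z ∂ν = (2 + 2 ^ p) * C * ((∫ z, (u n z - u₀ z) ^ 2 ∂ν) +
        (∫ z, |u n z - u₀ z| ^ p ∂ν) + ((∫ z, (v n z - v₀ z) ^ 2 ∂ν) +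
        ∫ z, |v n z - v₀ z| ^ p ∂ν)) := by
      intro n
      simp only [e]
      have i1 : Integrable (fun z => (u n z - u₀ z) ^ 2 + |u n z - u₀ z| ^ p) ν :=
        (hsqd _ _).add (hup n)
      have i2 : Integrable (fun z => (v n z - v₀ z) ^ 2 + |v n z - v₀ z| ^ p) ν :=
        (hsqd _ _).add (hvp n)
      rw [integral_const_mul, integral_add i1 i2, integral_add (hsqd _ _) (hup n),
        integral_add (hsqd _ _) (hvp n)]
    simp only [h1]
    simpa using (((hsql hu).add hupl).add ((hsql hv).add hvpl)).const_mul ((2 + 2 ^ p) * C)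
  have he0 : ∀ n z, 0 ≤ e n z := fun n z => by simp only [e]; positivity
  have hmeas : ∀ {w : ℕ → Lp ℝ 2 ν} {w₀ : Lp ℝ 2 ν}, Tendsto w atTop (𝓝 w₀) →
      TendstoInMeasure ν (fun n => (w n : α → ℝ)) atTop w₀ := fun hw =>
    tendstoInMeasure_of_tendsto_Lp hw
  -- Almost everywhere convergence is only available along subsequences, which is enough because the
  -- limit of the integrals is the same for all of them.
  refine tendsto_of_subseq_tendsto fun ns hns => ?_
  obtain ⟨ms, hms, hams⟩ := (hmeas (hu.comp hns)).exists_seq_tendsto_ae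
  obtain ⟨ls, hls, hals⟩ := (hmeas ((hv.comp hns).comp hms.tendsto_atTop)).exists_seq_tendsto_ae
  refine ⟨fun n => ms (ls n), ?_⟩
  have hσ : Tendsto (fun n => ns (ms (ls n))) atTop atTop :=
    hns.comp (hms.tendsto_atTop.comp hls.tendsto_atTop)
  refine tendsto_integral_of_dominated_up_to (fun n => hk _) hk₀ (fun δ hδ => ⟨H,
    fun n => e (ns (ms (ls n))), hH, fun n => he _, fun n z => he0 _ z,
    ((helim.comp hσ).eventually (gt_mem_nhds hδ)).mono fun n h => le_of_lt h,
    fun n => Eventually.of_forall fun z => hbd _ z⟩) ?_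
  filter_upwards [hams, hals] with z h1 h2
  exact (hκ.tendsto (u₀ z, v₀ z)).comp ((h1.comp hls.tendsto_atTop).prodMk_nhds h2)

end

/-! ### The Fourier transform on L²: duality, reflection and translation. -/

noncomputable section

namespace Shrira

open scoped ContDiff

theorem integral_schwartz_mul_fourier (ψ : 𝓢(Plane, ℂ)) (g : L2C) :
    ∫ ζ, ψ ζ * (𝓕 g : L2C) ζ = ∫ z, 𝓕 ψ z * g z := by
  have h := DFunLike.congr_fun (Lp.fourier_toTemperedDistribution_eq (E := Plane) (F := ℂ) g) ψ
  rw [TemperedDistribution.fourier_apply, Lp.toTemperedDistribution_apply,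
    Lp.toTemperedDistribution_apply] at h
  simpa only [smul_eq_mul] using h.symm

theorem integral_schwartz_mul_fourierInv (ψ : 𝓢(Plane, ℂ)) (g : L2C) :
    ∫ ζ, ψ ζ * (𝓕⁻ g : L2C) ζ = ∫ z, 𝓕⁻ ψ z * g z := by
  have h := integral_schwartz_mul_fourier (𝓕⁻ ψ) (𝓕⁻ g)
  simpa using h.symm

theorem ae_eq_of_integral_schwartz_mul_eq {g₁ g₂ : Plane → ℂ} (h₁ : LocallyIntegrable g₁)
    (h₂ : LocallyIntegrable g₂) (h : ∀ ψ : 𝓢(Plane, ℂ), ∫ z, ψ z * g₁ z = ∫ z, ψ z * g₂ z) :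
    g₁ =ᵐ[volume] g₂ := by
  refine ae_eq_of_integral_contDiff_smul_eq h₁ h₂ fun g hg hc => ?_
  have hc' : HasCompactSupport (Complex.ofRealCLM ∘ g) := hc.comp_left rfl
  have hg' : ContDiff ℝ ∞ (Complex.ofRealCLM ∘ g) := by fun_prop
  simpa [Complex.real_smul] using h (hc'.toSchwartzMap hg')

theorem locallyIntegrable_L2C (g : L2C) : LocallyIntegrable (g : Plane → ℂ) :=
  (Lp.memLp g).locallyIntegrable (by norm_num)

/-- The `L²` inverse Fourier transform of a function that is also integrable is given by the
Fourier integral. -/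
theorem fourierInv_ae_eq_integral {g : L2C} {G : Plane → ℂ} (hgG : (g : Plane → ℂ) =ᵐ[volume] G)
    (hG : Integrable G) : ((𝓕⁻ g : L2C) : Plane → ℂ) =ᵐ[volume] 𝓕⁻ G := by
  have hcont : Continuous (𝓕⁻ G) := by
    have h := VectorFourier.fourierIntegral_continuous (L := innerₗ Plane)
      Real.continuous_fourierChar (by exact continuous_inner) hG
    have e : 𝓕⁻ G = fun z => (VectorFourier.fourierIntegral Real.fourierChar volume
      (innerₗ Plane) G) (-z) := by
      funext z
      rw [Real.fourierInv_eq_fourier_neg]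
      rfl
    rw [e]
    exact h.comp continuous_neg
  refine ae_eq_of_integral_schwartz_mul_eq (locallyIntegrable_L2C _) hcont.locallyIntegrable
    fun ψ => ?_
  rw [integral_schwartz_mul_fourierInv]
  have e1 : ∫ z, 𝓕⁻ ψ z * g z = ∫ z, 𝓕⁻ ψ z * G z := by
    refine integral_congr_ae ?_
    filter_upwards [hgG] with z hz
    rw [hz]
  rw [e1]
  -- The duality is applied to G(-·), whose Fourier integral is the inverse transform of G; the
  -- reflection is removed at the end by z ↦ -z.
  have h := VectorFourier.integral_bilin_fourierIntegral_eq_flip (ContinuousLinearMap.mul ℂ ℂ)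
    (μ := volume) (ν := volume) (L := innerₗ Plane)
    Real.continuous_fourierChar continuous_inner ψ.integrable hG.comp_neg
  have e2 : ∀ z, VectorFourier.fourierIntegral Real.fourierChar volume (innerₗ Plane) ψ z
      = 𝓕⁻ ψ (-z) := by
    intro z
    rw [SchwartzMap.fourierInv_coe, Real.fourierInv_eq_fourier_neg, neg_neg]
    rfl
  have e3 : ∀ z, VectorFourier.fourierIntegral Real.fourierChar volume (innerₗ Plane).flip
      (fun x => G (-x)) z = 𝓕⁻ G z := by
    intro z
    rw [Real.fourierInv_eq_fourier_comp_neg]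
    simp only [flip_innerₗ]
    rfl
  simp only [e2, ContinuousLinearMap.mul_apply', e3] at h
  rw [← h, ← integral_neg_eq_self]

/-- The inclusion of the real in the complex `L²` functions. -/
def complexify (u : L2R) : L2C := (Complex.ofRealCLM.compLpL 2 (volume : Measure Plane)) u

theorem coeFn_complexify (u : L2R) : (complexify u : Plane → ℂ) =ᵐ[volume] fun z => (u z : ℂ) :=
  ContinuousLinearMap.coeFn_compLpL _ _

theorem fourierL2_eq (u : L2R) : fourierL2 u = 𝓕 (complexify u) := rfl

theorem integral_schwartz_mul_fourierL2 (ψ : 𝓢(Plane, ℂ)) (u : L2R) :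
    ∫ ζ, ψ ζ * fourierL2 u ζ = ∫ z, 𝓕 ψ z * (u z : ℂ) := by
  rw [fourierL2_eq, integral_schwartz_mul_fourier]
  refine integral_congr_ae ?_
  filter_upwards [coeFn_complexify u] with z hz
  rw [hz]

theorem norm_complexify (u : L2R) : ‖complexify u‖ = ‖u‖ := by
  refine le_antisymm (Lp.norm_le_norm_of_ae_le ?_) (Lp.norm_le_norm_of_ae_le ?_) <;>
  · filter_upwards [coeFn_complexify u] with z hz
    simp [hz]

theorem norm_fourierL2 (u : L2R) : ‖fourierL2 u‖ = ‖u‖ := by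
  rw [fourierL2_eq, Lp.norm_fourier_eq, norm_complexify]

theorem fourierL2_ae_eq {u : L2R} {G : Plane → ℂ} (hG : LocallyIntegrable G)
    (h : ∀ ψ : 𝓢(Plane, ℂ), ∫ ζ, ψ ζ * G ζ = ∫ z, 𝓕 ψ z * (u z : ℂ)) :
    (fourierL2 u : Plane → ℂ) =ᵐ[volume] G :=
  ae_eq_of_integral_schwartz_mul_eq (locallyIntegrable_L2C _) hG fun ψ => by
    rw [h, integral_schwartz_mul_fourierL2]

/-- The Fourier transform of a real function is Hermitian. -/
theorem fourierL2_neg_ae (u : L2R) :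
    ∀ᵐ ζ : Plane, fourierL2 u (-ζ) = starRingEnd ℂ (fourierL2 u ζ) := by
  have hmem : MemLp (fun ζ : Plane => starRingEnd ℂ (fourierL2 u (-ζ))) 2 volume :=
    ((Lp.memLp (fourierL2 u)).comp_measurePreserving (Measure.measurePreserving_neg volume)).star
  have key : (fourierL2 u : Plane → ℂ) =ᵐ[volume]
      fun ζ => starRingEnd ℂ (fourierL2 u (-ζ)) := by
    refine fourierL2_ae_eq (hmem.locallyIntegrable (by norm_num)) fun ψ => ?_
    -- χ(ζ) is the conjugate of ψ(-ζ), so that 𝓕χ is the conjugate of 𝓕ψ. Since u is real,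
    -- conjugating the duality identity for χ gives the one required for ψ.
    let χ : 𝓢(Plane, ℂ) := SchwartzMap.compCLMOfContinuousLinearEquiv ℝ
      (ContinuousLinearEquiv.neg ℝ) (SchwartzMap.postcompCLM (Complex.conjCLE : ℂ →L[ℝ] ℂ) ψ)
    have hχ : ∀ ζ, χ ζ = starRingEnd ℂ (ψ (-ζ)) := fun ζ => rfl
    have hFχ : ∀ z, 𝓕 χ z = starRingEnd ℂ (𝓕 ψ z) := by
      intro z
      rw [SchwartzMap.fourier_coe, SchwartzMap.fourier_coe, Real.fourier_eq', Real.fourier_eq',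
        ← integral_conj, ← integral_neg_eq_self]
      refine integral_congr_ae (Eventually.of_forall fun x => ?_)
      simp only [hχ, smul_eq_mul, map_mul, neg_neg, ← Complex.exp_conj, inner_neg_left]
      have h2 : (starRingEnd ℂ) 2 = 2 := Complex.conj_ofNat 2
      simp [h2]
    have h := integral_schwartz_mul_fourierL2 χ u
    rw [← integral_neg_eq_self] at h
    simp only [hχ, hFχ, neg_neg] at h
    have h' := congrArg (starRingEnd ℂ) h
    rw [← integral_conj, ← integral_conj] at h'
    simpa using h'
  filter_upwards [key] with ζ hζ
  rw [hζ, Complex.conj_conj]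

/-- The translation `u ↦ u(· + a)` of `L²`. -/
def translateL2 (a : Plane) : L2R →ₗᵢ[ℝ] L2R :=
  Lp.compMeasurePreservingₗᵢ ℝ (· + a) (measurePreserving_add_right volume a)

theorem coeFn_translateL2 (a : Plane) (u : L2R) :
    (translateL2 a u : Plane → ℝ) =ᵐ[volume] fun z => u (z + a) :=
  Lp.coeFn_compMeasurePreserving _ _

/-- The character `ζ ↦ e^{2πi ζ·a}`. -/
def character (a ζ : Plane) : ℂ := (Real.fourierChar (inner ℝ ζ a) : ℂ)

theorem norm_character (a ζ : Plane) : ‖character a ζ‖ = 1 := Circle.norm_coe _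

theorem continuous_character (a : Plane) : Continuous (character a) :=
  continuous_subtype_val.comp (Real.continuous_fourierChar.comp (by fun_prop))

theorem fourierL2_translateL2 (a : Plane) (u : L2R) :
    (fourierL2 (translateL2 a u) : Plane → ℂ) =ᵐ[volume]
      fun ζ => character a ζ * fourierL2 u ζ := by
  have hmem : MemLp (fun ζ : Plane => character a ζ * fourierL2 u ζ) 2 volume :=
    (Lp.memLp (fourierL2 u)).of_le
      ((continuous_character a).aestronglyMeasurable.mul (Lp.aestronglyMeasurable _))
      (Eventually.of_forall fun ζ => by rw [norm_mul, norm_character, one_mul])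
  refine fourierL2_ae_eq (hmem.locallyIntegrable (by norm_num)) fun ψ => ?_
  -- χ is ψ times the character. Its definition through a shift of 𝓕ψ makes it a Schwartz function
  -- at once.
  let χ : 𝓢(Plane, ℂ) := 𝓕⁻ (SchwartzMap.compSubConstCLM ℂ a (𝓕 ψ))
  have hFχ : ∀ z, 𝓕 χ z = 𝓕 ψ (z - a) := fun z => by simp [χ]
  have hχ : ∀ ζ, χ ζ = ψ ζ * character a ζ := by
    intro ζ
    have h1 : 𝓕⁻ (𝓕 ψ) = ψ := FourierTransform.fourierInv_fourier_eq ψ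
    have h2 : ψ ζ = 𝓕⁻ (𝓕 ψ) ζ := by rw [h1]
    rw [h2]
    simp only [χ]
    rw [SchwartzMap.fourierInv_coe, SchwartzMap.fourierInv_coe, Real.fourierInv_eq',
      Real.fourierInv_eq', ← integral_mul_const, ← integral_add_right_eq_self _ a]
    refine integral_congr_ae (Eventually.of_forall fun x => ?_)
    simp only [SchwartzMap.compSubConstCLM_apply, add_sub_cancel_right, smul_eq_mul, character,
      Real.fourierChar_apply, inner_add_left, real_inner_comm ζ a]
    rw [mul_right_comm (Complex.exp _), ← Complex.exp_add]
    congr 2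
    push_cast
    ring
  have h := integral_schwartz_mul_fourierL2 χ u
  simp only [hχ, hFχ] at h
  simp only [← mul_assoc]
  rw [h, ← integral_add_right_eq_self _ a]
  refine integral_congr_ae ?_
  filter_upwards [coeFn_translateL2 a u] with z hz
  rw [hz, add_sub_cancel_right]

end Shrira

/-! ### The energy space as a separable Hilbert space that controls H^{1/2}. -/

namespace Shrira

theorem norm_sq_eq_integral_L2C (g : L2C) : ‖g‖ ^ 2 = ∫ z, ‖g z‖ ^ 2 := by
  have h : ‖g‖ ^ 2 = (inner ℂ g g).re := (inner_self_eq_norm_sq (𝕜 := ℂ) g).symm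
  rw [h, L2.inner_def, ← RCLike.re_eq_complex_re, ← integral_re (L2.integrable_inner g g)]
  refine integral_congr_ae (Eventually.of_forall fun z => ?_)
  exact inner_self_eq_norm_sq (𝕜 := ℂ) (g z)

theorem norm_sq_eq_integral_L2R (g : L2R) : ‖g‖ ^ 2 = ∫ z, g z ^ 2 := by
  rw [← real_inner_self_eq_norm_sq, L2.inner_def]
  refine integral_congr_ae (Eventually.of_forall fun z => ?_)
  simp [sq]

theorem integrable_norm_sq_L2C (g : L2C) : Integrable fun z => ‖g z‖ ^ 2 :=
  (Lp.memLp g).integrable_norm_pow (by norm_num)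

theorem integrable_sq_L2R (g : L2R) : Integrable fun z => g z ^ 2 := (Lp.memLp g).integrable_sq

theorem fourier_multiplier_ae {m : Plane → ℂ} (u : multiplierDomain m) :
    ((𝓕 (multiplier m u) : L2C) : Plane → ℂ) =ᵐ[volume] fun ζ => m ζ * fourierL2 u ζ := by
  have h : 𝓕 (multiplier m u) = ((multiplierDomain_memLp u.2).toLp : L2C) :=
    FourierTransform.fourier_fourierInv_eq _
  rw [h]
  exact MemLp.coeFn_toLp _

variable {c : ℝ}

theorem memLp_symbolHalf (u : EnergySpace c) :
    MemLp (fun ζ => symbolHalf ζ * fourierL2 u.toL2 ζ) 2 volume := u.2.1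

theorem memLp_symbolNegHalfDy (u : EnergySpace c) :
    MemLp (fun ζ => symbolNegHalfDy ζ * fourierL2 u.toL2 ζ) 2 volume := u.2.2

theorem fourier_halfDx_ae (u : EnergySpace c) :
    ((𝓕 (halfDx u) : L2C) : Plane → ℂ) =ᵐ[volume] fun ζ => symbolHalf ζ * fourierL2 u.toL2 ζ :=
  fourier_multiplier_ae _

theorem fourier_negHalfDxDy_ae (u : EnergySpace c) :
    ((𝓕 (negHalfDxDy u) : L2C) : Plane → ℂ) =ᵐ[volume]
      fun ζ => symbolNegHalfDy ζ * fourierL2 u.toL2 ζ :=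
  fourier_multiplier_ae _

theorem norm_halfDx_sq (u : EnergySpace c) :
    ‖halfDx u‖ ^ 2 = ∫ ζ, ‖symbolHalf ζ * fourierL2 u.toL2 ζ‖ ^ 2 := by
  rw [← Lp.norm_fourier_eq, norm_sq_eq_integral_L2C]
  refine integral_congr_ae ?_
  filter_upwards [fourier_halfDx_ae u] with ζ h
  rw [h]

theorem norm_negHalfDxDy_sq (u : EnergySpace c) :
    ‖negHalfDxDy u‖ ^ 2 = ∫ ζ, ‖symbolNegHalfDy ζ * fourierL2 u.toL2 ζ‖ ^ 2 := by
  rw [← Lp.norm_fourier_eq, norm_sq_eq_integral_L2C]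
  refine integral_congr_ae ?_
  filter_upwards [fourier_negHalfDxDy_ae u] with ζ h
  rw [h]

theorem EnergySpace.toL2_injective : Function.Injective (EnergySpace.toL2 (c := c)) :=
  Subtype.val_injective

/-- The element of the energy space given by an `L²` function in both multiplier domains. -/
def EnergySpace.mk (u : L2R) (h₁ : MemLp (fun ζ => symbolHalf ζ * fourierL2 u ζ) 2 volume)
    (h₂ : MemLp (fun ζ => symbolNegHalfDy ζ * fourierL2 u ζ) 2 volume) : EnergySpace c :=
  ⟨u, h₁, h₂⟩

@[simp] theorem EnergySpace.toL2_mk (u : L2R) (h₁ h₂) :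
    (EnergySpace.mk u h₁ h₂ : EnergySpace c).toL2 = u := rfl

/-- At ξ = 0 the factor |2πξ|^{-1/2} has the default value 0. Identities that need ξ ≠ 0 therefore
fail at most on this line, which is a null set. -/
theorem ae_coord_zero_ne_zero : ∀ᵐ ζ : Plane, ζ 0 ≠ 0 := by
  have h := Measure.addHaar_submodule (volume : Measure Plane)
    (LinearMap.ker (EuclideanSpace.proj 0 : Plane →L[ℝ] ℝ).toLinearMap) (by
      intro h
      have h1 : (EuclideanSpace.single 0 1 : Plane) ∈
        LinearMap.ker (EuclideanSpace.proj 0 : Plane →L[ℝ] ℝ).toLinearMap := by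
        rw [h]; trivial
      simp at h1)
  rw [ae_iff]
  convert h using 2
  ext ζ
  simp

theorem norm_sq_plane (ζ : Plane) : ‖ζ‖ ^ 2 = ζ 0 ^ 2 + ζ 1 ^ 2 := by
  simp [EuclideanSpace.norm_sq_eq, Fin.sum_univ_two]

theorem norm_symbolHalf_sq (ζ : Plane) : ‖symbolHalf ζ‖ ^ 2 = 2 * Real.pi * |ζ 0| := by
  have h0 : (0 : ℝ) ≤ |2 * Real.pi * ζ 0| := abs_nonneg _
  rw [symbolHalf, Complex.norm_real, Real.norm_of_nonneg (Real.rpow_nonneg h0 _),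
    ← Real.rpow_mul_natCast h0]
  norm_num [abs_mul, abs_of_pos Real.pi_pos]

/-- No condition on ξ is needed: at ξ = 0 both sides vanish by the conventions for powers of zero
and division by zero. -/
theorem norm_symbolNegHalfDy_sq (ζ : Plane) :
    ‖symbolNegHalfDy ζ‖ ^ 2 = 2 * Real.pi * (ζ 1 ^ 2 / |ζ 0|) := by
  have h0 : (0 : ℝ) ≤ |2 * Real.pi * ζ 0| := abs_nonneg _
  rw [symbolNegHalfDy, norm_mul, mul_pow, Complex.norm_real,
    Real.norm_of_nonneg (Real.rpow_nonneg h0 _), ← Real.rpow_mul_natCast h0]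
  have h1 : -(1 / 2 : ℝ) * ((2 : ℕ) : ℝ) = -1 := by norm_num
  rw [h1, Real.rpow_neg_one]
  simp only [norm_mul, Complex.norm_ofNat, Complex.norm_real, Complex.norm_I, Real.norm_eq_abs,
    abs_mul, abs_of_pos Real.pi_pos, mul_one, mul_pow, sq_abs, abs_two]
  have := Real.pi_pos
  field_simp

theorem norm_symbols_sq_add {ζ : Plane} (h : ζ 0 ≠ 0) :
    ‖symbolHalf ζ‖ ^ 2 + ‖symbolNegHalfDy ζ‖ ^ 2 = 2 * Real.pi * (‖ζ‖ ^ 2 / |ζ 0|) := by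
  have h' : |ζ 0| ≠ 0 := abs_ne_zero.2 h
  rw [norm_symbolHalf_sq, norm_symbolNegHalfDy_sq, norm_sq_plane, add_div,
    ← sq_abs (ζ 0), pow_two |ζ 0|, mul_div_assoc, div_self h']
  ring

/-- Since |ξ| ≤ |ζ|, the symbol 2π|ζ|²/|ξ| dominates |ζ|. This is the source of the isotropic
H^{1/2} control, with critical exponent 4 in the plane. -/
theorem norm_le_norm_symbols_sq {ζ : Plane} (h : ζ 0 ≠ 0) :
    ‖ζ‖ ≤ ‖symbolHalf ζ‖ ^ 2 + ‖symbolNegHalfDy ζ‖ ^ 2 := by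
  have h' : 0 < |ζ 0| := abs_pos.2 h
  have h1 : |ζ 0| ≤ ‖ζ‖ := PiLp.norm_apply_le ζ 0
  rw [norm_symbols_sq_add h]
  have h2 : ‖ζ‖ ≤ ‖ζ‖ ^ 2 / |ζ 0| := by
    rw [le_div_iff₀ h']
    nlinarith [norm_nonneg ζ]
  nlinarith [Real.pi_gt_three, norm_nonneg ζ]

theorem measurable_symbolHalf : Measurable symbolHalf := by unfold symbolHalf; fun_prop

theorem measurable_symbolNegHalfDy : Measurable symbolNegHalfDy := by
  unfold symbolNegHalfDy; fun_prop

section Norm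
variable [hc : Fact (0 < c)]

theorem norm_toL2_sq_le (u : EnergySpace c) : ‖u.toL2‖ ^ 2 ≤ ‖u‖ ^ 2 / c := by
  rw [le_div_iff₀ hc.out, energy_norm_sq]
  nlinarith [sq_nonneg ‖halfDx u‖, sq_nonneg ‖negHalfDxDy u‖]

theorem norm_toL2_le (u : EnergySpace c) : ‖u.toL2‖ ≤ (Real.sqrt c)⁻¹ * ‖u‖ := by
  have h := norm_toL2_sq_le u
  have hs : 0 < Real.sqrt c := Real.sqrt_pos.2 hc.out
  refine le_of_sq_le_sq ?_ (by positivity)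
  rw [mul_pow, inv_pow, Real.sq_sqrt hc.out.le]
  rwa [div_eq_inv_mul] at h

theorem norm_halfDx_le (u : EnergySpace c) : ‖halfDx u‖ ≤ ‖u‖ := by
  refine le_of_sq_le_sq ?_ (norm_nonneg _)
  rw [energy_norm_sq]
  nlinarith [mul_nonneg hc.out.le (sq_nonneg ‖u.toL2‖), sq_nonneg ‖negHalfDxDy u‖]

theorem norm_negHalfDxDy_le (u : EnergySpace c) : ‖negHalfDxDy u‖ ≤ ‖u‖ := by
  refine le_of_sq_le_sq ?_ (norm_nonneg _)
  rw [energy_norm_sq]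
  nlinarith [mul_nonneg hc.out.le (sq_nonneg ‖u.toL2‖), sq_nonneg ‖halfDx u‖]

theorem weighted_fourier_bound (u : EnergySpace c) :
    Integrable (fun ζ : Plane => ‖ζ‖ * ‖fourierL2 u.toL2 ζ‖ ^ 2) ∧
      ∫ ζ : Plane, ‖ζ‖ * ‖fourierL2 u.toL2 ζ‖ ^ 2 ≤ ‖u‖ ^ 2 := by
  have i1 := (memLp_symbolHalf u).integrable_norm_pow (by norm_num)
  have i2 := (memLp_symbolNegHalfDy u).integrable_norm_pow (by norm_num)
  have hle : ∀ᵐ ζ : Plane, ‖ζ‖ * ‖fourierL2 u.toL2 ζ‖ ^ 2 ≤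
      ‖symbolHalf ζ * fourierL2 u.toL2 ζ‖ ^ 2 + ‖symbolNegHalfDy ζ * fourierL2 u.toL2 ζ‖ ^ 2 := by
    filter_upwards [ae_coord_zero_ne_zero] with ζ hζ
    rw [norm_mul, norm_mul, mul_pow, mul_pow, ← add_mul]
    exact mul_le_mul_of_nonneg_right (norm_le_norm_symbols_sq hζ) (sq_nonneg _)
  have hmeas : AEStronglyMeasurable (fun ζ : Plane => ‖ζ‖ * ‖fourierL2 u.toL2 ζ‖ ^ 2) volume :=
    continuous_norm.aestronglyMeasurable.mul ((Lp.aestronglyMeasurable _).norm.pow 2)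
  have hint : Integrable (fun ζ : Plane => ‖ζ‖ * ‖fourierL2 u.toL2 ζ‖ ^ 2) := by
    refine (i1.add i2).mono' hmeas ?_
    filter_upwards [hle] with ζ h
    rwa [Real.norm_of_nonneg (by positivity)]
  refine ⟨hint, (integral_mono_ae hint (i1.add i2) hle).trans ?_⟩
  have e : ∫ ζ, ((fun ζ => ‖symbolHalf ζ * fourierL2 u.toL2 ζ‖ ^ 2) + fun ζ =>
      ‖symbolNegHalfDy ζ * fourierL2 u.toL2 ζ‖ ^ 2) ζ = ‖halfDx u‖ ^ 2 + ‖negHalfDxDy u‖ ^ 2 := by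
    rw [norm_halfDx_sq, norm_negHalfDxDy_sq]
    exact integral_add i1 i2
  refine e.le.trans ?_
  rw [energy_norm_sq]
  nlinarith [mul_nonneg hc.out.le (sq_nonneg ‖u.toL2‖)]

/-- The inclusion of the energy space in `L²` as a continuous linear map. -/
def toL2CLM : EnergySpace c →L[ℝ] L2R :=
  LinearMap.mkContinuous EnergySpace.toL2 (Real.sqrt c)⁻¹ norm_toL2_le

/-- The map `u ↦ (u, D_x^{1/2} u, D_x^{-1/2} u_y)`. -/
def energyEmbedding : EnergySpace c →L[ℝ] L2R × L2C × L2C :=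
  toL2CLM.prod ((LinearMap.mkContinuous halfDx 1 (by simpa using norm_halfDx_le)).prod
    (LinearMap.mkContinuous negHalfDxDy 1 (by simpa using norm_negHalfDxDy_le)))

theorem energyEmbedding_apply (u : EnergySpace c) :
    energyEmbedding u = (u.toL2, halfDx u, negHalfDxDy u) := rfl

theorem norm_le_energyEmbedding (u : EnergySpace c) :
    ‖u‖ ≤ Real.sqrt (c + 2) * ‖energyEmbedding u‖ := by
  refine le_of_sq_le_sq ?_ (by positivity)
  have h1 : ‖u.toL2‖ ≤ ‖energyEmbedding u‖ := norm_fst_le (energyEmbedding u)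
  have h2 : ‖halfDx u‖ ≤ ‖energyEmbedding u‖ :=
    (norm_fst_le (energyEmbedding u).2).trans (norm_snd_le (energyEmbedding u))
  have h3 : ‖negHalfDxDy u‖ ≤ ‖energyEmbedding u‖ :=
    (norm_snd_le (energyEmbedding u).2).trans (norm_snd_le (energyEmbedding u))
  have hcp := hc.out
  rw [mul_pow, Real.sq_sqrt (by linarith), energy_norm_sq]
  have e1 := pow_le_pow_left₀ (norm_nonneg _) h1 2
  have e2 := pow_le_pow_left₀ (norm_nonneg _) h2 2
  have e3 := pow_le_pow_left₀ (norm_nonneg _) h3 2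
  nlinarith

theorem antilipschitz_energyEmbedding :
    AntilipschitzWith (Real.sqrt (c + 2)).toNNReal (energyEmbedding (c := c)) :=
  AddMonoidHomClass.antilipschitz_of_bound _ fun u => by
    rw [Real.coe_toNNReal _ (Real.sqrt_nonneg _)]
    exact norm_le_energyEmbedding u

/-- Inherited through `energyEmbedding` from a product of separable L² spaces. Separability is used
for sequential weak compactness. -/
instance : SecondCountableTopology (EnergySpace c) := by
  have : Fact ((2 : ENNReal) ≠ ⊤) := ⟨by norm_num⟩
  have h1 : SecondCountableTopology L2R := inferInstance
  have h2 : SecondCountableTopology L2C := inferInstance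
  have h3 : SecondCountableTopology (L2C × L2C) := inferInstance
  exact (antilipschitz_energyEmbedding.isUniformInducing
    energyEmbedding.uniformContinuous).isInducing.secondCountableTopology

/-- A multiplication operator is closed: pass to subsequences that converge almost everywhere on the
frequency side and compare the limits pointwise. -/
theorem multiplier_closed {m : Plane → ℂ} {u : ℕ → multiplierDomain m} {u₀ : L2R} {w : L2C}
    (hu : Tendsto (fun n => (u n : L2R)) atTop (𝓝 u₀))
    (hw : Tendsto (fun n => multiplier m (u n)) atTop (𝓝 w)) :
    ((𝓕 w : L2C) : Plane → ℂ) =ᵐ[volume] fun ζ => m ζ * fourierL2 u₀ ζ := by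
  have h1 : Tendsto (fun n => fourierL2 (u n)) atTop (𝓝 (fourierL2 u₀)) :=
    (((FourierTransform.fourierCLM ℂ L2C).continuous.comp
      (Complex.ofRealCLM.compLpL 2 (volume : Measure Plane)).continuous).tendsto u₀).comp hu
  have h2 : Tendsto (fun n => (𝓕 (multiplier m (u n)) : L2C)) atTop (𝓝 (𝓕 w)) :=
    ((FourierTransform.fourierCLM ℂ L2C).continuous.tendsto w).comp hw
  obtain ⟨ns, hns, h3⟩ := (tendstoInMeasure_of_tendsto_Lp h1).exists_seq_tendsto_ae
  obtain ⟨ms, hms, h4⟩ :=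
    (tendstoInMeasure_of_tendsto_Lp (h2.comp hns.tendsto_atTop)).exists_seq_tendsto_ae
  have h5 : ∀ᵐ ζ, ∀ n, (𝓕 (multiplier m (u n)) : L2C) ζ = m ζ * fourierL2 (u n) ζ :=
    ae_all_iff.2 fun n => fourier_multiplier_ae (u n)
  filter_upwards [h3, h4, h5] with ζ a3 a4 a5
  refine tendsto_nhds_unique a4 ?_
  simp only [Function.comp_apply, a5]
  exact (a3.comp hms.tendsto_atTop).const_mul (m ζ)

instance : CompleteSpace (EnergySpace c) := by
  refine Metric.complete_of_cauchySeq_tendsto fun u hu => ?_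
  have hcau : CauchySeq (fun n => energyEmbedding (u n)) :=
    (energyEmbedding (c := c)).uniformContinuous.comp_cauchySeq hu
  obtain ⟨⟨u₀, w₁, w₂⟩, hlim⟩ := cauchySeq_tendsto_of_complete hcau
  have hu0 : Tendsto (fun n => (u n).toL2) atTop (𝓝 u₀) := (continuous_fst.tendsto _).comp hlim
  have hw1 : Tendsto (fun n => halfDx (u n)) atTop (𝓝 w₁) :=
    ((continuous_fst.comp continuous_snd).tendsto _).comp hlim
  have hw2 : Tendsto (fun n => negHalfDxDy (u n)) atTop (𝓝 w₂) :=
    ((continuous_snd.comp continuous_snd).tendsto _).comp hlim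
  have m1 := multiplier_closed (m := symbolHalf)
    (u := fun n => Submodule.inclusion inf_le_left (u n)) hu0 hw1
  have m2 := multiplier_closed (m := symbolNegHalfDy)
    (u := fun n => Submodule.inclusion inf_le_right (u n)) hu0 hw2
  -- The limit lies in both multiplier domains because its products with the symbols agree almost
  -- everywhere with the L² functions 𝓕 w₁ and 𝓕 w₂.
  let v : EnergySpace c := EnergySpace.mk u₀ ((Lp.memLp _).ae_eq m1) ((Lp.memLp _).ae_eq m2)
  have hv1 : halfDx v = w₁ := by
    apply (Lp.fourierTransformₗᵢ Plane ℂ).injective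
    exact Lp.ext ((fourier_halfDx_ae v).trans m1.symm)
  have hv2 : negHalfDxDy v = w₂ := by
    apply (Lp.fourierTransformₗᵢ Plane ℂ).injective
    exact Lp.ext ((fourier_negHalfDxDy_ae v).trans m2.symm)
  refine ⟨v, ((antilipschitz_energyEmbedding.isUniformInducing
    energyEmbedding.uniformContinuous).isInducing.tendsto_nhds_iff).2 ?_⟩
  have e : energyEmbedding v = (u₀, w₁, w₂) := by rw [energyEmbedding_apply, hv1, hv2]; rfl
  rw [e]
  exact hlim

end Norm

end Shrira

/-! ### Frequency truncation and the embedding in L^q, 2 < q < 4. -/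

namespace Shrira

variable {c : ℝ}

/-- The Fourier transform of real `L²` functions as a continuous linear map. -/
def fourierL2CLM : L2R →L[ℝ] L2C :=
  ((FourierTransform.fourierCLM ℂ L2C).restrictScalars ℝ).comp
    (Complex.ofRealCLM.compLpL 2 (volume : Measure Plane))

/-- The part of `û` with frequencies in the ball of radius `R`. -/
def cutFourier (R : ℝ) (u : L2R) : Plane → ℂ := (Metric.ball (0 : Plane) R).indicator (fourierL2 u)

theorem memLp_cutFourier (R : ℝ) (u : L2R) : MemLp (cutFourier R u) 2 volume :=
  (Lp.memLp _).indicator measurableSet_ball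

theorem integrable_cutFourier (R : ℝ) (u : L2R) : Integrable (cutFourier R u) := by
  have h : IntegrableOn (fourierL2 u : Plane → ℂ) (Metric.ball (0 : Plane) R) := by
    have : IsFiniteMeasure (volume.restrict (Metric.ball (0 : Plane) R)) :=
      ⟨by rw [Measure.restrict_apply_univ]; exact measure_ball_lt_top⟩
    exact ((Lp.memLp (fourierL2 u)).restrict _).integrable (by norm_num)
  exact h.integrable_indicator measurableSet_ball

/-- The projection of `u` to the frequencies in the ball of radius `R`. -/
def lowPass (R : ℝ) (u : L2R) (z : Plane) : ℂ := 𝓕⁻ (cutFourier R u) z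

theorem lowPass_eq (R : ℝ) (u : L2R) (z : Plane) :
    lowPass R u z = ∫ ζ in Metric.ball (0 : Plane) R, character z ζ * fourierL2 u ζ := by
  rw [lowPass, Real.fourierInv_eq, ← integral_indicator measurableSet_ball]
  refine integral_congr_ae (Eventually.of_forall fun ζ => ?_)
  by_cases h : ζ ∈ Metric.ball (0 : Plane) R
  · simp [cutFourier, h, character, Circle.smul_def]
  · simp [cutFourier, h]

theorem lowPass_ae_eq (R : ℝ) (u : L2R) :
    ((𝓕⁻ ((memLp_cutFourier R u).toLp : L2C) : L2C) : Plane → ℂ) =ᵐ[volume] lowPass R u :=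
  fourierInv_ae_eq_integral (MemLp.coeFn_toLp _) (integrable_cutFourier R u)

theorem norm_lowPass_le (R : ℝ) (u : L2R) (z : Plane) :
    ‖lowPass R u z‖ ≤ ∫ ζ in Metric.ball (0 : Plane) R, ‖fourierL2 u ζ‖ := by
  rw [lowPass_eq]
  refine (norm_integral_le_integral_norm _).trans (le_of_eq ?_)
  simp only [norm_mul, norm_character, one_mul]

/-- The function on the frequency side that represents the evaluation of the low-pass part. -/
theorem memLp_evalKernel (R : ℝ) (z : Plane) :
    MemLp ((Metric.ball (0 : Plane) R).indicator fun ζ => starRingEnd ℂ (character z ζ)) 2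
      volume := by
  refine memLp_indicator_iff_restrict measurableSet_ball |>.2 ?_
  have : IsFiniteMeasure (volume.restrict (Metric.ball (0 : Plane) R)) :=
    ⟨by rw [Measure.restrict_apply_univ]; exact measure_ball_lt_top⟩
  refine MemLp.of_bound (C := 1) ?_ (Eventually.of_forall fun ζ => ?_)
  · exact (Complex.continuous_conj.comp (continuous_character z)).aestronglyMeasurable
  · simp [norm_character]

/-- The evaluation of the low-pass part at a point is a continuous functional. -/
def lowPassCLM (R : ℝ) (z : Plane) : L2R →L[ℝ] ℂ :=
  ((innerSL ℂ ((memLp_evalKernel R z).toLp : L2C)).restrictScalars ℝ).comp fourierL2CLM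

theorem lowPassCLM_apply (R : ℝ) (z : Plane) (u : L2R) : lowPassCLM R z u = lowPass R u z := by
  change inner ℂ ((memLp_evalKernel R z).toLp : L2C) (fourierL2 u) = _
  rw [L2.inner_def, lowPass_eq, ← integral_indicator measurableSet_ball]
  refine integral_congr_ae ?_
  filter_upwards [MemLp.coeFn_toLp (memLp_evalKernel R z)] with ζ h
  rw [h]
  by_cases hζ : ζ ∈ Metric.ball (0 : Plane) R
  · simp [hζ, mul_comm]
  · simp [hζ]

/-- Translation multiplies û by a character. A value of the low-pass part at a far point thereby
becomes a value at the origin, where it is weakly continuous. -/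
theorem lowPass_translateL2 (R : ℝ) (a : Plane) (u : L2R) :
    lowPass R (translateL2 a u) 0 = lowPass R u a := by
  rw [lowPass_eq, lowPass_eq]
  refine integral_congr_ae (ae_restrict_of_ae ?_)
  filter_upwards [fourierL2_translateL2 a u] with ζ h
  rw [h]
  simp [character]

/-- The high frequency part `u - P_R u`. -/
def highPass (R : ℝ) (u : L2R) : L2C := complexify u - 𝓕⁻ ((memLp_cutFourier R u).toLp : L2C)

theorem highPass_ae_eq (R : ℝ) (u : L2R) :
    (highPass R u : Plane → ℂ) =ᵐ[volume] fun z => (u z : ℂ) - lowPass R u z := by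
  filter_upwards [lowPass_ae_eq R u, coeFn_complexify u, Lp.coeFn_sub (complexify u)
    (𝓕⁻ ((memLp_cutFourier R u).toLp : L2C))] with z h1 h2 h3
  rw [highPass, h3, Pi.sub_apply, h1, h2]

theorem fourier_highPass_ae_eq (R : ℝ) (u : L2R) :
    ((𝓕 (highPass R u) : L2C) : Plane → ℂ) =ᵐ[volume]
      (Metric.ball (0 : Plane) R)ᶜ.indicator (fourierL2 u) := by
  have e : 𝓕 (highPass R u) = fourierL2 u - ((memLp_cutFourier R u).toLp : L2C) := by
    have h := (Lp.fourierTransformₗᵢ Plane ℂ).map_sub (complexify u)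
      (𝓕⁻ ((memLp_cutFourier R u).toLp : L2C))
    have h2 : 𝓕 (𝓕⁻ ((memLp_cutFourier R u).toLp : L2C)) = (memLp_cutFourier R u).toLp :=
      FourierTransform.fourier_fourierInv_eq _
    rw [← h2]
    exact h
  rw [e]
  filter_upwards [Lp.coeFn_sub (fourierL2 u) ((memLp_cutFourier R u).toLp : L2C),
    MemLp.coeFn_toLp (memLp_cutFourier R u)] with ζ h1 h2
  rw [h1, Pi.sub_apply, h2, cutFourier]
  by_cases hζ : ζ ∈ Metric.ball (0 : Plane) R
  · simp [hζ]
  · simp [hζ]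

section Norm
variable [hc : Fact (0 < c)]

/-- Outside the ball 1 ≤ |ζ|/R, so Plancherel and the bound on ∫ |ζ||û|² apply. -/
theorem norm_highPass_sq_le {R : ℝ} (hR : 0 < R) (u : EnergySpace c) :
    ‖highPass R u.toL2‖ ^ 2 ≤ ‖u‖ ^ 2 / R := by
  obtain ⟨hint, hle⟩ := weighted_fourier_bound u
  rw [← Lp.norm_fourier_eq, norm_sq_eq_integral_L2C, le_div_iff₀ hR, mul_comm,
    ← integral_const_mul]
  refine (integral_mono_ae ((integrable_norm_sq_L2C _).const_mul R) hint ?_).trans hle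
  filter_upwards [fourier_highPass_ae_eq R u.toL2] with ζ h
  simp only [h]
  by_cases hζ : ζ ∈ Metric.ball (0 : Plane) R
  · simp only [mem_compl_iff, hζ, not_true_eq_false, not_false_eq_true, indicator_of_notMem,
      norm_zero]
    norm_num
    positivity
  · rw [indicator_of_mem (by simpa using hζ)]
    have : R ≤ ‖ζ‖ := by simpa using hζ
    gcongr

/-- Polar coordinates: in dimension two the Jacobian r cancels r⁻¹, and the radial integral over (0,
R) is R. -/
theorem exists_integral_inv_norm_eq :
    ∃ V : ℝ, 0 < V ∧ ∀ R : ℝ, 0 < R →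
      IntegrableOn (fun ζ : Plane => ‖ζ‖⁻¹) (Metric.ball 0 R) ∧
      ∫ ζ in Metric.ball (0 : Plane) R, ‖ζ‖⁻¹ = V * R := by
  refine ⟨2 * volume.real (Metric.ball (0 : Plane) 1), ?_, fun R hR => ?_⟩
  · have : 0 < volume.real (Metric.ball (0 : Plane) 1) :=
      ENNReal.toReal_pos (Metric.measure_ball_pos _ _ one_pos).ne' measure_ball_lt_top.ne
    positivity
  · have e : (Metric.ball (0 : Plane) R).indicator (fun ζ : Plane => ‖ζ‖⁻¹) =
        fun ζ => (Iio R).indicator (fun r => r⁻¹) ‖ζ‖ := by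
      funext ζ
      simp [indicator, Metric.mem_ball]
    have hone : ∀ y ∈ Ioi (0 : ℝ), y ^ (Module.finrank ℝ Plane - 1) • (Iio R).indicator
        (fun r => r⁻¹) y = (Iio R).indicator (fun _ => (1 : ℝ)) y := by
      intro y hy
      have hy' : y ≠ 0 := (mem_Ioi.1 hy).ne'
      by_cases h : y < R <;> simp [indicator, h, hy']
    constructor
    · rw [← integrable_indicator_iff measurableSet_ball, e,
        integrable_fun_norm_addHaar volume (f := (Iio R).indicator fun r => r⁻¹)]
      rw [integrableOn_congr_fun hone measurableSet_Ioi]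
      refine (integrable_indicator_iff measurableSet_Iio).2 ?_
      rw [IntegrableOn, Measure.restrict_restrict measurableSet_Iio]
      exact integrable_const_iff.2 (Or.inr ⟨by
        rw [Measure.restrict_apply_univ, inter_comm, Ioi_inter_Iio]; simp⟩)
    · rw [← integral_indicator measurableSet_ball, e,
        integral_fun_norm_addHaar volume ((Iio R).indicator fun r => r⁻¹),
        setIntegral_congr_fun measurableSet_Ioi hone, integral_indicator measurableSet_Iio,
        Measure.restrict_restrict measurableSet_Iio, inter_comm, Ioi_inter_Iio]
      simp [hR.le]
      ring

/-- This is Cauchy–Schwarz for |û| = |ζ|^{-1/2}·|ζ|^{1/2}|û| over the ball, with ∫ |ζ|⁻¹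
proportional to R. It is carried out as a pointwise inequality between arithmetic and geometric
means. -/
theorem exists_norm_lowPass_le :
    ∃ D : ℝ, 0 < D ∧ ∀ (u : EnergySpace c), ‖u‖ ≤ 1 → ∀ R : ℝ, 0 < R → ∀ z,
      ‖lowPass R u.toL2 z‖ ≤ D * Real.sqrt R := by
  obtain ⟨V, hV, hVR⟩ := exists_integral_inv_norm_eq
  refine ⟨V + 1, by positivity, fun u hu R hR z => (norm_lowPass_le _ _ _).trans ?_⟩
  obtain ⟨hint, hle⟩ := weighted_fourier_bound u
  obtain ⟨hi, hiR⟩ := hVR R hR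
  have hs : 0 < Real.sqrt R := Real.sqrt_pos.2 hR
  have hss : Real.sqrt R * Real.sqrt R = R := Real.mul_self_sqrt hR.le
  have hcut : IntegrableOn (fun ζ => ‖fourierL2 u.toL2 ζ‖) (Metric.ball 0 R) := by
    have := (integrable_cutFourier R u.toL2).norm
    unfold cutFourier at this
    exact ((integrable_indicator_iff measurableSet_ball).1
      (integrable_cutFourier R u.toL2)).norm
  have h1 : ∫ ζ in Metric.ball (0 : Plane) R, ‖fourierL2 u.toL2 ζ‖ ≤
      ∫ ζ in Metric.ball (0 : Plane) R, ((Real.sqrt R)⁻¹ * ‖ζ‖⁻¹ +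
        Real.sqrt R * (‖ζ‖ * ‖fourierL2 u.toL2 ζ‖ ^ 2)) := by
    refine integral_mono_ae hcut ((hi.const_mul _).add (hint.integrableOn.const_mul _)) ?_
    refine ae_restrict_of_ae ?_
    filter_upwards [ae_coord_zero_ne_zero] with ζ hζ
    have hζ' : 0 < ‖ζ‖ := norm_pos_iff.2 fun h => hζ (by simp [h])
    have hb := norm_nonneg (fourierL2 u.toL2 ζ)
    set b := ‖fourierL2 u.toL2 ζ‖
    have hx : 0 < Real.sqrt R * ‖ζ‖ := by positivity
    -- With x = √R|ζ| this is the completed square behind b ≤ x⁻¹ + x b².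
    have key : (Real.sqrt R)⁻¹ * ‖ζ‖⁻¹ + Real.sqrt R * (‖ζ‖ * b ^ 2) - b =
        (Real.sqrt R * ‖ζ‖)⁻¹ * ((Real.sqrt R * ‖ζ‖ * b - 1) ^ 2 + Real.sqrt R * ‖ζ‖ * b) := by
      field_simp
      ring
    have : 0 ≤ (Real.sqrt R * ‖ζ‖)⁻¹ *
        ((Real.sqrt R * ‖ζ‖ * b - 1) ^ 2 + Real.sqrt R * ‖ζ‖ * b) := by positivity
    linarith
  refine h1.trans ?_
  rw [integral_add (hi.const_mul _) (hint.integrableOn.const_mul _), integral_const_mul,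
    integral_const_mul, hiR]
  have h2 : ∫ ζ in Metric.ball (0 : Plane) R, ‖ζ‖ * ‖fourierL2 u.toL2 ζ‖ ^ 2 ≤ 1 := by
    refine (setIntegral_le_integral hint (Eventually.of_forall fun ζ => by positivity)).trans
      (hle.trans ?_)
    exact pow_le_one₀ (norm_nonneg _) hu
  have h3 : (Real.sqrt R)⁻¹ * (V * R) = V * Real.sqrt R := by
    rw [← div_eq_inv_mul, mul_div_assoc, Real.div_sqrt]
  rw [h3]
  nlinarith

theorem volume_lt_le_of_integrable_sq {g : Plane → ℝ} (hg : Integrable fun z => g z ^ 2)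
    {t : ℝ} (ht : 0 < t) :
    volume {z | t < g z} ≤ ENNReal.ofReal ((∫ z, g z ^ 2) / t ^ 2) := by
  have h := meas_ge_le_lintegral_div (μ := (volume : Measure Plane))
    (f := fun z => ENNReal.ofReal (g z ^ 2)) hg.aestronglyMeasurable.aemeasurable.ennreal_ofReal
    (ε := ENNReal.ofReal (t ^ 2)) (by simp; positivity) ENNReal.ofReal_ne_top
  rw [← ofReal_integral_eq_lintegral_ofReal hg (Eventually.of_forall fun z => sq_nonneg _),
    ← ENNReal.ofReal_div_of_pos (by positivity)] at h
  refine (measure_mono fun z hz => ?_).trans h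
  exact ENNReal.ofReal_le_ofReal (pow_le_pow_left₀ ht.le (le_of_lt hz) 2)

/-- The weak `L⁴` bound. -/
theorem exists_volume_lt_le :
    ∃ K : ℝ, 0 < K ∧ ∀ (u : EnergySpace c), ‖u‖ ≤ 1 → ∀ t : ℝ, 0 < t →
      volume {z | t < |u z|} ≤ ENNReal.ofReal (K / t ^ 4) := by
  obtain ⟨D, hD, hDle⟩ := exists_norm_lowPass_le (c := c)
  refine ⟨16 * D ^ 2, by positivity, fun u hu t ht => ?_⟩
  -- The cutoff R = (t/2D)² makes the low part at most t/2. Where |u| > t the high part thus exceeds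
  -- t/2, and Chebyshev's inequality gives 16D²/t⁴.
  have hR : 0 < (t / (2 * D)) ^ 2 := by positivity
  have h1 : volume {z | t < |u z|} ≤ volume {z | t / 2 < ‖highPass ((t / (2 * D)) ^ 2) u.toL2 z‖} := by
    refine measure_mono_ae ?_
    filter_upwards [highPass_ae_eq ((t / (2 * D)) ^ 2) u.toL2] with z hz hz2
    change t / 2 < ‖highPass ((t / (2 * D)) ^ 2) u.toL2 z‖
    have hz2' : t < |u z| := hz2
    have h3 := hDle u hu _ hR z
    rw [Real.sqrt_sq (by positivity)] at h3
    have h4 : D * (t / (2 * D)) = t / 2 := by field_simp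
    have h5 := norm_sub_norm_le ((u z : ℝ) : ℂ) (lowPass ((t / (2 * D)) ^ 2) u.toL2 z)
    rw [hz]
    rw [Complex.norm_real, Real.norm_eq_abs] at h5
    linarith
  refine h1.trans ((volume_lt_le_of_integrable_sq (integrable_norm_sq_L2C _)
    (by positivity)).trans (ENNReal.ofReal_le_ofReal ?_))
  rw [← norm_sq_eq_integral_L2C]
  have h6 := norm_highPass_sq_le hR u
  have h7 : ‖u‖ ^ 2 ≤ 1 := pow_le_one₀ (norm_nonneg _) hu
  rw [div_le_iff₀ (by positivity)]
  refine h6.trans ?_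
  rw [div_le_iff₀ hR]
  have h8 : 16 * D ^ 2 / t ^ 4 * (t / 2) ^ 2 * (t / (2 * D)) ^ 2 = 1 := by
    field_simp
    ring
  linarith

/-- Layer-cake formula: the L² bound t⁻² on the distribution function is used for t ≤ 1 and the weak
L⁴ bound t⁻⁴ for t > 1. The two integrals converge because q > 2 and q < 4 respectively. -/
theorem exists_integral_rpow_le_of_norm_le_one {q : ℝ} (hq : 2 < q) (hq4 : q < 4) :
    ∃ K : ℝ, 0 < K ∧ ∀ u : EnergySpace c, ‖u‖ ≤ 1 →
      Integrable (fun z => |u z| ^ q) ∧ ∫ z, |u z| ^ q ≤ K := by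
  obtain ⟨K, hK, hKle⟩ := exists_volume_lt_le (c := c)
  have i1 : IntegrableOn (fun t : ℝ => c⁻¹ * t ^ (q - 3)) (Ioc 0 1) := by
    have h := intervalIntegral.intervalIntegrable_rpow' (a := 0) (b := 1) (r := q - 3)
      (by linarith)
    exact (((intervalIntegrable_iff_integrableOn_Ioc_of_le zero_le_one).1 h).const_mul _)
  have i2 : IntegrableOn (fun t : ℝ => K * t ^ (q - 5)) (Ioi 1) :=
    (integrableOn_Ioi_rpow_of_lt (by linarith) one_pos).const_mul _
  let L : ENNReal := ENNReal.ofReal q * ((∫⁻ t in Ioc (0 : ℝ) 1, ENNReal.ofReal (c⁻¹ * t ^ (q - 3))) +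
    ∫⁻ t in Ioi (1 : ℝ), ENNReal.ofReal (K * t ^ (q - 5)))
  have hL : L < ⊤ := ENNReal.mul_lt_top ENNReal.ofReal_lt_top
    (ENNReal.add_lt_top.2 ⟨i1.lintegral_lt_top, i2.lintegral_lt_top⟩)
  have hbound : ∀ u : EnergySpace c, ‖u‖ ≤ 1 → ∫⁻ z, ENNReal.ofReal (|u z| ^ q) ≤ L := by
    intro u hu
    have hm : AEMeasurable (fun z => |u z|) volume := (Lp.aestronglyMeasurable _).aemeasurable.abs
    rw [lintegral_rpow_eq_lintegral_meas_lt_mul volume (Eventually.of_forall fun z => abs_nonneg _)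
      hm (by linarith : 0 < q)]
    refine mul_le_mul_right ?_ _
    rw [← Ioc_union_Ioi_eq_Ioi (zero_le_one (α := ℝ)),
      lintegral_union measurableSet_Ioi (Ioc_disjoint_Ioi le_rfl)]
    refine add_le_add (setLIntegral_mono' measurableSet_Ioc fun t ht => ?_)
      (setLIntegral_mono' measurableSet_Ioi fun t ht => ?_)
    · have ht0 : 0 < t := ht.1
      have h1 : volume {z | t < |u z|} ≤ ENNReal.ofReal (c⁻¹ / t ^ 2) := by
        refine (volume_lt_le_of_integrable_sq (g := fun z => |u z|)
          (by simpa using integrable_sq_L2R u.toL2) ht0).trans (ENNReal.ofReal_le_ofReal ?_)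
        simp only [sq_abs]
        rw [← norm_sq_eq_integral_L2R]
        gcongr
        refine (norm_toL2_sq_le u).trans ?_
        rw [div_eq_inv_mul]
        exact mul_le_of_le_one_right (inv_nonneg.2 hc.out.le) (pow_le_one₀ (norm_nonneg _) hu)
      refine (mul_le_mul_left h1 _).trans ?_
      rw [← ENNReal.ofReal_mul (by have := hc.out; positivity)]
      refine ENNReal.ofReal_le_ofReal (le_of_eq ?_)
      have : t ^ (q - 1) = t ^ (q - 3) * t ^ 2 := by
        rw [← Real.rpow_natCast t 2, ← Real.rpow_add ht0]
        norm_num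
        ring_nf
      rw [this]
      field_simp
    · have ht0 : 0 < t := one_pos.trans ht
      refine (mul_le_mul_left (hKle u hu t ht0) _).trans ?_
      rw [← ENNReal.ofReal_mul (by positivity)]
      refine ENNReal.ofReal_le_ofReal (le_of_eq ?_)
      have : t ^ (q - 1) = t ^ (q - 5) * t ^ 4 := by
        rw [← Real.rpow_natCast t 4, ← Real.rpow_add ht0]
        norm_num
        ring_nf
      rw [this]
      field_simp
  refine ⟨L.toReal + 1, by positivity, fun u hu => ?_⟩
  have hm : AEStronglyMeasurable (fun z => |u z| ^ q) volume :=
    ((Lp.aestronglyMeasurable u.toL2).aemeasurable.abs.pow_const q).aestronglyMeasurable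
  have h0 : ∀ z, 0 ≤ |u z| ^ q := fun z => by positivity
  constructor
  · refine ⟨hm, ?_⟩
    rw [hasFiniteIntegral_iff_ofReal (Eventually.of_forall h0)]
    exact (hbound u hu).trans_lt hL
  · rw [integral_eq_lintegral_of_nonneg_ae (Eventually.of_forall h0) hm]
    have := ENNReal.toReal_mono hL.ne (hbound u hu)
    linarith

/-- The energy space embeds in `L^q` for `2 < q < 4`. -/
theorem exists_integral_rpow_le {q : ℝ} (hq : 2 < q) (hq4 : q < 4) :
    ∃ K : ℝ, 0 < K ∧ ∀ u : EnergySpace c,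
      Integrable (fun z => |u z| ^ q) ∧ ∫ z, |u z| ^ q ≤ K * ‖u‖ ^ q := by
  obtain ⟨K, hK, hKle⟩ := exists_integral_rpow_le_of_norm_le_one (c := c) hq hq4
  refine ⟨K, hK, fun u => ?_⟩
  by_cases hu : u = 0
  · have h0 : (fun z => |u z| ^ q) =ᵐ[volume] 0 := by
      rw [hu, map_zero]
      filter_upwards [Lp.coeFn_zero ℝ 2 (volume : Measure Plane)] with z hz
      rw [hz]
      simp [Real.zero_rpow (by linarith : q ≠ 0)]
    refine ⟨(integrable_zero _ _ _).congr h0.symm, ?_⟩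
    rw [integral_congr_ae h0]
    simp only [Pi.zero_apply, integral_zero]
    positivity
  · have hn : 0 < ‖u‖ := norm_pos_iff.2 hu
    have hw : ‖(‖u‖⁻¹ • u)‖ ≤ 1 := by
      rw [norm_smul, norm_inv, norm_norm, inv_mul_cancel₀ hn.ne']
    obtain ⟨hi, hle⟩ := hKle _ hw
    have e : (fun z => |u z| ^ q) =ᵐ[volume] fun z => ‖u‖ ^ q * |(‖u‖⁻¹ • u) z| ^ q := by
      rw [map_smul]
      filter_upwards [Lp.coeFn_smul (‖u‖⁻¹) u.toL2] with z hz
      rw [hz, Pi.smul_apply, smul_eq_mul, abs_mul, abs_of_pos (inv_pos.2 hn),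
        Real.mul_rpow (by positivity) (abs_nonneg _), Real.inv_rpow hn.le, ← mul_assoc,
        mul_inv_cancel₀ (by positivity), one_mul]
    refine ⟨(hi.const_mul _).congr e.symm, ?_⟩
    rw [integral_congr_ae e, integral_const_mul, mul_comm]
    gcongr

end Norm

end Shrira

/-! ### Translations, non-vanishing and almost everywhere convergence. -/

namespace Shrira

variable {c : ℝ}

theorem multiplier_translateL2_ae (m : Plane → ℂ) (a : Plane) (u : L2R) :
    (fun ζ => m ζ * fourierL2 (translateL2 a u) ζ) =ᵐ[volume]
      fun ζ => character a ζ * (m ζ * fourierL2 u ζ) := by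
  filter_upwards [fourierL2_translateL2 a u] with ζ h
  rw [h]
  ring

theorem memLp_translateL2 {m : Plane → ℂ} (a : Plane) {u : L2R}
    (hu : MemLp (fun ζ => m ζ * fourierL2 u ζ) 2 volume) :
    MemLp (fun ζ => m ζ * fourierL2 (translateL2 a u) ζ) 2 volume := by
  refine MemLp.ae_eq (multiplier_translateL2_ae m a u).symm ?_
  exact hu.of_le ((continuous_character a).aestronglyMeasurable.mul hu.aestronglyMeasurable)
    (Eventually.of_forall fun ζ => by rw [norm_mul, norm_character, one_mul])

theorem integral_norm_multiplier_translateL2 (m : Plane → ℂ) (a : Plane) (u : L2R) :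
    ∫ ζ, ‖m ζ * fourierL2 (translateL2 a u) ζ‖ ^ 2 = ∫ ζ, ‖m ζ * fourierL2 u ζ‖ ^ 2 := by
  refine integral_congr_ae ?_
  filter_upwards [multiplier_translateL2_ae m a u] with ζ h
  rw [h, norm_mul (character a ζ), norm_character, one_mul]

section Norm
variable [hc : Fact (0 < c)]

/-- The translation `u ↦ u(· + a)` of the energy space. -/
def translate (a : Plane) : EnergySpace c →ₗᵢ[ℝ] EnergySpace c where
  toFun u := EnergySpace.mk (translateL2 a u.toL2) (memLp_translateL2 a (memLp_symbolHalf u))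
    (memLp_translateL2 a (memLp_symbolNegHalfDy u))
  map_add' u v := EnergySpace.toL2_injective (by simp)
  map_smul' r u := EnergySpace.toL2_injective (by simp)
  norm_map' u := by
    refine (pow_left_inj₀ (norm_nonneg _) (norm_nonneg _) two_ne_zero).1 ?_
    simp only [LinearMap.coe_mk, AddHom.coe_mk]
    rw [energy_norm_sq, energy_norm_sq, norm_halfDx_sq, norm_halfDx_sq, norm_negHalfDxDy_sq,
      norm_negHalfDxDy_sq]
    simp only [EnergySpace.toL2_mk, LinearIsometry.norm_map, integral_norm_multiplier_translateL2]

theorem toL2_translate (a : Plane) (u : EnergySpace c) :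
    (translate a u).toL2 = translateL2 a u.toL2 := rfl

theorem coeFn_translate (a : Plane) (u : EnergySpace c) :
    (translate a u : Plane → ℝ) =ᵐ[volume] fun z => u (z + a) :=
  coeFn_translateL2 a u.toL2

theorem translate_translate_neg (a : Plane) (u : EnergySpace c) :
    translate a (translate (-a) u) = u := by
  refine EnergySpace.toL2_injective (Lp.ext ?_)
  refine (coeFn_translate a _).trans ?_
  filter_upwards [(measurePreserving_add_right (volume : Measure Plane) a).quasiMeasurePreserving.ae
    (coeFn_translate (-a) u)] with z hz
  rw [hz, add_neg_cancel_right]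

theorem inner_translate_left (a : Plane) (u v : EnergySpace c) :
    inner ℝ (translate a u) v = inner ℝ u (translate (-a) v) := by
  conv_lhs => rw [← translate_translate_neg a v]
  exact LinearIsometry.inner_map_map _ _ _

theorem integral_translate_comp (κ : ℝ → ℝ) (a : Plane) (u : EnergySpace c) :
    ∫ z, κ (translate a u z) = ∫ z, κ (u z) := by
  rw [← integral_add_right_eq_self (fun z => κ (u z)) a]
  refine integral_congr_ae ?_
  filter_upwards [coeFn_translate a u] with z hz
  rw [hz]

theorem integral_translate_mul (f : ℝ → ℝ) (a : Plane) (u v : EnergySpace c) :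
    ∫ z, f (translate a u z) * v z = ∫ z, f (u z) * translate (-a) v z := by
  rw [← integral_add_right_eq_self (fun z => f (u z) * translate (-a) v z) a]
  refine integral_congr_ae ?_
  filter_upwards [coeFn_translate a u,
    (measurePreserving_add_right (volume : Measure Plane) a).quasiMeasurePreserving.ae
    (coeFn_translate (-a) v)] with z h1 h2
  rw [h1, h2, add_neg_cancel_right]

/-- Non-vanishing: a function that is not small in `L^p` is not small near some point. -/
theorem exists_le_norm_lowPass {p : ℝ} (hp : 2 < p) (hp4 : p < 4) (M : ℝ) {η : ℝ} (hη : 0 < η) :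
    ∃ R > (0 : ℝ), ∃ κ > (0 : ℝ), ∀ u : EnergySpace c, ‖u‖ ≤ M → η ≤ ∫ z, |u z| ^ p →
      ∃ a, κ ≤ ‖lowPass R u.toL2 a‖ := by
  obtain ⟨K₀, hK₀, hemb⟩ := exists_integral_rpow_le (c := c) (q := (p + 4) / 2)
    (by linarith) (by linarith)
  obtain ⟨K₁, hK₁, hembp⟩ := exists_integral_rpow_le (c := c) hp hp4
  -- Any exponent strictly between p and 4 would do; it controls the region where u is large.
  set q := (p + 4) / 2 with hq
  have hqp : 0 < q - p := by rw [hq]; linarith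
  have hcp := hc.out
  by_cases hM : M < 0
  · exact ⟨1, one_pos, 1, one_pos, fun u hu => absurd (hu.trans_lt hM) (norm_nonneg u).not_gt⟩
  push Not at hM
  let A : ℝ := K₀ * M ^ q
  have hA : 0 ≤ A := by positivity
  -- The plane is split by x and k into small, middle and large values of |u|, with each
  -- contribution to ∫ |u|^p made less than η/4. The level k settles the large values: k^{p-q} =
  -- t⁻¹.
  let t : ℝ := 4 * (A + 1) / η
  have ht : 0 < t := by positivity
  let k : ℝ := t ^ (q - p)⁻¹
  have hk : 0 < k := by positivity
  have hkA : k ^ (p - q) * A < η / 4 := by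
    have e : k ^ (p - q) = t⁻¹ := by
      rw [← neg_sub q p, Real.rpow_neg hk.le, Real.rpow_inv_rpow ht.le hqp.ne']
    rw [e, inv_mul_lt_iff₀ ht]
    have : t * (η / 4) = A + 1 := by simp only [t]; field_simp
    linarith
  -- R depends on k: in the middle region |u|^p ≤ k^{p-2}u², and u² is at most four times the square
  -- of the high part, whose L² norm R makes small.
  let R : ℝ := 16 * k ^ (p - 2) * M ^ 2 / η + 1
  have hR : 0 < R := by positivity
  have hkR : 4 * k ^ (p - 2) * (M ^ 2 / R) < η / 4 := by
    rw [← mul_div_assoc, div_lt_iff₀ hR]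
    have : η / 4 * R = 4 * k ^ (p - 2) * M ^ 2 + η / 4 := by simp only [R]; field_simp; ring
    linarith
  -- x^{p-2} = s makes the contribution of |u| ≤ x small through the L² bound M²/c.
  let s : ℝ := η * c / (8 * (M ^ 2 + 1))
  have hs : 0 < s := by positivity
  let x : ℝ := s ^ (p - 2)⁻¹
  have hx : 0 < x := by positivity
  have hxs : x ^ (p - 2) * (M ^ 2 / c) < η / 4 := by
    rw [Real.rpow_inv_rpow hs.le (by linarith), ← mul_div_assoc, div_lt_iff₀ hcp]
    simp only [s]
    rw [div_mul_eq_mul_div, div_lt_iff₀ (by positivity)]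
    nlinarith [mul_pos hη hcp, mul_nonneg (mul_pos hη hcp).le (sq_nonneg M)]
  refine ⟨R, hR, x / 2, by positivity, fun u hu hηu => ?_⟩
  by_contra! hcon
  obtain ⟨iq, hleq⟩ := hemb u
  obtain ⟨ip, -⟩ := hembp u
  have hleq' : ∫ z, |u z| ^ q ≤ A := hleq.trans (by
    simp only [A]
    gcongr)
  have hM2 : ‖u‖ ^ 2 ≤ M ^ 2 := pow_le_pow_left₀ (norm_nonneg _) hu 2
  have hpt : ∀ᵐ z, |u z| ^ p ≤ x ^ (p - 2) * u z ^ 2 +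
      4 * k ^ (p - 2) * ‖highPass R u.toL2 z‖ ^ 2 + k ^ (p - q) * |u z| ^ q := by
    filter_upwards [highPass_ae_eq R u.toL2] with z hz
    have hu0 : 0 ≤ |u z| := abs_nonneg _
    have p1 : 0 ≤ x ^ (p - 2) * u z ^ 2 := by positivity
    have p2 : 0 ≤ 4 * k ^ (p - 2) * ‖highPass R u.toL2 z‖ ^ 2 := by positivity
    have p3 : 0 ≤ k ^ (p - q) * |u z| ^ q := by positivity
    have hsplit : |u z| ^ p = |u z| ^ (p - 2) * u z ^ 2 := by
      rw [← sq_abs (u z), ← Real.rpow_natCast |u z| 2, ← Real.rpow_add_of_nonneg hu0 (by linarith)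
        (by norm_num)]
      norm_num
    rcases le_total |u z| x with h | h
    · have : |u z| ^ (p - 2) ≤ x ^ (p - 2) := Real.rpow_le_rpow hu0 h (by linarith)
      have : |u z| ^ p ≤ x ^ (p - 2) * u z ^ 2 := by rw [hsplit]; gcongr
      linarith
    rcases le_total |u z| k with h' | h'
    · have h1 : |u z| ^ (p - 2) ≤ k ^ (p - 2) := Real.rpow_le_rpow hu0 h' (by linarith)
      have h2 := norm_sub_norm_le ((u z : ℝ) : ℂ) (lowPass R u.toL2 z)
      rw [← hz, Complex.norm_real, Real.norm_eq_abs] at h2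
      -- Here |u| ≥ x while the low part is below x/2, so the high part accounts for at least half
      -- of |u|.
      have h3 : |u z| ≤ 2 * ‖highPass R u.toL2 z‖ := by linarith [hcon z]
      have h4 : u z ^ 2 ≤ 4 * ‖highPass R u.toL2 z‖ ^ 2 := by
        rw [← sq_abs]; nlinarith
      have : |u z| ^ p ≤ 4 * k ^ (p - 2) * ‖highPass R u.toL2 z‖ ^ 2 := by
        rw [hsplit]
        calc _ ≤ k ^ (p - 2) * (4 * ‖highPass R u.toL2 z‖ ^ 2) := by gcongr
          _ = _ := by ring
      linarith
    · have hupos : 0 < |u z| := hk.trans_le h'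
      have h1 : |u z| ^ p = |u z| ^ (p - q) * |u z| ^ q := by
        rw [← Real.rpow_add hupos]; ring_nf
      have h2 : |u z| ^ (p - q) ≤ k ^ (p - q) :=
        Real.rpow_le_rpow_of_nonpos hk h' (by linarith)
      have : |u z| ^ p ≤ k ^ (p - q) * |u z| ^ q := by rw [h1]; gcongr
      linarith
  have i1 : Integrable fun z => x ^ (p - 2) * u z ^ 2 := (integrable_sq_L2R _).const_mul _
  have i2 : Integrable fun z => 4 * k ^ (p - 2) * ‖highPass R u.toL2 z‖ ^ 2 :=
    (integrable_norm_sq_L2C _).const_mul _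
  have i3 : Integrable fun z => k ^ (p - q) * |u z| ^ q := iq.const_mul _
  have i12 : Integrable fun z => x ^ (p - 2) * u z ^ 2 +
      4 * k ^ (p - 2) * ‖highPass R u.toL2 z‖ ^ 2 := i1.add i2
  have hint := integral_mono_ae ip (i12.add i3) hpt
  simp only [Pi.add_apply] at hint
  rw [integral_add i12 i3, integral_add i1 i2, integral_const_mul, integral_const_mul,
    integral_const_mul, ← norm_sq_eq_integral_L2C, ← norm_sq_eq_integral_L2R] at hint
  have b1 : x ^ (p - 2) * ‖u.toL2‖ ^ 2 ≤ x ^ (p - 2) * (M ^ 2 / c) := by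
    have := norm_toL2_sq_le u
    gcongr
    exact this.trans (by gcongr)
  have b2 : 4 * k ^ (p - 2) * ‖highPass R u.toL2‖ ^ 2 ≤ 4 * k ^ (p - 2) * (M ^ 2 / R) := by
    have := norm_highPass_sq_le hR u
    gcongr
    exact this.trans (by gcongr)
  have b3 : k ^ (p - q) * ∫ z, |u z| ^ q ≤ k ^ (p - q) * A := by gcongr
  linarith

/-- Evaluating the low-pass part is a continuous functional; its real and imaginary parts are tested
separately since weak convergence is stated for real functionals. -/
theorem tendsto_lowPass_of_weak {u : ℕ → EnergySpace c} {u₀ : EnergySpace c}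
    (hweak : ∀ ℓ : EnergySpace c →L[ℝ] ℝ, Tendsto (fun n => ℓ (u n)) atTop (𝓝 (ℓ u₀)))
    (R : ℝ) (z : Plane) :
    Tendsto (fun n => lowPass R (u n).toL2 z) atTop (𝓝 (lowPass R u₀.toL2 z)) := by
  let Λ : EnergySpace c →L[ℝ] ℂ := (lowPassCLM R z).comp toL2CLM
  have hΛ : ∀ v, Λ v = lowPass R v.toL2 z := fun v => lowPassCLM_apply R z v.toL2
  have h4 := ((Complex.continuous_ofReal.tendsto _).comp (hweak (Complex.reCLM.comp Λ))).add
    (((Complex.continuous_ofReal.tendsto _).comp (hweak (Complex.imCLM.comp Λ))).mul_const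
      Complex.I)
  simpa [Function.comp_def, Complex.re_add_im, hΛ] using h4

/-- A bounded weakly convergent sequence has a subsequence that converges almost everywhere. -/
theorem exists_subseq_tendsto_ae {u : ℕ → EnergySpace c} {u₀ : EnergySpace c} {M : ℝ}
    (hM : ∀ n, ‖u n‖ ≤ M)
    (hweak : ∀ ℓ : EnergySpace c →L[ℝ] ℝ, Tendsto (fun n => ℓ (u n)) atTop (𝓝 (ℓ u₀))) :
    ∃ ns : ℕ → ℕ, StrictMono ns ∧ ∀ᵐ z, Tendsto (fun n => u (ns n) z) atTop (𝓝 (u₀ z)) := by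
  obtain ⟨g, hgpos, hgm, hgint⟩ := exists_pos_lintegral_lt_of_sigmaFinite
    (volume : Measure Plane) one_ne_zero
  -- A positive integrable weight makes the measure finite, so that pointwise convergence of the
  -- low-pass parts implies convergence in measure. The cap by 1 gives ν ≤ volume, which transfers
  -- Chebyshev's inequality for the high-pass parts.
  let w : Plane → ENNReal := fun z => min (g z) 1
  have hwm : Measurable w := hgm.coe_nnreal_ennreal.min measurable_const
  let ν : Measure Plane := volume.withDensity w
  have hνle : ν ≤ volume := by
    calc ν ≤ volume.withDensity 1 := withDensity_mono (Eventually.of_forall fun z => min_le_right _ _)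
      _ = volume := withDensity_one
  have hνfin : IsFiniteMeasure ν := isFiniteMeasure_withDensity
    ((lintegral_mono fun z => min_le_left _ _).trans_lt (hgint.trans ENNReal.one_lt_top)).ne
  have hM' : ∀ n, ‖u n - u₀‖ ≤ M + ‖u₀‖ := fun n => (norm_sub_le _ _).trans (by linarith [hM n])
  have hpt : ∀ R z, Tendsto (fun n => lowPass R (u n - u₀).toL2 z) atTop (𝓝 0) := by
    intro R z
    have h := (tendsto_lowPass_of_weak hweak R z).sub_const (lowPass R u₀.toL2 z)
    rw [sub_self] at h
    refine h.congr fun n => ?_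
    rw [← lowPassCLM_apply, ← lowPassCLM_apply, ← lowPassCLM_apply, ← map_sub, ← map_sub]
  have hmeas : TendstoInMeasure ν (fun n z => (u n - u₀) z) atTop (fun _ => (0 : ℝ)) := by
    rw [tendstoInMeasure_iff_norm]
    intro ε hε
    rw [ENNReal.tendsto_nhds_zero]
    intro δ hδ
    obtain ⟨δ', hδ'0, hδ'⟩ : ∃ δ' : ℝ, 0 < δ' ∧ ENNReal.ofReal δ' ≤ δ / 2 := by
      obtain ⟨r, hr, hr'⟩ := ENNReal.lt_iff_exists_nnreal_btwn.1 (ENNReal.half_pos hδ.ne')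
      refine ⟨r, by exact_mod_cast hr, ?_⟩
      rw [ENNReal.ofReal_coe_nnreal]
      exact hr'.le
    -- R is chosen so that Chebyshev's bound at height ε/4 for the high part is at most δ',
    -- uniformly in n.
    let R : ℝ := (M + ‖u₀‖) ^ 2 / ((ε / 4) ^ 2 * δ') + 1
    have hR : 0 < R := by positivity
    have hlow : Tendsto (fun n => ν {z | ε / 2 ≤ ‖lowPass R (u n - u₀).toL2 z - 0‖}) atTop (𝓝 0) := by
      refine (tendstoInMeasure_iff_norm (g := fun _ : Plane => (0 : ℂ))).1
        (tendstoInMeasure_of_tendsto_ae (fun n => ?_)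
        (Eventually.of_forall fun z => hpt R z)) _ (by positivity)
      exact ((Lp.aestronglyMeasurable _).congr (lowPass_ae_eq R _)).mono_measure hνle
    filter_upwards [ENNReal.tendsto_nhds_zero.1 hlow _ (ENNReal.half_pos hδ.ne')] with n hn
    have hhigh : ν {z | ε / 4 < ‖highPass R (u n - u₀).toL2 z‖} ≤ δ / 2 := by
      refine (hνle _).trans ((volume_lt_le_of_integrable_sq (integrable_norm_sq_L2C _)
        (by positivity)).trans ((ENNReal.ofReal_le_ofReal ?_).trans hδ'))
      rw [← norm_sq_eq_integral_L2C, div_le_iff₀ (by positivity)]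
      refine (norm_highPass_sq_le hR _).trans ?_
      rw [div_le_iff₀ hR]
      have h1 := pow_le_pow_left₀ (norm_nonneg _) (hM' n) 2
      have h2 : δ' * (ε / 4) ^ 2 * R = (M + ‖u₀‖) ^ 2 + δ' * (ε / 4) ^ 2 := by
        simp only [R]; field_simp
      have h3 : 0 < δ' * (ε / 4) ^ 2 := by positivity
      linarith
    have hsub : ν {z | ε ≤ ‖(u n - u₀) z - 0‖} ≤
        ν ({z | ε / 4 < ‖highPass R (u n - u₀).toL2 z‖} ∪
          {z | ε / 2 ≤ ‖lowPass R (u n - u₀).toL2 z - 0‖}) := by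
      refine measure_mono_ae ?_
      have hae := (Measure.absolutelyContinuous_of_le hνle).ae_le
        (highPass_ae_eq R (u n - u₀).toL2)
      filter_upwards [hae] with z hz hz2
      have hz2' : ε ≤ ‖(u n - u₀) z - 0‖ := hz2
      by_cases h : ε / 2 ≤ ‖lowPass R (u n - u₀).toL2 z - 0‖
      · exact Or.inr h
      · left
        change ε / 4 < ‖highPass R (u n - u₀).toL2 z‖
        have h5 := norm_sub_norm_le (((u n - u₀) z : ℝ) : ℂ) (lowPass R (u n - u₀).toL2 z)
        rw [← hz, Complex.norm_real] at h5
        rw [sub_zero] at h hz2'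
        linarith
    calc _ ≤ _ := hsub
      _ ≤ _ := measure_union_le _ _
      _ ≤ δ / 2 + δ / 2 := add_le_add hhigh hn
      _ = δ := ENNReal.add_halves δ
  obtain ⟨ns, hns, hae⟩ := hmeas.exists_seq_tendsto_ae
  refine ⟨ns, hns, ?_⟩
  have hae' : ∀ᵐ z, Tendsto (fun n => (u (ns n) - u₀) z) atTop (𝓝 0) := by
    filter_upwards [(ae_withDensity_iff hwm).1 hae] with z hz
    -- The weight is positive everywhere, so ν-null sets are Lebesgue null.
    refine hz (ne_of_gt ?_)
    simp only [w, lt_min_iff, one_pos, and_true]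
    exact_mod_cast hgpos z
  have hsub : ∀ᵐ z, ∀ n, (u (ns n) - u₀) z = u (ns n) z - u₀ z :=
    ae_all_iff.2 fun n => by
      rw [map_sub]
      exact Lp.coeFn_sub _ _
  filter_upwards [hae', hsub] with z h1 h2
  simp only [h2] at h1
  simpa using h1.add_const (u₀ z)

end Norm

end Shrira

/-! ### Schwartz test functions and their x-derivatives in the energy space. -/

namespace Shrira

variable {c : ℝ}

/-- A real Schwartz function as a complex Schwartz function. -/
def toComplex (ψ : 𝓢(Plane, ℝ)) : 𝓢(Plane, ℂ) := SchwartzMap.postcompCLM Complex.ofRealCLM ψ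

theorem toComplex_apply (ψ : 𝓢(Plane, ℝ)) (z : Plane) : toComplex ψ z = (ψ z : ℂ) := rfl

theorem complexify_toLp (ψ : 𝓢(Plane, ℝ)) : complexify (ψ.toLp 2) = (toComplex ψ).toLp 2 := by
  refine Lp.ext ?_
  filter_upwards [coeFn_complexify (ψ.toLp 2), (toComplex ψ).coeFn_toLp 2 volume,
    ψ.coeFn_toLp 2 volume] with z h1 h2 h3
  rw [h1, h2, h3, toComplex_apply]

theorem fourierL2_toLp_ae (ψ : 𝓢(Plane, ℝ)) :
    (fourierL2 (ψ.toLp 2) : Plane → ℂ) =ᵐ[volume]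
      (𝓕 (toComplex ψ) : 𝓢(Plane, ℂ)) := by
  rw [fourierL2_eq, complexify_toLp, SchwartzMap.toLp_fourier_eq]
  exact SchwartzMap.coeFn_toLp _ _ _

/-- The unit vector in the direction `x`. -/
abbrev unitX : Plane := EuclideanSpace.single 0 1

theorem toComplex_lineDeriv (m : Plane) (ψ : 𝓢(Plane, ℝ)) :
    ∂_{m} (toComplex ψ) = toComplex (∂_{m} ψ) := by
  ext z
  rw [toComplex_apply, SchwartzMap.lineDerivOp_apply_eq_fderiv,
    SchwartzMap.lineDerivOp_apply_eq_fderiv]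
  have h : HasFDerivAt (toComplex ψ) (Complex.ofRealCLM.comp (fderiv ℝ ψ z)) z :=
    Complex.ofRealCLM.hasFDerivAt.comp z ψ.differentiableAt.hasFDerivAt
  rw [h.fderiv]
  rfl

theorem toComplex_laplacian (ψ : 𝓢(Plane, ℝ)) : Δ (toComplex ψ) = toComplex (Δ ψ) := by
  rw [SchwartzMap.laplacian_eq_sum (stdOrthonormalBasis ℝ Plane),
    SchwartzMap.laplacian_eq_sum (stdOrthonormalBasis ℝ Plane)]
  simp only [toComplex_lineDeriv]
  exact (map_sum (SchwartzMap.postcompCLM (E := Plane) Complex.ofRealCLM) _ _).symm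

theorem fourier_lineDeriv_apply (χ : 𝓢(Plane, ℂ)) (ζ : Plane) :
    𝓕 (∂_{unitX} χ) ζ = 2 * Real.pi * Complex.I * (ζ 0 : ℂ) * 𝓕 χ ζ := by
  have : (fun ζ : Plane => inner ℝ ζ unitX).HasTemperateGrowth := by fun_prop
  rw [SchwartzMap.fourier_lineDerivOp_eq]
  rw [smul_apply, SchwartzMap.smulLeftCLM_apply_apply this]
  simp [EuclideanSpace.inner_single_right, mul_assoc]

theorem fourier_laplacian_apply (χ : 𝓢(Plane, ℂ)) (ζ : Plane) :
    𝓕 (Δ χ) ζ = -(4 * Real.pi ^ 2 * ‖ζ‖ ^ 2 : ℝ) * 𝓕 χ ζ := by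
  have : (fun ζ : Plane => ‖ζ‖ ^ 2).HasTemperateGrowth := by fun_prop
  rw [SchwartzMap.laplacian_eq_fourierMultiplierCLM, ← Complex.coe_smul, FourierTransform.fourier_smul,
    SchwartzMap.fourierMultiplierCLM_apply, FourierTransform.fourier_fourierInv_eq]
  simp [SchwartzMap.smulLeftCLM_apply_apply this]
  ring

theorem memLp_mul_schwartz {m : Plane → ℂ} (hm : Measurable m) {C : ℝ}
    (hC : ∀ ζ, ‖m ζ‖ ≤ C * (1 + ‖ζ‖ ^ 2)) (χ : 𝓢(Plane, ℂ)) :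
    MemLp (fun ζ => m ζ * χ ζ) 2 volume := by
  have ht : (fun ζ : Plane => 1 + ‖ζ‖ ^ 2).HasTemperateGrowth := by fun_prop
  have h := (SchwartzMap.smulLeftCLM ℂ (fun ζ : Plane => 1 + ‖ζ‖ ^ 2) χ).memLp 2 volume
  refine h.of_le_mul (c := C) (hm.aestronglyMeasurable.mul χ.continuous.aestronglyMeasurable)
    (Eventually.of_forall fun ζ => ?_)
  rw [SchwartzMap.smulLeftCLM_apply_apply ht, norm_smul, norm_mul, ← mul_assoc,
    Real.norm_of_nonneg (by positivity)]
  gcongr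
  exact hC ζ

theorem abs_coord_le (ζ : Plane) (i : Fin 2) : |ζ i| ≤ ‖ζ‖ := PiLp.norm_apply_le ζ i

/-- `∂_x ψ` as an element of `L²`. -/
def dxL2 (ψ : 𝓢(Plane, ℝ)) : L2R := (∂_{unitX} ψ).toLp 2

theorem coeFn_dxL2 (ψ : 𝓢(Plane, ℝ)) :
    (dxL2 ψ : Plane → ℝ) =ᵐ[volume] (∂_{unitX} ψ : 𝓢(Plane, ℝ)) :=
  SchwartzMap.coeFn_toLp _ _ _

theorem fourierL2_dxL2_ae (ψ : 𝓢(Plane, ℝ)) :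
    (fourierL2 (dxL2 ψ) : Plane → ℂ) =ᵐ[volume]
      fun ζ => 2 * Real.pi * Complex.I * (ζ 0 : ℂ) * fourierL2 (ψ.toLp 2) ζ := by
  filter_upwards [fourierL2_toLp_ae (∂_{unitX} ψ), fourierL2_toLp_ae ψ] with ζ h1 h2
  rw [dxL2, h1, h2, ← toComplex_lineDeriv, fourier_lineDeriv_apply]

/-- The factor ξ from ∂_x cancels the singularity of |ξ|^{-1/2}: |mξ|² ≤ 2π|ζ|²·|ξ|, of polynomial
growth. Without that factor a Schwartz function need not belong to the energy space. -/
theorem memLp_symbol_dx {m : Plane → ℂ} (hm : Measurable m)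
    (hb : ∀ ζ, ‖m ζ‖ ^ 2 * |ζ 0| ≤ 2 * Real.pi * ‖ζ‖ ^ 2) (ψ : 𝓢(Plane, ℝ)) :
    MemLp (fun ζ => m ζ * fourierL2 (dxL2 ψ) ζ) 2 volume := by
  have h : (fun ζ => m ζ * fourierL2 (dxL2 ψ) ζ) =ᵐ[volume]
      fun ζ => (m ζ * (2 * Real.pi * Complex.I * (ζ 0 : ℂ))) * 𝓕 (toComplex ψ) ζ := by
    filter_upwards [fourierL2_toLp_ae (∂_{unitX} ψ)] with ζ hζ
    rw [dxL2, hζ, ← toComplex_lineDeriv, fourier_lineDeriv_apply]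
    ring
  refine MemLp.ae_eq h.symm (memLp_mul_schwartz (C := 4 * Real.pi ^ 2) (by fun_prop) (fun ζ => ?_) _)
  have hπ := Real.pi_gt_three
  have e : ‖m ζ * (2 * Real.pi * Complex.I * (ζ 0 : ℂ))‖ = 2 * Real.pi * (‖m ζ‖ * |ζ 0|) := by
    simp [abs_of_pos Real.pi_pos]
    ring
  rw [e]
  have h0 := abs_coord_le ζ 0
  have h1 : (‖m ζ‖ * |ζ 0|) ^ 2 ≤ (2 * Real.pi * (1 + ‖ζ‖ ^ 2)) ^ 2 := by
    calc (‖m ζ‖ * |ζ 0|) ^ 2 = (‖m ζ‖ ^ 2 * |ζ 0|) * |ζ 0| := by ring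
      _ ≤ (2 * Real.pi * ‖ζ‖ ^ 2) * ‖ζ‖ := by
        have := hb ζ
        gcongr
      _ ≤ (2 * Real.pi * (1 + ‖ζ‖ ^ 2)) * (2 * Real.pi * (1 + ‖ζ‖ ^ 2)) := by
        gcongr
        · linarith
        · nlinarith [norm_nonneg ζ, sq_nonneg (‖ζ‖ - 1)]
      _ = _ := by ring
  have h2 := le_of_sq_le_sq h1 (by positivity)
  calc 2 * Real.pi * (‖m ζ‖ * |ζ 0|) ≤ 2 * Real.pi * (2 * Real.pi * (1 + ‖ζ‖ ^ 2)) := by gcongr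
    _ = _ := by ring

theorem norm_symbolHalf_sq_mul_le (ζ : Plane) :
    ‖symbolHalf ζ‖ ^ 2 * |ζ 0| ≤ 2 * Real.pi * ‖ζ‖ ^ 2 := by
  rw [norm_symbolHalf_sq, mul_assoc, norm_sq_plane, ← sq, sq_abs]
  have := Real.pi_pos
  gcongr
  linarith [sq_nonneg (ζ 1)]

theorem norm_symbolNegHalfDy_sq_mul_le (ζ : Plane) :
    ‖symbolNegHalfDy ζ‖ ^ 2 * |ζ 0| ≤ 2 * Real.pi * ‖ζ‖ ^ 2 := by
  rw [norm_symbolNegHalfDy_sq, mul_assoc, norm_sq_plane]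
  have := Real.pi_pos
  gcongr
  rcases eq_or_ne (ζ 0) 0 with h | h
  · simp [h, sq_nonneg]
  · rw [div_mul_cancel₀ _ (abs_ne_zero.2 h)]
    linarith [sq_nonneg (ζ 0)]

/-- The element `∂_x ψ` of the energy space. -/
def xDeriv (ψ : 𝓢(Plane, ℝ)) : EnergySpace c :=
  EnergySpace.mk (dxL2 ψ)
    (memLp_symbol_dx (m := symbolHalf) measurable_symbolHalf norm_symbolHalf_sq_mul_le ψ)
    (memLp_symbol_dx (m := symbolNegHalfDy) measurable_symbolNegHalfDy
      norm_symbolNegHalfDy_sq_mul_le ψ)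

theorem toL2_xDeriv (ψ : 𝓢(Plane, ℝ)) : (xDeriv ψ : EnergySpace c).toL2 = dxL2 ψ := rfl

/-- `ψ ↦ ∂_x ψ` as a linear map to the energy space. -/
def xDerivₗ : 𝓢(Plane, ℝ) →ₗ[ℝ] EnergySpace c where
  toFun := xDeriv
  map_add' ψ χ := EnergySpace.toL2_injective (by
    simp only [toL2_xDeriv, dxL2, map_add, LineDeriv.lineDerivOp_add]
    rfl)
  map_smul' r ψ := EnergySpace.toL2_injective (by
    simp only [toL2_xDeriv, dxL2, map_smul, LineDeriv.lineDerivOp_smul, RingHom.id_apply]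
    rfl)

end Shrira

/-! ### The weak form of the equation and density of the test functions ∂_xψ. -/

namespace Shrira

variable {c : ℝ}

theorem inner_L2C_eq (g h : L2C) : inner ℂ g h = ∫ z, h z * starRingEnd ℂ (g z) := by
  rw [L2.inner_def]
  rfl

theorem inner_fourier_eq_integral {g h : L2C} {G H : Plane → ℂ}
    (hg : ((𝓕 g : L2C) : Plane → ℂ) =ᵐ[volume] G) (hh : ((𝓕 h : L2C) : Plane → ℂ) =ᵐ[volume] H) :
    inner ℂ g h = ∫ ζ, H ζ * starRingEnd ℂ (G ζ) := by
  rw [← Lp.inner_fourier_eq, inner_L2C_eq]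
  refine integral_congr_ae ?_
  filter_upwards [hg, hh] with ζ h1 h2
  rw [h1, h2]

theorem integrable_mul_conj {G H : Plane → ℂ} (hG : MemLp G 2 volume) (hH : MemLp H 2 volume) :
    Integrable fun ζ => H ζ * starRingEnd ℂ (G ζ) :=
  MemLp.integrable_mul hH hG.star

/-- The symbol `4π² i sgn(ξ) |ζ|²` of `-𝓗 Δ`. -/
def hilbertLaplaceSymbol (ζ : Plane) : ℂ :=
  Complex.I * ((Real.sign (ζ 0) * (4 * Real.pi ^ 2 * ‖ζ‖ ^ 2) : ℝ) : ℂ)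

theorem hilbertLaplaceSymbol_neg (ζ : Plane) :
    hilbertLaplaceSymbol (-ζ) = starRingEnd ℂ (hilbertLaplaceSymbol ζ) := by
  rw [hilbertLaplaceSymbol, hilbertLaplaceSymbol, map_mul, Complex.conj_ofReal, Complex.conj_I]
  simp [Real.sign_neg]

theorem measurable_hilbertLaplaceSymbol : Measurable hilbertLaplaceSymbol := by
  have hs : Measurable Real.sign := by
    have : Real.sign = fun r : ℝ => if r < 0 then (-1 : ℝ) else if 0 < r then 1 else 0 := by
      funext r; rfl
    rw [this]
    exact Measurable.ite measurableSet_Iio measurable_const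
      (Measurable.ite measurableSet_Ioi measurable_const measurable_const)
  unfold hilbertLaplaceSymbol
  fun_prop

theorem norm_hilbertLaplaceSymbol_le (ζ : Plane) :
    ‖hilbertLaplaceSymbol ζ‖ ≤ 4 * Real.pi ^ 2 * (1 + ‖ζ‖ ^ 2) := by
  have h : |Real.sign (ζ 0)| ≤ 1 := by
    rcases Real.sign_apply_eq (ζ 0) with h | h | h <;> simp [h]
  rw [hilbertLaplaceSymbol, norm_mul, Complex.norm_I, one_mul, Complex.norm_real, norm_mul,
    Real.norm_eq_abs, Real.norm_of_nonneg (by positivity)]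
  calc _ ≤ 1 * (4 * Real.pi ^ 2 * ‖ζ‖ ^ 2) := by gcongr
    _ ≤ _ := by
      rw [one_mul]
      gcongr
      linarith

/-- |ζ|²/|ξ| times ξ is sgn(ξ)|ζ|². This is the algebra that turns the quadratic form of the energy
into the Hilbert transform of a Laplacian. -/
theorem symbols_mul_dx {ζ : Plane} (h : ζ 0 ≠ 0) :
    ((‖symbolHalf ζ‖ ^ 2 + ‖symbolNegHalfDy ζ‖ ^ 2 : ℝ) : ℂ) *
      (2 * Real.pi * Complex.I * (ζ 0 : ℂ)) = hilbertLaplaceSymbol ζ := by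
  rw [norm_symbols_sq_add h, hilbertLaplaceSymbol]
  have e : 2 * Real.pi * (‖ζ‖ ^ 2 / |ζ 0|) * (2 * Real.pi * ζ 0) =
      Real.sign (ζ 0) * (4 * Real.pi ^ 2 * ‖ζ‖ ^ 2) := by
    rcases lt_or_gt_of_ne h with h' | h'
    · rw [Real.sign_of_neg h', abs_of_neg h']
      field_simp
      ring
    · rw [Real.sign_of_pos h', abs_of_pos h']
      field_simp
      ring
  rw [← e]
  push_cast
  ring

/-- The pairing `∫ 4π² i sgn(ξ) |ζ|² ψ̂ v̂*` on the frequency side. -/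
def hilbertLaplacePairing (v : L2R) (ψ : 𝓢(Plane, ℝ)) : ℂ :=
  ∫ ζ, hilbertLaplaceSymbol ζ * fourierL2 (ψ.toLp 2) ζ * starRingEnd ℂ (fourierL2 v ζ)

/-- The symbol and both transforms are Hermitian, so ζ ↦ -ζ conjugates the integrand. The pairing is
therefore real and can be matched with the real energy scalar product. -/
theorem conj_hilbertLaplacePairing (v : L2R) (ψ : 𝓢(Plane, ℝ)) :
    starRingEnd ℂ (hilbertLaplacePairing v ψ) = hilbertLaplacePairing v ψ := by
  rw [hilbertLaplacePairing, ← integral_conj, ← integral_neg_eq_self]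
  refine integral_congr_ae ?_
  filter_upwards [fourierL2_neg_ae v, fourierL2_neg_ae (ψ.toLp 2)] with ζ h1 h2
  rw [h1, h2, hilbertLaplaceSymbol_neg]
  simp

theorem inner_halfDx_add_inner_negHalfDxDy (v : EnergySpace c) (ψ : 𝓢(Plane, ℝ)) :
    inner ℂ (halfDx v) (halfDx (xDeriv ψ : EnergySpace c)) +
      inner ℂ (negHalfDxDy v) (negHalfDxDy (xDeriv ψ : EnergySpace c)) =
      hilbertLaplacePairing v.toL2 ψ := by
  rw [inner_fourier_eq_integral (fourier_halfDx_ae v) (fourier_halfDx_ae (xDeriv ψ)),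
    inner_fourier_eq_integral (fourier_negHalfDxDy_ae v) (fourier_negHalfDxDy_ae (xDeriv ψ)),
    ← integral_add (integrable_mul_conj (memLp_symbolHalf v) (memLp_symbolHalf (xDeriv ψ)))
      (integrable_mul_conj (memLp_symbolNegHalfDy v) (memLp_symbolNegHalfDy (xDeriv ψ))),
    hilbertLaplacePairing]
  refine integral_congr_ae ?_
  filter_upwards [fourierL2_dxL2_ae ψ, ae_coord_zero_ne_zero] with ζ h1 h2
  rw [toL2_xDeriv, h1, ← symbols_mul_dx h2]
  have e : ∀ m a b : ℂ, m * a * starRingEnd ℂ (m * b) = ((‖m‖ ^ 2 : ℝ) : ℂ) * (a * starRingEnd ℂ b) := by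
    intro m a b
    have := Complex.mul_conj' m
    push_cast
    rw [← this, map_mul]
    ring
  rw [e, e]
  push_cast
  ring

theorem fourier_hilbertTransform_ae (u : L2R) :
    ((𝓕 (hilbertTransform u) : L2C) : Plane → ℂ) =ᵐ[volume] fun ζ => symbolHilbert ζ * fourierL2 u ζ :=
  fourier_multiplier_ae (m := symbolHilbert) ⟨u, mem_domain_hilbert u⟩

theorem integral_hilbertTransform_mul_laplacian (v : L2R) (ψ : 𝓢(Plane, ℝ)) :
    ∫ z, hilbertTransform v z * (Δ (toComplex ψ)) z = -hilbertLaplacePairing v ψ := by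
  have hF : ((𝓕 ((Δ (toComplex ψ)).toLp 2 : L2C) : L2C) : Plane → ℂ) =ᵐ[volume]
      fun ζ => -(4 * Real.pi ^ 2 * ‖ζ‖ ^ 2 : ℝ) * fourierL2 (ψ.toLp 2) ζ := by
    rw [SchwartzMap.toLp_fourier_eq]
    filter_upwards [SchwartzMap.coeFn_toLp (𝓕 (Δ (toComplex ψ))) 2 volume, fourierL2_toLp_ae ψ]
      with ζ h1 h2
    rw [h1, h2, fourier_laplacian_apply]
  have h := inner_fourier_eq_integral (fourier_hilbertTransform_ae v) hF
  -- Conjugation turns the bilinear pairing of the weak form into the sesquilinear one of L²,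
  -- because Δψ is real.
  have h1 : starRingEnd ℂ (∫ z, hilbertTransform v z * (Δ (toComplex ψ)) z) =
      inner ℂ (hilbertTransform v) ((Δ (toComplex ψ)).toLp 2 : L2C) := by
    rw [inner_L2C_eq, ← integral_conj]
    refine integral_congr_ae ?_
    filter_upwards [SchwartzMap.coeFn_toLp (Δ (toComplex ψ)) 2 volume] with z hz
    rw [hz, toComplex_laplacian, toComplex_apply, map_mul, Complex.conj_ofReal, mul_comm]
  have h2 : inner ℂ (hilbertTransform v) ((Δ (toComplex ψ)).toLp 2 : L2C) =
      -hilbertLaplacePairing v ψ := by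
    rw [h, hilbertLaplacePairing, ← integral_neg]
    refine integral_congr_ae (Eventually.of_forall fun ζ => ?_)
    simp only [symbolHilbert, hilbertLaplaceSymbol, map_mul, map_neg, Complex.conj_I,
      Complex.conj_ofReal]
    push_cast
    ring
  rw [h2] at h1
  have h3 := congrArg (starRingEnd ℂ) h1
  rwa [Complex.conj_conj, map_neg, conj_hilbertLaplacePairing] at h3

theorem ofReal_inner_L2R (u v : L2R) :
    ((inner ℝ u v : ℝ) : ℂ) = ∫ z, (v z : ℂ) * (u z : ℂ) := by
  rw [L2.inner_def, ← integral_complex_ofReal]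
  refine integral_congr_ae (Eventually.of_forall fun z => ?_)
  simp

theorem ofReal_inner_L2R_fourier (u v : L2R) :
    ((inner ℝ u v : ℝ) : ℂ) = ∫ ζ, fourierL2 v ζ * starRingEnd ℂ (fourierL2 u ζ) := by
  have h : ((inner ℝ u v : ℝ) : ℂ) = inner ℂ (complexify u) (complexify v) := by
    rw [ofReal_inner_L2R, inner_L2C_eq]
    refine integral_congr_ae ?_
    filter_upwards [coeFn_complexify u, coeFn_complexify v] with z h1 h2
    rw [h1, h2, Complex.conj_ofReal]
  rw [h, ← Lp.inner_fourier_eq, inner_L2C_eq]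
  rfl

section Norm
variable [hc : Fact (0 < c)]

theorem energy_inner_eq (u v : EnergySpace c) :
    inner ℝ u v = c * inner ℝ u.toL2 v.toL2 + (inner ℂ (halfDx u) (halfDx v)).re
      + (inner ℂ (negHalfDxDy u) (negHalfDxDy v)).re := rfl

theorem ofReal_inner_xDeriv (v : EnergySpace c) (ψ : 𝓢(Plane, ℝ)) :
    ((inner ℝ v (xDeriv ψ) : ℝ) : ℂ) =
      c * (inner ℝ v.toL2 (dxL2 ψ) : ℝ) + hilbertLaplacePairing v.toL2 ψ := by
  have hre : ((hilbertLaplacePairing v.toL2 ψ).re : ℂ) = hilbertLaplacePairing v.toL2 ψ :=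
    Complex.conj_eq_iff_re.1 (conj_hilbertLaplacePairing _ _)
  rw [energy_inner_eq, toL2_xDeriv, ← hre, ← inner_halfDx_add_inner_negHalfDxDy, Complex.add_re]
  push_cast
  ring

/-- The weak form of the left hand side of the equation. -/
def weakResidual (f : ℝ → ℝ) (u : EnergySpace c) (ψ : 𝓢(Plane, ℂ)) : ℂ :=
  (c : ℂ) * (∫ z, (u z : ℂ) * (∂_{unitX} ψ) z) - (∫ z, hilbertTransform u.toL2 z * (Δ ψ) z)
      - (∫ z, (f (u z) : ℂ) * (∂_{unitX} ψ) z)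

/-- This identifies the weak equation tested with a real ψ with S'(u)(∂_xψ). -/
theorem weakResidual_toComplex (f : ℝ → ℝ) (u : EnergySpace c) (ψ : 𝓢(Plane, ℝ)) :
    weakResidual f u (toComplex ψ) =
      ((inner ℝ u (xDeriv ψ) - ∫ z, f (u z) * (xDeriv ψ : EnergySpace c) z : ℝ) : ℂ) := by
  rw [weakResidual, integral_hilbertTransform_mul_laplacian, Complex.ofReal_sub,
    ofReal_inner_xDeriv, ofReal_inner_L2R, ← integral_complex_ofReal, toComplex_lineDeriv, sub_neg_eq_add]
  have e1 : ∫ z, (u z : ℂ) * toComplex (∂_{unitX} ψ) z = ∫ z, (dxL2 ψ z : ℂ) * (u z : ℂ) := by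
    refine integral_congr_ae ?_
    filter_upwards [coeFn_dxL2 ψ] with z hz
    rw [hz, toComplex_apply, mul_comm]
  have e2 : ∫ z, (f (u z) : ℂ) * toComplex (∂_{unitX} ψ) z =
      ∫ z, ((f (u z) * (xDeriv ψ : EnergySpace c) z : ℝ) : ℂ) := by
    refine integral_congr_ae ?_
    filter_upwards [coeFn_dxL2 ψ] with z hz
    rw [toL2_xDeriv, hz, toComplex_apply, Complex.ofReal_mul]
  rw [e1, e2]

theorem integrable_L2R_mul_toComplex (u : L2R) (ψ : 𝓢(Plane, ℝ)) :
    Integrable fun z => (u z : ℂ) * toComplex ψ z :=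
  ((Lp.memLp u).ofReal).integrable_mul ((toComplex ψ).memLp 2 volume)

theorem integrable_L2C_mul_schwartz (g : L2C) (χ : 𝓢(Plane, ℂ)) :
    Integrable fun z => g z * χ z :=
  (Lp.memLp g).integrable_mul (χ.memLp 2 volume)

theorem schwartz_eq_re_add_im (ψ : 𝓢(Plane, ℂ)) :
    ψ = toComplex (SchwartzMap.postcompCLM Complex.reCLM ψ) +
      Complex.I • toComplex (SchwartzMap.postcompCLM Complex.imCLM ψ) := by
  ext z
  simp [toComplex_apply, mul_comm Complex.I, Complex.re_add_im]

-- Reduces complex test functions to real ones. The integrability hypothesis justifies splitting the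
-- nonlinear integral.
omit hc in
theorem weakResidual_add_I_smul {f : ℝ → ℝ} {u : EnergySpace c}
    (hint : ∀ φ : EnergySpace c, Integrable fun z => f (u z) * φ z) (a b : 𝓢(Plane, ℝ)) :
    weakResidual f u (toComplex a + Complex.I • toComplex b) =
      weakResidual f u (toComplex a) + Complex.I * weakResidual f u (toComplex b) := by
  have hsplit : ∀ (g : Plane → ℂ) (χ₁ χ₂ : 𝓢(Plane, ℂ)), Integrable (fun z => g z * χ₁ z) →
      Integrable (fun z => g z * χ₂ z) → ∫ z, g z * (χ₁ + Complex.I • χ₂) z =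
        (∫ z, g z * χ₁ z) + Complex.I * ∫ z, g z * χ₂ z := by
    intro g χ₁ χ₂ h1 h2
    rw [← integral_const_mul, ← integral_add h1 (h2.const_mul _)]
    refine integral_congr_ae (Eventually.of_forall fun z => ?_)
    simp
    ring
  have hf : ∀ ψ : 𝓢(Plane, ℝ), Integrable fun z => (f (u z) : ℂ) * (∂_{unitX} (toComplex ψ)) z := by
    intro ψ
    refine ((hint (xDeriv ψ)).ofReal (𝕜 := ℂ)).congr ?_
    filter_upwards [coeFn_dxL2 ψ] with z hz
    rw [toL2_xDeriv, hz, toComplex_lineDeriv, toComplex_apply]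
    simp
  have hd : ∀ χ₁ χ₂ : 𝓢(Plane, ℂ), ∂_{unitX} (χ₁ + Complex.I • χ₂) =
      ∂_{unitX} χ₁ + Complex.I • ∂_{unitX} χ₂ := fun χ₁ χ₂ => by
    rw [LineDeriv.lineDerivOp_add, LineDeriv.lineDerivOp_smul]
  have hΔ : ∀ χ₁ χ₂ : 𝓢(Plane, ℂ), Δ (χ₁ + Complex.I • χ₂) = Δ χ₁ + Complex.I • Δ χ₂ :=
    fun χ₁ χ₂ => by
      simp only [← SchwartzMap.laplacianCLM_eq ℂ, map_add, map_smul]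
  have hu : ∀ ψ : 𝓢(Plane, ℝ), Integrable fun z => (u z : ℂ) * (∂_{unitX} (toComplex ψ)) z := by
    intro ψ
    rw [toComplex_lineDeriv]
    exact integrable_L2R_mul_toComplex _ _
  simp only [weakResidual, hd, hΔ]
  rw [hsplit _ _ _ (hu a) (hu b), hsplit _ _ _ (hf a) (hf b),
    hsplit _ _ _ (integrable_L2C_mul_schwartz _ _) (integrable_L2C_mul_schwartz _ _)]
  ring

theorem isSolution_iff_xDeriv {f : ℝ → ℝ} {u : EnergySpace c}
    (hint : ∀ φ : EnergySpace c, Integrable fun z => f (u z) * φ z) :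
    IsSolution f u ↔ ∀ ψ : 𝓢(Plane, ℝ),
      inner ℝ u (xDeriv ψ) = ∫ z, f (u z) * (xDeriv ψ : EnergySpace c) z := by
  change (∀ ψ, weakResidual f u ψ = 0) ↔ _
  have hreal : ∀ ψ : 𝓢(Plane, ℝ), weakResidual f u (toComplex ψ) = 0 ↔
      inner ℝ u (xDeriv ψ) = ∫ z, f (u z) * (xDeriv ψ : EnergySpace c) z := fun ψ => by
    rw [weakResidual_toComplex, Complex.ofReal_eq_zero, sub_eq_zero]
  constructor
  · exact fun h ψ => (hreal ψ).1 (h _)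
  · intro h ψ
    rw [schwartz_eq_re_add_im ψ, weakResidual_add_I_smul hint, (hreal _).2 (h _),
      (hreal _).2 (h _)]
    simp

/-- The derivatives `∂_x ψ` of real Schwartz functions are dense in the energy space. -/
theorem topologicalClosure_range_xDeriv :
    (LinearMap.range (xDerivₗ : 𝓢(Plane, ℝ) →ₗ[ℝ] EnergySpace c)).topologicalClosure = ⊤ := by
  rw [Submodule.topologicalClosure_eq_top_iff, Submodule.eq_bot_iff]
  intro v hv
  -- The total symbol i(2πcξ + 4π² sgn(ξ)|ζ|²) factors as i sgn(ξ) times m. The weight m is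
  -- continuous and vanishes only at the origin; the factor i sgn(ξ) is absorbed in s, which stays
  -- in L².
  let m : Plane → ℝ := fun ζ => 2 * Real.pi * c * |ζ 0| + 4 * Real.pi ^ 2 * ‖ζ‖ ^ 2
  let s : Plane → ℂ := fun ζ => symbolHilbert ζ * fourierL2 v.toL2 ζ
  have hs : MemLp s 2 volume := multiplierDomain_memLp (mem_domain_hilbert v.toL2)
  let g : Plane → ℂ := fun ζ => starRingEnd ℂ (s ζ) * (m ζ : ℂ)
  have hmc : Continuous fun ζ => (m ζ : ℂ) := by fun_prop
  have hg : LocallyIntegrable g :=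
    LocallyIntegrable.mul_continuous hmc (hs.star.locallyIntegrable (by norm_num))
  have hreal : ∀ ψ : 𝓢(Plane, ℝ), ∫ ζ, 𝓕 (toComplex ψ) ζ * g ζ = 0 := by
    intro ψ
    have h0 : inner ℝ v (xDeriv ψ) = 0 :=
      (Submodule.mem_orthogonal' _ v).1 hv _ ⟨ψ, rfl⟩
    have h1 := ofReal_inner_xDeriv v ψ
    have hH : Integrable fun ζ => hilbertLaplaceSymbol ζ * fourierL2 (ψ.toLp 2) ζ *
        starRingEnd ℂ (fourierL2 v.toL2 ζ) := by
      refine integrable_mul_conj (Lp.memLp _) (MemLp.ae_eq ?_ (memLp_mul_schwartz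
        measurable_hilbertLaplaceSymbol norm_hilbertLaplaceSymbol_le (𝓕 (toComplex ψ))))
      filter_upwards [fourierL2_toLp_ae ψ] with ζ hζ
      rw [hζ]
    rw [h0, Complex.ofReal_zero, ofReal_inner_L2R_fourier, hilbertLaplacePairing,
      ← integral_const_mul, ← integral_add ((integrable_mul_conj (Lp.memLp _)
        (Lp.memLp _)).const_mul _) hH] at h1
    rw [h1]
    refine integral_congr_ae ?_
    filter_upwards [fourierL2_toLp_ae ψ, fourierL2_dxL2_ae ψ] with ζ hζ hζ'
    rw [hζ', ← hζ]
    have e : Real.sign (ζ 0) * |ζ 0| = ζ 0 := by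
      rcases lt_trichotomy (ζ 0) 0 with h' | h' | h'
      · rw [Real.sign_of_neg h', abs_of_neg h']; ring
      · simp [h']
      · rw [Real.sign_of_pos h', abs_of_pos h']; ring
    have e' : (ζ 0 : ℂ) = (Real.sign (ζ 0) : ℂ) * (|ζ 0| : ℝ) := by
      rw [← Complex.ofReal_mul, e]
    simp only [g, s, m, symbolHilbert, hilbertLaplaceSymbol, map_mul, map_neg, Complex.conj_I,
      Complex.conj_ofReal]
    rw [e']
    push_cast
    ring
  have hint : ∀ χ : 𝓢(Plane, ℂ), Integrable fun ζ => χ ζ * g ζ := by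
    intro χ
    have hm : MemLp (fun ζ => (m ζ : ℂ) * χ ζ) 2 volume := by
      refine memLp_mul_schwartz (C := 2 * Real.pi * c + 4 * Real.pi ^ 2) hmc.measurable
        (fun ζ => ?_) χ
      have hcp := hc.out
      have hπ := Real.pi_pos
      rw [Complex.norm_real, Real.norm_of_nonneg (by positivity)]
      have h1 := abs_coord_le ζ 0
      have h2 : |ζ 0| ≤ 1 + ‖ζ‖ ^ 2 := by nlinarith [sq_nonneg (‖ζ‖ - 1), norm_nonneg ζ]
      have h3 : ‖ζ‖ ^ 2 ≤ 1 + ‖ζ‖ ^ 2 := by linarith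
      rw [add_mul]
      simp only [m]
      gcongr
    refine (integrable_mul_conj hs hm).congr (Eventually.of_forall fun ζ => ?_)
    simp only [g]
    ring
  -- Each Schwartz function is the transform of another one, whose real and imaginary parts are real
  -- test functions.
  have hall : ∀ χ : 𝓢(Plane, ℂ), ∫ ζ, χ ζ * g ζ = ∫ ζ, χ ζ * (0 : Plane → ℂ) ζ := by
    intro χ
    have h1 : χ = 𝓕 (𝓕⁻ χ) := (FourierTransform.fourier_fourierInv_eq χ).symm
    rw [h1, schwartz_eq_re_add_im (𝓕⁻ χ), FourierTransform.fourier_add,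
      FourierTransform.fourier_smul]
    simp only [add_apply, smul_apply, add_mul, Pi.zero_apply, mul_zero, integral_zero,
      smul_eq_mul, mul_assoc]
    rw [integral_add (hint _) ((hint _).const_mul _), integral_const_mul, hreal, hreal]
    simp
  have hg0 := ae_eq_of_integral_schwartz_mul_eq hg (locallyIntegrable_zero) hall
  have hv0 : fourierL2 v.toL2 = 0 := by
    refine Lp.ext ?_
    filter_upwards [hg0, ae_coord_zero_ne_zero, Lp.coeFn_zero ℂ 2 (volume : Measure Plane)]
      with ζ h1 h2 h3
    rw [h3]
    have hcp := hc.out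
    have hπ := Real.pi_pos
    have habs := abs_pos.2 h2
    have hm : (m ζ : ℂ) ≠ 0 := by
      rw [Complex.ofReal_ne_zero]
      simp only [m]
      positivity
    have h4 : s ζ = 0 := by
      simpa using (mul_eq_zero.1 h1).resolve_right hm
    have h5 : symbolHilbert ζ ≠ 0 := by
      simp [symbolHilbert, Real.sign_eq_zero_iff, h2]
    exact (mul_eq_zero.1 h4).resolve_left h5
  refine EnergySpace.toL2_injective ?_
  rw [map_zero, ← norm_eq_zero, ← norm_fourierL2, hv0, norm_zero]

end Norm

end Shrira

/-! ### The nonlinear integrals: growth, continuity and directional derivatives. -/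

namespace Shrira

variable {c : ℝ}

/-- The growth part of the hypotheses on the nonlinearity. -/
structure SubcriticalGrowth (f : ℝ → ℝ) (p C : ℝ) : Prop where
  continuous : Continuous f
  two_lt : 2 < p
  lt_four : p < 4
  pos : 0 < C
  bound : ∀ s, |f s| ≤ C * (|s| + |s| ^ (p - 1))

theorem abs_rpow_sub_one_mul_le {p : ℝ} (hp : 1 < p) (a b : ℝ) :
    |a| ^ (p - 1) * |b| ≤ |a| ^ p + |b| ^ p := by
  have ha := abs_nonneg a
  have hb := abs_nonneg b
  have e : ∀ x : ℝ, 0 ≤ x → x ^ p = x ^ (p - 1) * x := fun x hx => by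
    rw [← Real.rpow_add_one' hx (by linarith), sub_add_cancel]
  have h1 : 0 ≤ |a| ^ p := by positivity
  have h2 : 0 ≤ |b| ^ p := by positivity
  rcases le_total |a| |b| with h | h
  · have : |a| ^ (p - 1) * |b| ≤ |b| ^ p := by
      rw [e _ hb]
      have := Real.rpow_le_rpow ha h (by linarith : 0 ≤ p - 1)
      gcongr
    linarith
  · have : |a| ^ (p - 1) * |b| ≤ |a| ^ p := by
      rw [e _ ha]
      gcongr
    linarith

theorem continuous_primitive {f : ℝ → ℝ} (hf : Continuous f) : Continuous (primitive f) :=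
  intervalIntegral.continuous_primitive (fun a b => hf.intervalIntegrable a b) 0

theorem hasDerivAt_primitive {f : ℝ → ℝ} (hf : Continuous f) (s : ℝ) :
    HasDerivAt (primitive f) (f s) s :=
  (hf.integral_hasStrictDerivAt 0 s).hasDerivAt

theorem primitive_zero (f : ℝ → ℝ) : primitive f 0 = 0 := intervalIntegral.integral_same

namespace SubcriticalGrowth

variable {f : ℝ → ℝ} {p C : ℝ} (hf : SubcriticalGrowth f p C)
include hf

theorem abs_mul_le (a b : ℝ) :
    |f a * b| ≤ C * (a ^ 2 + |a| ^ p + (b ^ 2 + |b| ^ p)) := by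
  have h1 := abs_rpow_sub_one_mul_le (by linarith [hf.two_lt] : 1 < p) a b
  have h2 : |a| * |b| ≤ a ^ 2 + b ^ 2 := by
    rw [← sq_abs a, ← sq_abs b]
    nlinarith [sq_nonneg (|a| - |b|), sq_nonneg |a|, sq_nonneg |b|]
  rw [abs_mul]
  calc |f a| * |b| ≤ C * (|a| + |a| ^ (p - 1)) * |b| := by
        have := hf.bound a
        gcongr
    _ = C * (|a| * |b| + |a| ^ (p - 1) * |b|) := by ring
    _ ≤ _ := mul_le_mul_of_nonneg_left (by linarith) hf.pos.le

theorem abs_primitive_le (a : ℝ) : |primitive f a| ≤ C * (a ^ 2 + |a| ^ p) := by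
  have h := intervalIntegral.norm_integral_le_of_norm_le_const (a := 0) (b := a) (f := f)
    (C := C * (|a| + |a| ^ (p - 1))) (fun s hs => by
      have hs' : |s| ≤ |a| := by
        rcases uIoc_subset_uIcc hs with ⟨h1, h2⟩
        rcases le_total 0 a with h | h
        · rw [min_eq_left h] at h1; rw [max_eq_right h] at h2
          rwa [abs_of_nonneg h1, abs_of_nonneg h]
        · rw [min_eq_right h] at h1; rw [max_eq_left h] at h2
          rw [abs_of_nonpos h2, abs_of_nonpos h]; linarith
      refine (hf.bound s).trans ?_
      have := hf.pos
      have := hf.two_lt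
      gcongr
      linarith)
  have e : |a| ^ p = |a| ^ (p - 1) * |a| := by
    rw [← Real.rpow_add_one' (abs_nonneg a) (by linarith [hf.two_lt]), sub_add_cancel]
  rw [Real.norm_eq_abs, sub_zero] at h
  refine h.trans (le_of_eq ?_)
  rw [e, ← sq_abs a]
  ring

theorem abs_primitive_le' (a b : ℝ) :
    |primitive f a| ≤ C * (a ^ 2 + |a| ^ p + (b ^ 2 + |b| ^ p)) := by
  refine (hf.abs_primitive_le a).trans ?_
  have : 0 ≤ b ^ 2 + |b| ^ p := by positivity
  exact mul_le_mul_of_nonneg_left (by linarith) hf.pos.le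

/-- The growth exponent p - 1 is strictly below p, so f is a bounded quantity plus an arbitrarily
small multiple of |s|^p. This permits passing to the limit when only L^p bounds are known
(`tendsto_integral_mul`). -/
theorem exists_bound {δ : ℝ} (hδ : 0 < δ) : ∃ A, 0 < A ∧ ∀ s, |f s| ≤ A + δ * |s| ^ p := by
  have hC := hf.pos
  have hp := hf.two_lt
  -- |s| ≤ 1 + |s|^{p-1} leaves the term 2C|s|^{p-1}, hence the factor 2C.
  let δ' := δ / (2 * C)
  have hδ' : 0 < δ' := by positivity
  refine ⟨C * (1 + 2 * (δ'⁻¹) ^ (p - 1)), by positivity, fun s => (hf.bound s).trans ?_⟩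
  have hs := abs_nonneg s
  have h1 : |s| ≤ 1 + |s| ^ (p - 1) := by
    rcases le_total |s| 1 with h | h
    · have : 0 ≤ |s| ^ (p - 1) := by positivity
      linarith
    · have := Real.rpow_le_rpow_of_exponent_le h (by linarith : 1 ≤ p - 1)
      rw [Real.rpow_one] at this
      linarith
  have h2 : |s| ^ (p - 1) ≤ (δ'⁻¹) ^ (p - 1) + δ' * |s| ^ p := by
    have q1 : 0 ≤ (δ'⁻¹) ^ (p - 1) := by positivity
    have q2 : 0 ≤ δ' * |s| ^ p := by positivity
    rcases le_total |s| δ'⁻¹ with h | h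
    · have := Real.rpow_le_rpow hs h (by linarith : 0 ≤ p - 1)
      linarith
    · have e : |s| ^ p = |s| ^ (p - 1) * |s| := by
        rw [← Real.rpow_add_one' hs (by linarith), sub_add_cancel]
      have h3 : 1 ≤ δ' * |s| := by
        have := mul_le_mul_of_nonneg_left h hδ'.le
        rwa [mul_inv_cancel₀ hδ'.ne'] at this
      have : |s| ^ (p - 1) ≤ δ' * |s| ^ p := by
        rw [e]
        have : 0 ≤ |s| ^ (p - 1) := by positivity
        nlinarith
      linarith
  have e : δ = 2 * C * δ' := by simp only [δ']; field_simp
  rw [e]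
  nlinarith

variable [hc : Fact (0 < c)]

theorem integrable_rpow (u : EnergySpace c) : Integrable fun z => |u z| ^ p := by
  obtain ⟨K, -, h⟩ := exists_integral_rpow_le (c := c) hf.two_lt hf.lt_four
  exact (h u).1

/-- The integrand depends on two functions so that F(u) and f(u)v are covered at once; the same
device is used for continuity. -/
theorem integrable_comp {κ : ℝ → ℝ → ℝ} (hκ : Continuous fun q : ℝ × ℝ => κ q.1 q.2)
    (hgrowth : ∀ a b, |κ a b| ≤ C * (a ^ 2 + |a| ^ p + (b ^ 2 + |b| ^ p)))
    (u v : EnergySpace c) : Integrable fun z => κ (u z) (v z) := by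
  refine ((((integrable_sq_L2R u.toL2).add (hf.integrable_rpow u)).add
    ((integrable_sq_L2R v.toL2).add (hf.integrable_rpow v))).const_mul C).mono'
    (hκ.comp_aestronglyMeasurable
      ((Lp.aestronglyMeasurable u.toL2).prodMk (Lp.aestronglyMeasurable v.toL2))) ?_
  exact Eventually.of_forall fun z => hgrowth _ _

theorem tendsto_integral_rpow_sub {u : ℕ → EnergySpace c} {u₀ : EnergySpace c}
    (hu : Tendsto u atTop (𝓝 u₀)) :
    (∀ n, Integrable fun z => |u n z - u₀ z| ^ p) ∧
      Tendsto (fun n => ∫ z, |u n z - u₀ z| ^ p) atTop (𝓝 0) := by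
  obtain ⟨K, -, h⟩ := exists_integral_rpow_le (c := c) hf.two_lt hf.lt_four
  have e : ∀ n, (fun z => |(u n - u₀) z| ^ p) =ᵐ[volume] fun z => |u n z - u₀ z| ^ p := by
    intro n
    rw [map_sub]
    filter_upwards [Lp.coeFn_sub (u n).toL2 u₀.toL2] with z hz
    rw [hz, Pi.sub_apply]
  refine ⟨fun n => (h _).1.congr (e n), ?_⟩
  have hlim : Tendsto (fun n => K * ‖u n - u₀‖ ^ p) atTop (𝓝 0) := by
    have hp : 0 < p := by linarith [hf.two_lt]
    have := ((tendsto_iff_norm_sub_tendsto_zero.1 hu).rpow_const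
      (Or.inr hp.le)).const_mul K
    simpa [Real.zero_rpow hp.ne'] using this
  refine squeeze_zero (fun n => integral_nonneg fun z => by positivity) (fun n => ?_) hlim
  rw [← integral_congr_ae (e n)]
  exact (h _).2

theorem continuous_integral_comp {κ : ℝ → ℝ → ℝ} (hκ : Continuous fun q : ℝ × ℝ => κ q.1 q.2)
    (hgrowth : ∀ a b, |κ a b| ≤ C * (a ^ 2 + |a| ^ p + (b ^ 2 + |b| ^ p))) :
    Continuous fun q : EnergySpace c × EnergySpace c => ∫ z, κ (q.1 z) (q.2 z) := by
  refine continuous_iff_seqContinuous.2 fun w w₀ hw => ?_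
  have hu : Tendsto (fun n => (w n).1) atTop (𝓝 w₀.1) := (continuous_fst.tendsto _).comp hw
  have hv : Tendsto (fun n => (w n).2) atTop (𝓝 w₀.2) := (continuous_snd.tendsto _).comp hw
  obtain ⟨hui, hul⟩ := hf.tendsto_integral_rpow_sub hu
  obtain ⟨hvi, hvl⟩ := hf.tendsto_integral_rpow_sub hv
  exact tendsto_integral_comp_of_growth (p := p) hκ (by linarith [hf.two_lt]) hf.pos.le hgrowth
    (((toL2CLM (c := c)).continuous.tendsto _).comp hu)
    (((toL2CLM (c := c)).continuous.tendsto _).comp hv)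
    (hf.integrable_rpow _) (hf.integrable_rpow _) hui hvi hul hvl

theorem continuous_mul_uncurry : Continuous fun q : ℝ × ℝ => f q.1 * q.2 :=
  (hf.continuous.comp continuous_fst).mul continuous_snd

theorem continuous_primitive_uncurry : Continuous fun q : ℝ × ℝ => primitive f q.1 :=
  (continuous_primitive hf.continuous).comp continuous_fst

theorem integrable_mul (u v : EnergySpace c) : Integrable fun z => f (u z) * v z :=
  hf.integrable_comp (κ := fun a b => f a * b) hf.continuous_mul_uncurry hf.abs_mul_le u v

theorem integrable_primitive (u : EnergySpace c) : Integrable fun z => primitive f (u z) :=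
  hf.integrable_comp (κ := fun a _ => primitive f a) hf.continuous_primitive_uncurry
    hf.abs_primitive_le' u u

theorem continuous_integral_mul :
    Continuous fun q : EnergySpace c × EnergySpace c => ∫ z, f (q.1 z) * q.2 z :=
  hf.continuous_integral_comp (κ := fun a b => f a * b) hf.continuous_mul_uncurry hf.abs_mul_le

theorem continuous_integral_primitive :
    Continuous fun u : EnergySpace c => ∫ z, primitive f (u z) :=
  (hf.continuous_integral_comp (κ := fun a _ => primitive f a) hf.continuous_primitive_uncurry
    hf.abs_primitive_le').comp (continuous_id.prodMk continuous_id)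

theorem continuous_action : Continuous (action f : EnergySpace c → ℝ) :=
  (by fun_prop : Continuous fun u : EnergySpace c => 1 / 2 * ‖u‖ ^ 2).sub
    hf.continuous_integral_primitive

omit hf in
theorem nehariFunctional_eq (u : EnergySpace c) :
    nehariFunctional f u = ‖u‖ ^ 2 - ∫ z, f (u z) * u z := by
  simp only [nehariFunctional, mul_comm]

theorem continuous_nehariFunctional : Continuous (nehariFunctional f : EnergySpace c → ℝ) := by
  have h := (hf.continuous_integral_mul (c := c)).comp (continuous_id.prodMk continuous_id)
  have e : (nehariFunctional f : EnergySpace c → ℝ) =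
      fun u => ‖u‖ ^ 2 - ∫ z, f (u z) * u z := funext nehariFunctional_eq
  rw [e]
  exact (continuous_norm.pow 2).sub h

end SubcriticalGrowth

/-- The derivative `S'(u)φ` of the action. -/
def actionDeriv [Fact (0 < c)] (f : ℝ → ℝ) (u φ : EnergySpace c) : ℝ :=
  inner ℝ u φ - ∫ z, f (u z) * φ z

namespace SubcriticalGrowth

variable {f : ℝ → ℝ} {p C : ℝ} (hf : SubcriticalGrowth f p C) [hc : Fact (0 < c)]
include hf

theorem continuous_actionDeriv :
    Continuous fun q : EnergySpace c × EnergySpace c => actionDeriv f q.1 q.2 :=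
  continuous_inner.sub hf.continuous_integral_mul

omit hf in
theorem actionDeriv_self (u : EnergySpace c) : actionDeriv f u u = nehariFunctional f u := by
  rw [nehariFunctional_eq, actionDeriv, real_inner_self_eq_norm_sq]

omit hf hc in
theorem coeFn_add_smul (w φ : EnergySpace c) (s : ℝ) :
    (w + s • φ : EnergySpace c) =ᵐ[volume] fun z => w z + s * φ z := by
  rw [map_add, map_smul]
  filter_upwards [Lp.coeFn_add w.toL2 (s • φ.toL2), Lp.coeFn_smul s φ.toL2] with z h1 h2
  rw [h1, Pi.add_apply, h2, Pi.smul_apply, smul_eq_mul]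

omit hf hc in
theorem coeFn_smul (u : EnergySpace c) (s : ℝ) :
    (s • u : EnergySpace c) =ᵐ[volume] fun z => s * u z := by
  rw [map_smul]
  filter_upwards [Lp.coeFn_smul s u.toL2] with z h2
  rw [h2, Pi.smul_apply, smul_eq_mul]

/-- Differentiation under the integral along a line; the argument needs only directional derivatives
of the action, jointly continuous in point and direction. -/
theorem hasDerivAt_integral_primitive (w φ : EnergySpace c) (s₀ : ℝ) :
    HasDerivAt (fun s : ℝ => ∫ z, primitive f ((w + s • φ : EnergySpace c) z))
      (∫ z, f ((w + s₀ • φ : EnergySpace c) z) * φ z) s₀ := by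
  have hp := hf.two_lt
  have e1 : ∀ s : ℝ, ∫ z, primitive f ((w + s • φ : EnergySpace c) z) =
      ∫ z, primitive f (w z + s * φ z) := fun s => by
    refine integral_congr_ae ?_
    filter_upwards [coeFn_add_smul w φ s] with z hz
    rw [hz]
  have e2 : ∫ z, f ((w + s₀ • φ : EnergySpace c) z) * φ z = ∫ z, f (w z + s₀ * φ z) * φ z := by
    refine integral_congr_ae ?_
    filter_upwards [coeFn_add_smul w φ s₀] with z hz
    rw [hz]
  rw [funext e1, e2]
  -- r bounds |s| on the unit ball around s₀, which makes the dominating function independent of s.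
  let r := |s₀| + 1
  have hr : 0 < r := by positivity
  have hm : ∀ s : ℝ, AEStronglyMeasurable (fun z => w z + s * φ z) volume := fun s =>
    (Lp.aestronglyMeasurable w.toL2).add ((Lp.aestronglyMeasurable φ.toL2).const_mul s)
  have hbd : Integrable fun z => C * (2 * (w z ^ 2 + r ^ 2 * φ z ^ 2) +
      2 ^ p * (|w z| ^ p + r ^ p * |φ z| ^ p) + (φ z ^ 2 + |φ z| ^ p)) :=
    (((((integrable_sq_L2R w.toL2).add ((integrable_sq_L2R φ.toL2).const_mul _)).const_mul _).add
      (((hf.integrable_rpow w).add ((hf.integrable_rpow φ).const_mul _)).const_mul _)).add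
      ((integrable_sq_L2R φ.toL2).add (hf.integrable_rpow φ))).const_mul C
  refine (hasDerivAt_integral_of_dominated_loc_of_deriv_le
    (bound := fun z => C * (2 * (w z ^ 2 + r ^ 2 * φ z ^ 2) +
      2 ^ p * (|w z| ^ p + r ^ p * |φ z| ^ p) + (φ z ^ 2 + |φ z| ^ p)))
    (F' := fun s z => f (w z + s * φ z) * φ z) (Metric.ball_mem_nhds s₀ one_pos)
    (Eventually.of_forall fun s =>
      (continuous_primitive hf.continuous).comp_aestronglyMeasurable (hm s)) ?_ ?_ ?_ hbd ?_).2
  · refine (hf.integrable_primitive (w + s₀ • φ)).congr ?_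
    filter_upwards [coeFn_add_smul w φ s₀] with z hz
    rw [hz]
  · exact (hf.continuous.comp_aestronglyMeasurable (hm s₀)).mul (Lp.aestronglyMeasurable φ.toL2)
  · refine Eventually.of_forall fun z s hs => ?_
    have hs' : |s| ≤ r := by
      have h1 : |s - s₀| < 1 := by simpa [Real.dist_eq] using hs
      have h2 := abs_sub_abs_le_abs_sub s s₀
      simp only [r]
      linarith
    refine (hf.abs_mul_le _ _).trans ?_
    have hC := hf.pos
    have hsφ : |s * φ z| ≤ r * |φ z| := by rw [abs_mul]; gcongr
    have q1 : (w z + s * φ z) ^ 2 ≤ 2 * (w z ^ 2 + r ^ 2 * φ z ^ 2) := by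
      have h3 : (s * φ z) ^ 2 ≤ r ^ 2 * φ z ^ 2 := by
        rw [← sq_abs (s * φ z), ← sq_abs (φ z), ← mul_pow]
        gcongr
      nlinarith [sq_nonneg (w z - s * φ z)]
    have q2 : |w z + s * φ z| ^ p ≤ 2 ^ p * (|w z| ^ p + r ^ p * |φ z| ^ p) := by
      refine (abs_rpow_le_two_rpow_mul (by linarith) _ (w z)).trans ?_
      rw [add_sub_cancel_left, ← Real.mul_rpow hr.le (abs_nonneg _)]
      gcongr
    gcongr
  · refine Eventually.of_forall fun z s _ => ?_
    have h1 : HasDerivAt (fun s : ℝ => w z + s * φ z) (φ z) s := by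
      simpa using ((hasDerivAt_id s).mul_const (φ z)).const_add (w z)
    exact (hasDerivAt_primitive hf.continuous _).comp s h1

theorem hasDerivAt_action (w φ : EnergySpace c) (s₀ : ℝ) :
    HasDerivAt (fun s : ℝ => action f (w + s • φ)) (actionDeriv f (w + s₀ • φ) φ) s₀ := by
  have h1 : HasDerivAt (fun s : ℝ => w + s • φ) φ s₀ := by
    simpa using ((hasDerivAt_id s₀).smul_const φ).const_add w
  have h2 := (h1.norm_sq).const_mul (1 / 2 : ℝ)
  have h3 := h2.sub (hf.hasDerivAt_integral_primitive w φ s₀)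
  exact h3.congr_deriv (by rw [actionDeriv]; ring)

theorem hasDerivAt_action_smul (u : EnergySpace c) (t : ℝ) :
    HasDerivAt (fun t : ℝ => action f (t • u)) (actionDeriv f (t • u) u) t := by
  have h := hf.hasDerivAt_action 0 u t
  simp only [zero_add] at h
  exact h

end SubcriticalGrowth

end Shrira

/-! ### The Nehari manifold and the projection along rays. -/

namespace Shrira

variable {c : ℝ}

/-- The hypotheses on the nonlinearity under which the Nehari method applies. -/
structure NehariConditions (c : ℝ) [Fact (0 < c)] (f : ℝ → ℝ) (p C μ : ℝ) : Prop
    extends SubcriticalGrowth f p C where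
  isLittleO : f =o[𝓝 0] (fun u : ℝ => u)
  two_lt_mu : 2 < μ
  superquadratic : ∀ u : ℝ, u ≠ 0 → 0 < μ * primitive f u ∧ μ * primitive f u ≤ u * f u
  fiber : ∀ u : EnergySpace c, u ≠ 0 →
    StrictMonoOn (fun t : ℝ => t⁻¹ * ∫ z, u z * f (t * u z)) (Set.Ioi 0) ∧
    Tendsto (fun t : ℝ => t⁻¹ * ∫ z, u z * f (t * u z)) atTop atTop

/-- For t ≠ 0 the sign of I(tu) is read off from the bracket, whose second term is the function
assumed strictly increasing. -/
theorem nehariFunctional_smul [Fact (0 < c)] (f : ℝ → ℝ) (u : EnergySpace c) {t : ℝ}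
    (ht : t ≠ 0) :
    nehariFunctional f (t • u) = t ^ 2 * (‖u‖ ^ 2 - t⁻¹ * ∫ z, u z * f (t * u z)) := by
  have e : ∫ z, (t • u : EnergySpace c) z * f ((t • u : EnergySpace c) z) =
      t * ∫ z, u z * f (t * u z) := by
    rw [← integral_const_mul]
    refine integral_congr_ae ?_
    filter_upwards [SubcriticalGrowth.coeFn_smul u t] with z hz
    rw [hz, mul_assoc]
  rw [nehariFunctional, e, norm_smul, mul_pow, Real.norm_eq_abs, sq_abs]
  field_simp

theorem actionDeriv_smul_right [Fact (0 < c)] (f : ℝ → ℝ) (u φ : EnergySpace c) (a : ℝ) :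
    actionDeriv f u (a • φ) = a * actionDeriv f u φ := by
  have e : ∫ z, f (u z) * (a • φ : EnergySpace c) z = a * ∫ z, f (u z) * φ z := by
    rw [← integral_const_mul]
    refine integral_congr_ae ?_
    filter_upwards [SubcriticalGrowth.coeFn_smul φ a] with z hz
    rw [hz]
    ring
  rw [actionDeriv, actionDeriv, e, real_inner_smul_right]
  ring

namespace NehariConditions

variable {f : ℝ → ℝ} {p C μ : ℝ} [hc : Fact (0 < c)] (hf : NehariConditions c f p C μ)
include hf

/-- Near zero the little-o condition gives ε s². For |s| ≥ δ one has s² ≤ δ^{-(p-2)}|s|^p, so the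
quadratic part of the growth bound is absorbed by the p-th power. -/
theorem exists_mul_le {ε : ℝ} (hε : 0 < ε) :
    ∃ A, 0 < A ∧ ∀ s, s * f s ≤ ε * s ^ 2 + A * |s| ^ p := by
  have hp := hf.two_lt
  have hC := hf.pos
  obtain ⟨δ, hδ, h⟩ := Metric.eventually_nhds_iff.1 (hf.isLittleO.def hε)
  have hA : 0 < C * (δ⁻¹ ^ (p - 2) + 1) := by positivity
  refine ⟨_, hA, fun s => ?_⟩
  have hs := abs_nonneg s
  have h0 : s * f s ≤ |s| * |f s| := (le_abs_self _).trans (abs_mul _ _).le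
  have hsp : 0 ≤ |s| ^ p := by positivity
  rcases lt_or_ge |s| δ with hlt | hge
  · have h1 : |f s| ≤ ε * |s| := h (by simpa [Real.dist_eq] using hlt)
    have h2 : |s| * |f s| ≤ |s| * (ε * |s|) := mul_le_mul_of_nonneg_left h1 hs
    have h3 : 0 ≤ C * (δ⁻¹ ^ (p - 2) + 1) * |s| ^ p := mul_nonneg hA.le hsp
    have h4 : |s| * (ε * |s|) = ε * s ^ 2 := by rw [← sq_abs s]; ring
    linarith
  · have hs0 : 0 < |s| := hδ.trans_le hge
    have e1 : |s| ^ p = |s| * |s| ^ (p - 1) := by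
      rw [Real.rpow_sub_one hs0.ne']; field_simp
    have e2 : |s| ^ p = |s| ^ 2 * |s| ^ (p - 2) := by
      rw [Real.rpow_sub hs0, Real.rpow_two]; field_simp
    have h1 : 1 ≤ δ⁻¹ ^ (p - 2) * |s| ^ (p - 2) := by
      rw [← Real.mul_rpow (by positivity) hs]
      refine Real.one_le_rpow ?_ (by linarith)
      rw [inv_mul_eq_div, le_div_iff₀ hδ]
      linarith
    have h2 : |s| ^ 2 ≤ δ⁻¹ ^ (p - 2) * |s| ^ p := by
      rw [e2]
      nlinarith [sq_nonneg |s|]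
    have h3 : |s| * |f s| ≤ |s| * (C * (|s| + |s| ^ (p - 1))) :=
      mul_le_mul_of_nonneg_left (hf.bound s) hs
    have h4 : |s| * (C * (|s| + |s| ^ (p - 1))) = C * (|s| ^ 2 + |s| ^ p) := by rw [e1]; ring
    have h5 : C * (|s| ^ 2 + |s| ^ p) ≤ C * (δ⁻¹ ^ (p - 2) + 1) * |s| ^ p := by
      rw [mul_assoc]
      refine mul_le_mul_of_nonneg_left ?_ hC.le
      linarith
    have h6 : 0 ≤ ε * s ^ 2 := by positivity
    linarith

theorem integrable_mul_self (u : EnergySpace c) : Integrable fun z => u z * f (u z) := by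
  simpa only [mul_comm] using hf.integrable_mul u u

/-- The quadratic term is taken with coefficient c/2, which is absorbed by half of the energy norm.
-/
theorem exists_half_sq_sub_le :
    ∃ A, 0 < A ∧ ∀ u : EnergySpace c,
      1 / 2 * ‖u‖ ^ 2 - A * ∫ z, |u z| ^ p ≤ nehariFunctional f u := by
  have hc0 := hc.out
  obtain ⟨A, hA, h⟩ := hf.exists_mul_le (half_pos hc0)
  refine ⟨A, hA, fun u => ?_⟩
  have h1 : ∫ z, u z * f (u z) ≤ ∫ z, (c / 2 * u z ^ 2 + A * |u z| ^ p) :=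
    integral_mono (hf.integrable_mul_self u)
      (((integrable_sq_L2R u.toL2).const_mul _).add ((hf.integrable_rpow u).const_mul _))
      fun z => h _
  rw [integral_add ((integrable_sq_L2R u.toL2).const_mul _) ((hf.integrable_rpow u).const_mul _),
    integral_const_mul, integral_const_mul, ← norm_sq_eq_integral_L2R] at h1
  have h2 := norm_toL2_sq_le u
  rw [le_div_iff₀ hc0] at h2
  rw [nehariFunctional]
  linarith

/-- The functional `I` is positive on a punctured ball around the origin. -/
theorem exists_nehariFunctional_pos :
    ∃ r, 0 < r ∧ ∀ u : EnergySpace c, u ≠ 0 → ‖u‖ < r → 0 < nehariFunctional f u := by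
  have hp := hf.two_lt
  obtain ⟨A, hA, h⟩ := hf.exists_half_sq_sub_le
  obtain ⟨K, hK, hpow⟩ := exists_integral_rpow_le (c := c) hf.two_lt hf.lt_four
  -- The radius r solves A K r^{p-2} = 1/2, so below it the p-th power term is less than half the
  -- squared norm.
  refine ⟨(1 / (2 * A * K)) ^ (1 / (p - 2)), by positivity, fun u hu hur => ?_⟩
  have hu0 : 0 < ‖u‖ := norm_pos_iff.2 hu
  have h1 : ‖u‖ ^ (p - 2) < 1 / (2 * A * K) := by
    have := Real.rpow_lt_rpow hu0.le hur (by linarith : 0 < p - 2)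
    rwa [← Real.rpow_mul (by positivity), one_div_mul_cancel (by linarith), Real.rpow_one] at this
  rw [lt_div_iff₀ (by positivity)] at h1
  have e : ‖u‖ ^ p = ‖u‖ ^ 2 * ‖u‖ ^ (p - 2) := by
    rw [Real.rpow_sub hu0, Real.rpow_two]; field_simp
  have h2 := (hpow u).2
  rw [e] at h2
  have h3 := mul_le_mul_of_nonneg_left h2 hA.le
  have h4 : ‖u‖ ^ 2 * (‖u‖ ^ (p - 2) * (2 * A * K)) < ‖u‖ ^ 2 * 1 :=
    mul_lt_mul_of_pos_left h1 (by positivity)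
  have := h u
  nlinarith

/-- On the manifold I = 0 gives ½‖u‖² ≤ A ∫ |u|^p, while ‖u‖ is bounded below. This excludes
vanishing of minimizing sequences. -/
theorem exists_integral_rpow_ge :
    ∃ η, 0 < η ∧ ∀ u ∈ nehariManifold c f, η ≤ ∫ z, |u z| ^ p := by
  obtain ⟨A, hA, h⟩ := hf.exists_half_sq_sub_le
  obtain ⟨r, hr, hpos⟩ := hf.exists_nehariFunctional_pos
  refine ⟨r ^ 2 / (2 * A), by positivity, fun u hu => ?_⟩
  have h1 : r ≤ ‖u‖ := by
    by_contra! hlt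
    exact (hpos u hu.2 hlt).ne' hu.1
  have h2 := h u
  rw [hu.1] at h2
  have h3 : r ^ 2 ≤ ‖u‖ ^ 2 := by gcongr
  rw [div_le_iff₀ (by positivity)]
  linarith

theorem primitive_nonneg (s : ℝ) : 0 ≤ primitive f s := by
  rcases eq_or_ne s 0 with rfl | hs
  · rw [primitive_zero]
  · exact (pos_of_mul_pos_right (hf.superquadratic s hs).1 (by linarith [hf.two_lt_mu])).le

theorem mul_primitive_le (s : ℝ) : μ * primitive f s ≤ s * f s := by
  rcases eq_or_ne s 0 with rfl | hs
  · simp [primitive_zero]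
  · exact (hf.superquadratic s hs).2

/-- A consequence of μ > 2. Its integral is S - ½I, so it represents S on the manifold by a
nonnegative integrand, as Fatou's lemma requires. -/
theorem half_mul_sub_primitive_nonneg (s : ℝ) : 0 ≤ 1 / 2 * (s * f s) - primitive f s := by
  have h1 := hf.primitive_nonneg s
  have h2 := hf.mul_primitive_le s
  have h3 := hf.two_lt_mu
  nlinarith

theorem action_sub_half_nehariFunctional (u : EnergySpace c) :
    action f u - 1 / 2 * nehariFunctional f u =
      ∫ z, (1 / 2 * (u z * f (u z)) - primitive f (u z)) := by
  rw [integral_sub ((hf.integrable_mul_self u).const_mul _) (hf.integrable_primitive u),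
    integral_const_mul, action, nehariFunctional]
  ring

theorem half_nehariFunctional_le_action (u : EnergySpace c) :
    1 / 2 * nehariFunctional f u ≤ action f u := by
  have h := hf.action_sub_half_nehariFunctional u
  have : 0 ≤ ∫ z, (1 / 2 * (u z * f (u z)) - primitive f (u z)) :=
    integral_nonneg fun z => hf.half_mul_sub_primitive_nonneg _
  linarith

/-- Coercivity on the manifold, where ∫ F(u) ≤ μ⁻¹ ∫ u f(u) = μ⁻¹‖u‖². It bounds minimizing
sequences. -/
theorem mul_norm_sq_le_action {u : EnergySpace c} (hu : u ∈ nehariManifold c f) :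
    (1 / 2 - 1 / μ) * ‖u‖ ^ 2 ≤ action f u := by
  have hμ : 0 < μ := by linarith [hf.two_lt_mu]
  have h1 : μ * ∫ z, primitive f (u z) ≤ ∫ z, u z * f (u z) := by
    rw [← integral_const_mul]
    exact integral_mono ((hf.integrable_primitive u).const_mul _) (hf.integrable_mul_self u)
      fun z => hf.mul_primitive_le _
  have h2 : ‖u‖ ^ 2 - ∫ z, u z * f (u z) = 0 := hu.1
  have h3 : ∫ z, primitive f (u z) ≤ 1 / μ * ‖u‖ ^ 2 := by
    rw [one_div, ← div_eq_inv_mul, le_div_iff₀ hμ]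
    linarith
  rw [action]
  linarith

theorem action_nonneg {u : EnergySpace c} (hu : u ∈ nehariManifold c f) : 0 ≤ action f u := by
  have := hf.half_nehariFunctional_le_action u
  rw [hu.1] at this
  linarith

/-! ### The Nehari projection along rays -/

theorem continuous_nehariFunctional_smul (u : EnergySpace c) :
    Continuous fun t : ℝ => nehariFunctional f (t • u) :=
  hf.continuous_nehariFunctional.comp (continuous_id.smul continuous_const)

/-- I(tu) is positive for small t and negative for large t by the divergence in (A5); the
intermediate value theorem applies. -/
theorem exists_smul_mem {u : EnergySpace c} (hu : u ≠ 0) :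
    ∃ t : ℝ, 0 < t ∧ nehariFunctional f (t • u) = 0 := by
  obtain ⟨r, hr, hpos⟩ := hf.exists_nehariFunctional_pos
  have hu0 : 0 < ‖u‖ := norm_pos_iff.2 hu
  let a := r / (2 * ‖u‖)
  have ha : 0 < a := by positivity
  have h1 : 0 < nehariFunctional f (a • u) := by
    refine hpos _ (smul_ne_zero ha.ne' hu) ?_
    rw [norm_smul, Real.norm_of_nonneg ha.le]
    simp only [a]
    field_simp
    linarith
  obtain ⟨b, hb1, hb2⟩ := (((hf.fiber u hu).2.eventually_gt_atTop (‖u‖ ^ 2)).and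
    (eventually_gt_atTop a)).exists
  have hb : 0 < b := ha.trans hb2
  have h2 : nehariFunctional f (b • u) < 0 := by
    rw [nehariFunctional_smul f u hb.ne']
    exact mul_neg_of_pos_of_neg (by positivity) (by linarith)
  obtain ⟨t, ht, h⟩ := intermediate_value_Icc' hb2.le
    (hf.continuous_nehariFunctional_smul u).continuousOn ⟨h2.le, h1.le⟩
  exact ⟨t, ha.trans_le ht.1, h⟩

theorem nehariFunctional_smul_pos_of_lt {u : EnergySpace c} (hu : u ≠ 0) {s t : ℝ} (hs : 0 < s)
    (hst : s < t) (ht : nehariFunctional f (t • u) = 0) : 0 < nehariFunctional f (s • u) := by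
  have ht0 := hs.trans hst
  rw [nehariFunctional_smul f u ht0.ne'] at ht
  have h1 := (mul_eq_zero.1 ht).resolve_left (by positivity)
  have h2 := (hf.fiber u hu).1 hs ht0 hst
  rw [nehariFunctional_smul f u hs.ne']
  exact mul_pos (by positivity) (by simp only at h2; linarith)

theorem nehariFunctional_smul_neg_of_lt {u : EnergySpace c} (hu : u ≠ 0) {s t : ℝ} (ht0 : 0 < t)
    (hst : t < s) (ht : nehariFunctional f (t • u) = 0) : nehariFunctional f (s • u) < 0 := by
  have hs := ht0.trans hst
  rw [nehariFunctional_smul f u ht0.ne'] at ht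
  have h1 := (mul_eq_zero.1 ht).resolve_left (by positivity)
  have h2 := (hf.fiber u hu).1 ht0 hs hst
  rw [nehariFunctional_smul f u hs.ne']
  exact mul_neg_of_pos_of_neg (by positivity) (by simp only at h2; linarith)

omit hf in
theorem actionDeriv_smul_self (u : EnergySpace c) {t : ℝ} (ht : 0 < t) :
    actionDeriv f (t • u) u = t⁻¹ * nehariFunctional f (t • u) := by
  rw [← SubcriticalGrowth.actionDeriv_self, actionDeriv_smul_right, inv_mul_cancel_left₀ ht.ne']

/-- Along a ray the action is largest at the point of the Nehari manifold. -/
theorem action_smul_le {u : EnergySpace c} (hu : u ≠ 0) {s t : ℝ} (hs : 0 ≤ s) (ht0 : 0 < t)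
    (ht : nehariFunctional f (t • u) = 0) : action f (s • u) ≤ action f (t • u) := by
  have hcont : Continuous fun t : ℝ => action f (t • u) :=
    hf.continuous_action.comp (continuous_id.smul continuous_const)
  rcases le_total s t with hst | hst
  · refine monotoneOn_of_deriv_nonneg (convex_Icc 0 t) hcont.continuousOn
      (fun x _ => (hf.hasDerivAt_action_smul u x).differentiableAt.differentiableWithinAt)
      (fun x hx => ?_) ⟨hs, hst⟩ ⟨ht0.le, le_rfl⟩ hst
    rw [interior_Icc] at hx
    rw [(hf.hasDerivAt_action_smul u x).deriv, actionDeriv_smul_self u hx.1]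
    exact mul_nonneg (inv_nonneg.2 hx.1.le)
      (hf.nehariFunctional_smul_pos_of_lt hu hx.1 hx.2 ht).le
  · refine antitoneOn_of_deriv_nonpos (convex_Ici t) hcont.continuousOn
      (fun x _ => (hf.hasDerivAt_action_smul u x).differentiableAt.differentiableWithinAt)
      (fun x hx => ?_) self_mem_Ici hst hst
    rw [interior_Ici] at hx
    have hx0 : 0 < x := ht0.trans hx
    rw [(hf.hasDerivAt_action_smul u x).deriv, actionDeriv_smul_self u hx0]
    exact mul_nonpos_of_nonneg_of_nonpos (inv_nonneg.2 hx0.le)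
      (hf.nehariFunctional_smul_neg_of_lt hu ht0 hx ht).le

/-- Far out on the ray the derivative x(‖u‖² - x⁻¹∫ u f(xu)) is at most -1, so the action eventually
becomes negative. -/
theorem exists_action_smul_neg {u : EnergySpace c} (hu : u ≠ 0) :
    ∃ t : ℝ, 0 < t ∧ action f (t • u) < 0 := by
  obtain ⟨a, ha⟩ := eventually_atTop.1 (((hf.fiber u hu).2.eventually_ge_atTop (‖u‖ ^ 2 + 1)).and
    (eventually_ge_atTop 1))
  have hcont : Continuous fun t : ℝ => action f (t • u) :=
    hf.continuous_action.comp (continuous_id.smul continuous_const)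
  have ha1 : 1 ≤ a := (ha a le_rfl).2
  have hderiv : ∀ x ∈ interior (Ici a), deriv (fun t : ℝ => action f (t • u)) x ≤ -1 := by
    intro x hx
    rw [interior_Ici] at hx
    obtain ⟨h1, h2⟩ := ha x (le_of_lt hx)
    have hx0 : 0 < x := by linarith
    rw [(hf.hasDerivAt_action_smul u x).deriv, actionDeriv_smul_self u hx0,
      nehariFunctional_smul f u hx0.ne']
    have e : x⁻¹ * (x ^ 2 * (‖u‖ ^ 2 - x⁻¹ * ∫ z, u z * f (x * u z))) =
        x * (‖u‖ ^ 2 - x⁻¹ * ∫ z, u z * f (x * u z)) := by field_simp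
    rw [e]
    nlinarith
  -- A step longer than |S(au)| with slope at most -1 ends below zero.
  let b := a + |action f (a • u)| + 1
  have hab : a ≤ b := by
    have := abs_nonneg (action f (a • u))
    simp only [b]; linarith
  have h := (convex_Ici a).image_sub_le_mul_sub_of_deriv_le hcont.continuousOn
    (fun x _ => (hf.hasDerivAt_action_smul u x).differentiableAt.differentiableWithinAt)
    hderiv a self_mem_Ici b hab hab
  refine ⟨b, by linarith, ?_⟩
  have h1 := le_abs_self (action f (a • u))
  simp only [b] at h ⊢
  linarith

/-- The factor that scales a nonzero `u` onto the Nehari manifold. -/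
def scale (u : EnergySpace c) : ℝ :=
  -- The value 1 at the origin is a default that keeps the factor positive everywhere.
  open Classical in if hu : u ≠ 0 then (hf.exists_smul_mem hu).choose else 1

theorem scale_pos (u : EnergySpace c) : 0 < hf.scale u := by
  rw [scale]
  split_ifs with hu
  · exact (hf.exists_smul_mem hu).choose_spec.1
  · exact one_pos

theorem nehariFunctional_scale_smul {u : EnergySpace c} (hu : u ≠ 0) :
    nehariFunctional f (hf.scale u • u) = 0 := by
  rw [scale, dif_pos hu]
  exact (hf.exists_smul_mem hu).choose_spec.2

theorem scale_smul_mem {u : EnergySpace c} (hu : u ≠ 0) : hf.scale u • u ∈ nehariManifold c f :=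
  ⟨hf.nehariFunctional_scale_smul hu, smul_ne_zero (hf.scale_pos u).ne' hu⟩

theorem lt_scale {u : EnergySpace c} (hu : u ≠ 0) {t : ℝ}
    (h : 0 < nehariFunctional f (t • u)) : t < hf.scale u := by
  by_contra! hle
  rcases hle.eq_or_lt with e | hlt
  · rw [← e, hf.nehariFunctional_scale_smul hu] at h
    exact h.false
  · exact h.not_gt
      (hf.nehariFunctional_smul_neg_of_lt hu (hf.scale_pos u) hlt (hf.nehariFunctional_scale_smul hu))

theorem scale_lt {u : EnergySpace c} (hu : u ≠ 0) {t : ℝ} (ht : 0 < t)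
    (h : nehariFunctional f (t • u) < 0) : hf.scale u < t := by
  by_contra! hle
  rcases hle.eq_or_lt with e | hlt
  · rw [e, hf.nehariFunctional_scale_smul hu] at h
    exact h.false
  · exact h.not_gt
      (hf.nehariFunctional_smul_pos_of_lt hu ht hlt (hf.nehariFunctional_scale_smul hu))

theorem eq_scale {u : EnergySpace c} (hu : u ≠ 0) {t : ℝ} (ht : 0 < t)
    (h : nehariFunctional f (t • u) = 0) : t = hf.scale u := by
  rcases lt_trichotomy t (hf.scale u) with h' | h' | h'
  · exact absurd h (hf.nehariFunctional_smul_pos_of_lt hu ht h'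
      (hf.nehariFunctional_scale_smul hu)).ne'
  · exact h'
  · exact absurd h (hf.nehariFunctional_smul_neg_of_lt hu (hf.scale_pos u) h'
      (hf.nehariFunctional_scale_smul hu)).ne

/-- By uniqueness the projected point depends only on the ray; this moves freely between the unit
sphere and all nonzero vectors. -/
theorem scale_smul {u : EnergySpace c} (hu : u ≠ 0) {a : ℝ} (ha : 0 < a) :
    hf.scale (a • u) • a • u = hf.scale u • u := by
  rw [smul_smul, ← hf.eq_scale hu (mul_pos (hf.scale_pos _) ha)]
  rw [← smul_smul]
  exact hf.nehariFunctional_scale_smul (smul_ne_zero ha.ne' hu)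

theorem scale_smul_of_mem {u : EnergySpace c} (hu : u ∈ nehariManifold c f) :
    hf.scale u • u = u := by
  rw [← hf.eq_scale hu.2 one_pos (by rw [one_smul]; exact hu.1), one_smul]

/-- For fixed t the sign of I(tv) is an open condition in v, and it decides on which side of t the
factor lies. No differentiability of I is involved. -/
theorem continuousAt_scale {u : EnergySpace c} (hu : u ≠ 0) : ContinuousAt hf.scale u := by
  have hI : ∀ t : ℝ, Continuous fun v : EnergySpace c => nehariFunctional f (t • v) := fun t =>
    hf.continuous_nehariFunctional.comp (continuous_const_smul t)
  have hne : ∀ᶠ v in 𝓝 u, v ≠ 0 := isOpen_ne.mem_nhds hu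
  have hτ := hf.scale_pos u
  have h0 := hf.nehariFunctional_scale_smul hu
  refine tendsto_order.2 ⟨fun a ha => ?_, fun b hb => ?_⟩
  -- The lower bound is raised to stay positive, since the sign argument on rays needs a positive
  -- parameter.
  · let a' := max a (hf.scale u / 2)
    have ha' : 0 < a' := lt_max_of_lt_right (by linarith)
    have hlt : a' < hf.scale u := max_lt ha (by linarith)
    filter_upwards [hne, (hI a').continuousAt.eventually_const_lt
      (hf.nehariFunctional_smul_pos_of_lt hu ha' hlt h0)] with v hv h
    exact (le_max_left _ _).trans_lt (hf.lt_scale hv h)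
  · filter_upwards [hne, (hI b).continuousAt.eventually_lt_const
      (hf.nehariFunctional_smul_neg_of_lt hu hτ hb h0)] with v hv h
    exact hf.scale_lt hv (hτ.trans hb) h

end NehariConditions

end Shrira

/-! ### Weak limits and almost critical points. -/

namespace Shrira

variable {c : ℝ}

/-- Riesz representation carries the sequence to the dual, where closed balls are sequentially
weak-* compact because the space is separable. -/
theorem exists_subseq_tendsto_weak {E : Type*} [NormedAddCommGroup E] [InnerProductSpace ℝ E]
    [CompleteSpace E] [TopologicalSpace.SeparableSpace E] {u : ℕ → E} {M : ℝ}
    (hM : ∀ n, ‖u n‖ ≤ M) :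
    ∃ u₀ : E, ∃ ns : ℕ → ℕ, StrictMono ns ∧
      ∀ ℓ : E →L[ℝ] ℝ, Tendsto (fun n => ℓ (u (ns n))) atTop (𝓝 (ℓ u₀)) := by
  let x : ℕ → WeakDual ℝ E := fun n =>
    StrongDual.toWeakDual (InnerProductSpace.toDual ℝ E (u n))
  obtain ⟨a, -, ns, hns, ha⟩ := WeakDual.isSeqCompact_closedBall ℝ E 0 M (x := x) fun n => by
    simpa [x] using hM n
  refine ⟨(InnerProductSpace.toDual ℝ E).symm (WeakDual.toStrongDual a), ns, hns, fun ℓ => ?_⟩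
  have h := (WeakBilin.tendsto_iff_forall_eval_tendsto _ ContinuousLinearMap.coe_injective).1 ha
    ((InnerProductSpace.toDual ℝ E).symm ℓ)
  have e : ∀ v : E, ℓ v = inner ℝ v ((InnerProductSpace.toDual ℝ E).symm ℓ) := fun v => by
    rw [real_inner_comm, InnerProductSpace.toDual_symm_apply]
  simp only [e]
  rw [InnerProductSpace.toDual_symm_apply]
  exact h

/-- Fatou's lemma for integrals of nonnegative real functions. -/
theorem integral_le_of_tendsto_ae {α : Type*} [MeasurableSpace α] {ν : Measure α}
    {k : ℕ → α → ℝ} {k₀ : α → ℝ} {b : ℕ → ℝ} {b₀ : ℝ} (hk : ∀ n, Integrable (k n) ν)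
    (hk₀ : Integrable k₀ ν) (hpos : ∀ n z, 0 ≤ k n z) (hpos₀ : ∀ z, 0 ≤ k₀ z)
    (hb : ∀ n, ∫ z, k n z ∂ν ≤ b n) (hlim : Tendsto b atTop (𝓝 b₀))
    (hae : ∀ᵐ z ∂ν, Tendsto (fun n => k n z) atTop (𝓝 (k₀ z))) :
    ∫ z, k₀ z ∂ν ≤ b₀ := by
  have hb₀ : 0 ≤ b₀ := ge_of_tendsto' hlim fun n => (integral_nonneg (hpos n)).trans (hb n)
  rw [← ENNReal.ofReal_le_ofReal_iff hb₀,
    ofReal_integral_eq_lintegral_ofReal hk₀ (Eventually.of_forall hpos₀)]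
  calc ∫⁻ z, ENNReal.ofReal (k₀ z) ∂ν
      = ∫⁻ z, liminf (fun n => ENNReal.ofReal (k n z)) atTop ∂ν := by
        refine lintegral_congr_ae ?_
        filter_upwards [hae] with z hz
        exact ((ENNReal.continuous_ofReal.tendsto _).comp hz).liminf_eq.symm
    _ ≤ liminf (fun n => ∫⁻ z, ENNReal.ofReal (k n z) ∂ν) atTop :=
        lintegral_liminf_le' fun n => (hk n).aestronglyMeasurable.aemeasurable.ennreal_ofReal
    _ ≤ liminf (fun n => ENNReal.ofReal (b n)) atTop := by
        refine liminf_le_liminf (Eventually.of_forall fun n => ?_)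
        rw [← ofReal_integral_eq_lintegral_ofReal (hk n) (Eventually.of_forall (hpos n))]
        exact ENNReal.ofReal_le_ofReal (hb n)
    _ = ENNReal.ofReal b₀ := ((ENNReal.continuous_ofReal.tendsto _).comp hlim).liminf_eq

theorem action_translate [Fact (0 < c)] (f : ℝ → ℝ) (a : Plane) (u : EnergySpace c) :
    action f (translate a u) = action f u := by
  rw [action, action, LinearIsometry.norm_map, integral_translate_comp]

theorem translate_mem_nehariManifold [Fact (0 < c)] {f : ℝ → ℝ} (a : Plane) {u : EnergySpace c}
    (hu : u ∈ nehariManifold c f) : translate a u ∈ nehariManifold c f := by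
  refine ⟨?_, fun h => hu.2 ?_⟩
  · rw [← hu.1, nehariFunctional, nehariFunctional, LinearIsometry.norm_map,
      integral_translate_comp (fun s => s * f s)]
  · rw [← norm_eq_zero, ← (translate a).norm_map, h, norm_zero]

theorem actionDeriv_translate [Fact (0 < c)] (f : ℝ → ℝ) (a : Plane) (u φ : EnergySpace c) :
    actionDeriv f (translate a u) φ = actionDeriv f u (translate (-a) φ) := by
  rw [actionDeriv, actionDeriv, inner_translate_left, integral_translate_mul]

/-- Normalizing a vector moves it by |1 - ‖v‖| ≤ ‖v - w‖. The factor 2 is compensated by applying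
Ekeland's principle with ε/2. -/
theorem norm_div_norm_sub_le {E : Type*} [NormedAddCommGroup E] [NormedSpace ℝ E] {v w : E}
    (hw : ‖w‖ = 1) (hv : v ≠ 0) : ‖‖v‖⁻¹ • v - w‖ ≤ 2 * ‖v - w‖ := by
  have hv0 : ‖v‖ ≠ 0 := norm_ne_zero_iff.2 hv
  have h1 : ‖‖v‖⁻¹ • v - v‖ ≤ ‖v - w‖ := by
    have e : ‖v‖⁻¹ • v - v = (‖v‖⁻¹ - 1) • v := by rw [sub_smul, one_smul]
    have e2 : ‖(‖v‖⁻¹ - 1) • v‖ = |1 - ‖v‖| := by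
      rw [norm_smul, Real.norm_eq_abs, ← abs_of_nonneg (norm_nonneg v), ← abs_mul,
        abs_of_nonneg (norm_nonneg v), sub_mul, inv_mul_cancel₀ hv0, one_mul]
    rw [e, e2, ← hw, norm_sub_rev]
    exact abs_norm_sub_norm_le w v
  calc ‖‖v‖⁻¹ • v - w‖ = ‖(‖v‖⁻¹ • v - v) + (v - w)‖ := by rw [sub_add_sub_cancel]
    _ ≤ _ := (norm_add_le _ _).trans (by linarith)

namespace NehariConditions

variable {f : ℝ → ℝ} {p C μ : ℝ} [hc : Fact (0 < c)] (hf : NehariConditions c f p C μ)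
include hf

theorem continuous_actionDeriv_comp {X : Type*} [TopologicalSpace X] {g h : X → EnergySpace c}
    (hg : Continuous g) (hh : Continuous h) : Continuous fun x => actionDeriv f (g x) (h x) :=
  hf.continuous_actionDeriv.comp (hg.prodMk hh)

theorem continuous_smul_actionDeriv (w φ : EnergySpace c) :
    Continuous fun q : ℝ × ℝ => q.1 * actionDeriv f (q.1 • w + q.2 • q.1 • φ) φ := by
  have h : Continuous fun q : ℝ × ℝ => q.1 • w + q.2 • q.1 • φ :=
    (continuous_fst.smul continuous_const).add
      (continuous_snd.smul (continuous_fst.smul continuous_const))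
  exact continuous_fst.mul (hf.continuous_actionDeriv_comp h continuous_const)

/-- At an almost minimal point of the fibrewise maximum of the action, the derivative of the
action is almost nonnegative in every direction. -/
theorem neg_le_actionDeriv_of_almost_min {w : EnergySpace c} (hw : w ≠ 0) {ε : ℝ}
    (hmin : ∀ v : EnergySpace c, v ≠ 0 →
      action f (hf.scale w • w) - ε * ‖v - w‖ ≤ action f (hf.scale v • v))
    (φ : EnergySpace c) :
    -(ε * ‖φ‖) ≤ hf.scale w * actionDeriv f (hf.scale w • w) φ := by
  by_contra! hlt
  -- G(t, σ) is the derivative in σ of S(tw + σtφ). If it is too negative at (τ(w), 0), it stays so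
  -- nearby, and continuity of τ keeps t = τ(w + sφ) in that neighbourhood for small s.
  let G : ℝ × ℝ → ℝ := fun q => q.1 * actionDeriv f (q.1 • w + q.2 • q.1 • φ) φ
  have hG : Continuous G := hf.continuous_smul_actionDeriv w φ
  have hG0 : G (hf.scale w, 0) < -(ε * ‖φ‖) := by simpa [G] using hlt
  have hev := hG.continuousAt.eventually_lt_const hG0
  rw [nhds_prod_eq, eventually_prod_iff] at hev
  obtain ⟨pa, hpa, pb, hpb, hab⟩ := hev
  obtain ⟨δ, hδ, hball⟩ := Metric.eventually_nhds_iff.1 hpb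
  have hpath : Continuous fun s : ℝ => w + s • φ := by fun_prop
  have hpath0 : w + (0 : ℝ) • φ = w := by simp
  have h1 : ∀ᶠ s in 𝓝 (0 : ℝ), w + s • φ ≠ 0 :=
    hpath.continuousAt.eventually_ne (by rwa [hpath0])
  have h2 : ∀ᶠ s in 𝓝 (0 : ℝ), pa (hf.scale (w + s • φ)) := by
    refine (ContinuousAt.comp (f := fun s : ℝ => w + s • φ) (g := hf.scale) (x := 0) ?_
      hpath.continuousAt).eventually (by
        rw [show (hf.scale ∘ fun s : ℝ => w + s • φ) 0 = hf.scale w from congrArg hf.scale hpath0]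
        exact hpa)
    rw [hpath0]
    exact hf.continuousAt_scale hw
  obtain ⟨δ', hδ', h12⟩ := Metric.eventually_nhds_iff.1 (h1.and h2)
  let s := min δ δ' / 2
  have hmpos : 0 < min δ δ' := lt_min hδ hδ'
  have hs : 0 < s := half_pos hmpos
  have hsδ : s < δ := (half_lt_self hmpos).trans_le (min_le_left _ _)
  have hsδ' : s < δ' := (half_lt_self hmpos).trans_le (min_le_right _ _)
  obtain ⟨hv, hpav⟩ := h12 (y := s) (by simpa [abs_of_pos hs] using hsδ')
  let t := hf.scale (w + s • φ)
  have ht : 0 < t := hf.scale_pos _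
  have hd : ∀ x, HasDerivAt (fun σ : ℝ => action f (t • w + σ • t • φ))
      (actionDeriv f (t • w + x • t • φ) (t • φ)) x := fun x => hf.hasDerivAt_action _ _ x
  obtain ⟨σ, hσ, he⟩ := exists_hasDerivAt_eq_slope (fun σ : ℝ => action f (t • w + σ • t • φ))
    (fun x => actionDeriv f (t • w + x • t • φ) (t • φ)) hs
    (fun x _ => (hd x).continuousAt.continuousWithinAt) (fun x _ => hd x)
  have h3 : G (t, σ) < -(ε * ‖φ‖) :=
    hab hpav (hball (by rw [Real.dist_eq, sub_zero, abs_of_pos hσ.1]; exact hσ.2.trans hsδ))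
  have h4 := hmin _ hv
  -- Maximality on the ray of w gives S(tw) ≤ S(τ(w)w). The change of t with s can therefore be
  -- ignored, and no derivative of τ is needed.
  have h5 := hf.action_smul_le hw ht.le (hf.scale_pos w) (hf.nehariFunctional_scale_smul hw)
  have e1 : t • w + s • t • φ = t • (w + s • φ) := by
    rw [smul_add, smul_comm]
  simp only [zero_smul, add_zero, sub_zero, e1] at he
  rw [actionDeriv_smul_right, eq_div_iff hs.ne'] at he
  rw [add_sub_cancel_left, norm_smul, Real.norm_of_nonneg hs.le] at h4
  have h6 : G (t, σ) * s < -(ε * ‖φ‖) * s := mul_lt_mul_of_pos_right h3 hs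
  simp only [G] at h6
  rw [he] at h6
  linarith

/-- Ekeland's principle is applied on the complete unit sphere, and invariance along rays extends
the resulting inequality to all nonzero v. Since ‖w‖ = 1, the projection factor of w equals the norm
of the projected point, which explains the factor ‖u‖. -/
theorem exists_almost_critical [Nontrivial (EnergySpace c)] {m : ℝ}
    (hm : ∀ u ∈ nehariManifold c f, m ≤ action f u) {u₁ : EnergySpace c}
    (hu₁ : u₁ ∈ nehariManifold c f) {ε : ℝ} (hε : 0 < ε) :
    ∃ u ∈ nehariManifold c f, action f u ≤ action f u₁ ∧
      ∀ φ, ‖u‖ * |actionDeriv f u φ| ≤ ε * ‖φ‖ := by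
  let X := Metric.sphere (0 : EnergySpace c) 1
  have hne : ∀ x : X, (x : EnergySpace c) ≠ 0 := fun x => ne_zero_of_mem_unit_sphere x
  let Ψ : X → ℝ := fun x => action f (hf.scale x • (x : EnergySpace c))
  have hΨ : Continuous Ψ := by
    refine hf.continuous_action.comp (Continuous.smul (f := fun x : X => hf.scale x)
      (g := fun x : X => (x : EnergySpace c)) ?_ continuous_subtype_val)
    exact continuous_iff_continuousAt.2 fun x =>
      (hf.continuousAt_scale (hne x)).comp continuous_subtype_val.continuousAt
  have : CompleteSpace X := Metric.isClosed_sphere.completeSpace_coe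
  have hnorm : ∀ v : EnergySpace c, v ≠ 0 → ‖v‖⁻¹ • v ∈ X := fun v hv => by
    rw [mem_sphere_zero_iff_norm]
    exact norm_smul_inv_norm (𝕜 := ℝ) hv
  have hscale : ∀ v : EnergySpace c, ∀ hv : v ≠ 0,
      Ψ ⟨‖v‖⁻¹ • v, hnorm v hv⟩ = action f (hf.scale v • v) := fun v hv => by
    simp only [Ψ]
    rw [hf.scale_smul hv (inv_pos.2 (norm_pos_iff.2 hv))]
  obtain ⟨w, hw1, hw2⟩ := exists_ekeland_point hΨ (fun x => hm _ (hf.scale_smul_mem (hne x)))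
    (half_pos hε) ⟨‖u₁‖⁻¹ • u₁, hnorm u₁ hu₁.2⟩
  rw [hscale u₁ hu₁.2, hf.scale_smul_of_mem hu₁] at hw1
  have hwn : ‖(w : EnergySpace c)‖ = 1 := mem_sphere_zero_iff_norm.1 w.2
  have hmin : ∀ v : EnergySpace c, v ≠ 0 →
      action f (hf.scale w • (w : EnergySpace c)) - ε * ‖v - w‖ ≤ action f (hf.scale v • v) := by
    intro v hv
    have h1 := hw2 ⟨‖v‖⁻¹ • v, hnorm v hv⟩
    rw [hscale v hv, Subtype.dist_eq, dist_eq_norm] at h1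
    have h2 := norm_div_norm_sub_le hwn hv
    simp only [Ψ] at h1
    nlinarith
  refine ⟨hf.scale w • (w : EnergySpace c), hf.scale_smul_mem (hne w), hw1, fun φ => ?_⟩
  have hτ := hf.scale_pos (w : EnergySpace c)
  have h1 := hf.neg_le_actionDeriv_of_almost_min (hne w) hmin φ
  -- The one-sided estimate for -φ supplies the upper bound.
  have h2 := hf.neg_le_actionDeriv_of_almost_min (hne w) hmin ((-1 : ℝ) • φ)
  rw [actionDeriv_smul_right, norm_smul, norm_neg, norm_one, one_mul] at h2
  rw [norm_smul, hwn, mul_one, Real.norm_of_nonneg hτ.le, ← abs_of_pos hτ, ← abs_mul,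
    abs_of_pos hτ, abs_le]
  constructor <;> linarith

/-- If `v n → u₀` almost everywhere with bounded `Lᵖ` norms, then `f (v n)` converges to `f u₀`
in the sense of distributions. -/
theorem tendsto_integral_mul {v : ℕ → EnergySpace c} {u₀ : EnergySpace c} {B : ℝ}
    (hB : ∀ n, ∫ z, |v n z| ^ p ≤ B)
    (hae : ∀ᵐ z, Tendsto (fun n => v n z) atTop (𝓝 (u₀ z)))
    (g : EnergySpace c) (hg : Integrable (g : Plane → ℝ)) {D : ℝ} (hD : ∀ᵐ z, |g z| ≤ D) :
    Tendsto (fun n => ∫ z, f (v n z) * g z) atTop (𝓝 (∫ z, f (u₀ z) * g z)) := by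
  refine tendsto_integral_of_dominated_up_to (fun n => hf.integrable_mul (v n) g)
    (hf.integrable_mul u₀ g) (fun δ hδ => ?_) ?_
  · have hB0 : 0 ≤ B := (integral_nonneg fun z => by positivity).trans (hB 0)
    -- The product is chosen so that δ'(|D|+1)(B+1) = δ; the added ones avoid division by zero.
    let δ' := δ / ((|D| + 1) * (B + 1))
    have hδ' : 0 < δ' := by positivity
    obtain ⟨A, hA, hfA⟩ := hf.exists_bound hδ'
    refine ⟨fun z => |f (u₀ z) * g z| + A * |g z|,
      fun n z => δ' * (|D| + 1) * |v n z| ^ p,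
      (hf.integrable_mul u₀ g).abs.add (hg.abs.const_mul A),
      fun n => (hf.integrable_rpow (v n)).const_mul _, fun n z => by positivity,
      Eventually.of_forall fun n => ?_, fun n => ?_⟩
    · rw [integral_const_mul]
      have h1 : δ' * (|D| + 1) * (B + 1) = δ := by simp only [δ']; field_simp
      have h2 : δ' * (|D| + 1) * ∫ z, |v n z| ^ p ≤ δ' * (|D| + 1) * (B + 1) :=
        mul_le_mul_of_nonneg_left (by linarith [hB n]) (by positivity)
      linarith
    · filter_upwards [hD] with z hz
      have h1 : |f (v n z) * g z| ≤ (A + δ' * |v n z| ^ p) * |g z| := by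
        rw [abs_mul]
        exact mul_le_mul_of_nonneg_right (hfA _) (abs_nonneg _)
      have h2 : |g z| ≤ |D| + 1 := by linarith [le_abs_self D]
      have h3 : δ' * |v n z| ^ p * |g z| ≤ δ' * |v n z| ^ p * (|D| + 1) :=
        mul_le_mul_of_nonneg_left h2 (by positivity)
      have h4 := abs_sub (f (v n z) * g z) (f (u₀ z) * g z)
      linarith
  · filter_upwards [hae] with z hz
    exact ((hf.continuous.tendsto _).comp hz).mul_const _

/-- A nontrivial critical point lies on the Nehari manifold. -/
theorem mem_nehariManifold_of_forall {u : EnergySpace c} (hu : u ≠ 0)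
    (h : ∀ ψ : 𝓢(Plane, ℝ), actionDeriv f u (xDeriv ψ) = 0) : u ∈ nehariManifold c f := by
  refine ⟨?_, hu⟩
  rw [← SubcriticalGrowth.actionDeriv_self]
  -- S'(u) is continuous and vanishes on a dense subspace, hence everywhere, in particular at u
  -- itself.
  have hclosed : IsClosed {φ : EnergySpace c | actionDeriv f u φ = 0} :=
    isClosed_eq (hf.continuous_actionDeriv_comp continuous_const continuous_id) continuous_const
  have hsub : closure ((LinearMap.range (xDerivₗ : 𝓢(Plane, ℝ) →ₗ[ℝ] EnergySpace c) :
      Submodule ℝ (EnergySpace c)) : Set (EnergySpace c)) ⊆ {φ | actionDeriv f u φ = 0} := by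
    refine closure_minimal ?_ hclosed
    rintro _ ⟨ψ, rfl⟩
    exact h ψ
  refine hsub ?_
  rw [← Submodule.topologicalClosure_coe, topologicalClosure_range_xDeriv]
  trivial

theorem isSolution_iff {u : EnergySpace c} :
    IsSolution f u ↔ ∀ ψ : 𝓢(Plane, ℝ), actionDeriv f u (xDeriv ψ) = 0 := by
  rw [isSolution_iff_xDeriv (hf.integrable_mul u)]
  simp only [actionDeriv, sub_eq_zero]

theorem mem_nehariManifold_of_isSolution {u : EnergySpace c} (hu : u ≠ 0) (h : IsSolution f u) :
    u ∈ nehariManifold c f :=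
  hf.mem_nehariManifold_of_forall hu (hf.isSolution_iff.1 h)

end NehariConditions

end Shrira

/-! ### The minimizer and the equality of the levels. -/

namespace Shrira

variable {c : ℝ}

theorem coeFn_xDeriv [Fact (0 < c)] (ψ : 𝓢(Plane, ℝ)) :
    (xDeriv ψ : EnergySpace c) =ᵐ[volume] (∂_{unitX} ψ : 𝓢(Plane, ℝ)) := by
  rw [toL2_xDeriv]
  exact coeFn_dxL2 ψ

theorem integrable_xDeriv [Fact (0 < c)] (ψ : 𝓢(Plane, ℝ)) :
    Integrable (xDeriv ψ : EnergySpace c) :=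
  (SchwartzMap.integrable (∂_{unitX} ψ : 𝓢(Plane, ℝ))).congr (coeFn_xDeriv ψ).symm

theorem exists_abs_xDeriv_le [Fact (0 < c)] (ψ : 𝓢(Plane, ℝ)) :
    ∃ D, ∀ᵐ z, |(xDeriv ψ : EnergySpace c) z| ≤ D := by
  obtain ⟨D, hD⟩ := (∂_{unitX} ψ : 𝓢(Plane, ℝ)).decay 0 0
  refine ⟨D, ?_⟩
  filter_upwards [coeFn_xDeriv (c := c) ψ] with z hz
  rw [hz]
  simpa using hD.2 z

theorem nehariFunctional_zero [Fact (0 < c)] (f : ℝ → ℝ) :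
    nehariFunctional f (0 : EnergySpace c) = 0 := by
  have h := actionDeriv_smul_right f (0 : EnergySpace c) 0 0
  rwa [zero_smul, zero_mul, SubcriticalGrowth.actionDeriv_self] at h

namespace NehariConditions

variable {f : ℝ → ℝ} {p C μ : ℝ} [hc : Fact (0 < c)] (hf : NehariConditions c f p C μ)
include hf

/-- A bounded Palais–Smale sequence at the Nehari level. The norms on the manifold are bounded below
by r, which turns the bound on ‖u‖·|S'(u)φ| into one on |S'(u)φ|. -/
theorem exists_minimizing_sequence [Nontrivial (EnergySpace c)] :
    ∃ m : ℝ, (∀ u ∈ nehariManifold c f, m ≤ action f u) ∧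
      ∃ u : ℕ → EnergySpace c, (∀ n, u n ∈ nehariManifold c f) ∧
        Tendsto (fun n => action f (u n)) atTop (𝓝 m) ∧
        (∃ M, ∀ n, ‖u n‖ ≤ M) ∧
        ∃ ε : ℕ → ℝ, Tendsto ε atTop (𝓝 0) ∧ ∀ n φ, |actionDeriv f (u n) φ| ≤ ε n * ‖φ‖ := by
  obtain ⟨r, hr, hpos⟩ := hf.exists_nehariFunctional_pos
  obtain ⟨ω, hω⟩ := exists_ne (0 : EnergySpace c)
  have hne : (action f '' nehariManifold c f).Nonempty :=
    ⟨_, mem_image_of_mem _ (hf.scale_smul_mem hω)⟩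
  have hbdd : BddBelow (action f '' nehariManifold c f) :=
    ⟨0, by rintro _ ⟨u, hu, rfl⟩; exact hf.action_nonneg hu⟩
  let m := sInf (action f '' nehariManifold c f)
  have hm : ∀ u ∈ nehariManifold c f, m ≤ action f u := fun u hu =>
    csInf_le hbdd (mem_image_of_mem _ hu)
  have hstep : ∀ n : ℕ, ∃ u ∈ nehariManifold c f, action f u ≤ m + 1 / ((n : ℝ) + 1) ∧
      ∀ φ, ‖u‖ * |actionDeriv f u φ| ≤ 1 / ((n : ℝ) + 1) * ‖φ‖ := by
    intro n
    have hn : (0 : ℝ) < 1 / ((n : ℝ) + 1) := Nat.one_div_pos_of_nat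
    obtain ⟨_, ⟨u₁, hu₁, rfl⟩, hlt⟩ := exists_lt_of_csInf_lt hne
      (show m < m + 1 / ((n : ℝ) + 1) by linarith)
    obtain ⟨u, hu, h1, h2⟩ := hf.exists_almost_critical hm hu₁ hn
    exact ⟨u, hu, h1.trans hlt.le, h2⟩
  choose u hu hle hcrit using hstep
  have hlim : Tendsto (fun n : ℕ => 1 / ((n : ℝ) + 1)) atTop (𝓝 0) :=
    tendsto_one_div_add_atTop_nhds_zero_nat
  have hru : ∀ n, r ≤ ‖u n‖ := fun n => by
    by_contra! hlt
    exact (hpos _ (hu n).2 hlt).ne' (hu n).1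
  refine ⟨m, hm, u, hu, ?_, ⟨(m + 1) / (1 / 2 - 1 / μ) + 1, fun n => ?_⟩,
    fun n => 1 / ((n : ℝ) + 1) / r, ?_, fun n φ => ?_⟩
  · refine tendsto_of_tendsto_of_tendsto_of_le_of_le tendsto_const_nhds ?_
      (fun n => hm _ (hu n)) hle
    simpa using hlim.const_add m
  · have hμ := hf.two_lt_mu
    have hθ : 0 < 1 / 2 - 1 / μ := sub_pos.2 (one_div_lt_one_div_of_lt two_pos hμ)
    have h1 := hf.mul_norm_sq_le_action (hu n)
    have h2 : 1 / ((n : ℝ) + 1) ≤ 1 := by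
      rw [div_le_one (by positivity)]
      linarith [n.cast_nonneg (α := ℝ)]
    have h3 : ‖u n‖ ^ 2 ≤ (m + 1) / (1 / 2 - 1 / μ) := by
      rw [le_div_iff₀ hθ]
      linarith [hle n]
    nlinarith [sq_nonneg (‖u n‖ - 1), norm_nonneg (u n)]
  · simpa using hlim.div_const r
  · have h1 : r * |actionDeriv f (u n) φ| ≤ 1 / ((n : ℝ) + 1) * ‖φ‖ :=
      (mul_le_mul_of_nonneg_right (hru n) (abs_nonneg _)).trans (hcrit n φ)
    rw [div_mul_eq_mul_div, le_div_iff₀ hr]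
    linarith

/-- The action attains its minimum on the Nehari manifold at a solution. -/
theorem exists_minimizer [Nontrivial (EnergySpace c)] :
    ∃ u ∈ nehariManifold c f, (∀ v ∈ nehariManifold c f, action f u ≤ action f v) ∧
      IsSolution f u := by
  obtain ⟨m, hm, u, hu, hlim, ⟨M, hM⟩, ε, hε, hcrit⟩ := hf.exists_minimizing_sequence
  obtain ⟨η, hη, hηu⟩ := hf.exists_integral_rpow_ge
  obtain ⟨K, hK, hpow⟩ := exists_integral_rpow_le (c := c) hf.two_lt hf.lt_four
  obtain ⟨R, hR, κ, hκ, hlow⟩ := exists_le_norm_lowPass (c := c) hf.two_lt hf.lt_four M hη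
  choose a ha using fun n => hlow (u n) (hM n) (hηu _ (hu n))
  have hvM : ∀ n, ‖translate (a n) (u n)‖ ≤ M := fun n => by
    rw [LinearIsometry.norm_map]; exact hM n
  obtain ⟨u₀, ns, hns, hweak⟩ := exists_subseq_tendsto_weak hvM
  obtain ⟨ks, hks, hae⟩ := exists_subseq_tendsto_ae
    (u := fun n => translate (a (ns n)) (u (ns n))) (fun n => hvM (ns n)) hweak
  let i : ℕ → ℕ := fun n => ns (ks n)
  have hi : Tendsto i atTop atTop := (hns.comp hks).tendsto_atTop
  let v : ℕ → EnergySpace c := fun n => translate (a (i n)) (u (i n))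
  have hvweak : ∀ ℓ : EnergySpace c →L[ℝ] ℝ, Tendsto (fun n => ℓ (v n)) atTop (𝓝 (ℓ u₀)) :=
    fun ℓ => (hweak ℓ).comp hks.tendsto_atTop
  have hvmem : ∀ n, v n ∈ nehariManifold c f := fun n => translate_mem_nehariManifold _ (hu _)
  -- After translation the low-pass parts have size at least κ at the origin, and this survives the
  -- weak limit.
  have hu₀ : u₀ ≠ 0 := by
    rintro rfl
    have h1 := (tendsto_lowPass_of_weak hvweak R 0).norm
    have h2 : κ ≤ ‖lowPass R (0 : EnergySpace c).toL2 0‖ := ge_of_tendsto' h1 fun n => by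
      rw [toL2_translate, lowPass_translateL2]
      exact ha (i n)
    rw [map_zero, ← lowPassCLM_apply, map_zero, norm_zero] at h2
    linarith
  have hB : ∀ n, ∫ z, |v n z| ^ p ≤ K * M ^ p := fun n => by
    have hp := hf.two_lt
    refine (hpow (v n)).2.trans ?_
    have : ‖v n‖ ≤ M := hvM _
    gcongr
  have hcrit₀ : ∀ ψ : 𝓢(Plane, ℝ), actionDeriv f u₀ (xDeriv ψ) = 0 := by
    intro ψ
    obtain ⟨D, hD⟩ := exists_abs_xDeriv_le (c := c) ψ
    have h1 : Tendsto (fun n => actionDeriv f (v n) (xDeriv ψ)) atTop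
        (𝓝 (actionDeriv f u₀ (xDeriv ψ))) := by
      refine Tendsto.sub ?_ (hf.tendsto_integral_mul hB hae _ (integrable_xDeriv ψ) hD)
      have h := hvweak (innerSL ℝ (xDeriv ψ : EnergySpace c))
      simpa only [innerSL_apply_apply, real_inner_comm] using h
    refine tendsto_nhds_unique h1 ?_
    refine squeeze_zero_norm (a := fun n => ε (i n) * ‖(xDeriv ψ : EnergySpace c)‖) (fun n => ?_) ?_
    · rw [Real.norm_eq_abs, actionDeriv_translate]
      refine (hcrit _ _).trans (le_of_eq ?_)
      rw [LinearIsometry.norm_map]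
    · simpa using (hε.comp hi).mul_const ‖(xDeriv ψ : EnergySpace c)‖
  have hmem : u₀ ∈ nehariManifold c f := hf.mem_nehariManifold_of_forall hu₀ hcrit₀
  refine ⟨u₀, hmem, fun w hw => le_trans ?_ (hm w hw), hf.isSolution_iff.2 hcrit₀⟩
  -- On the manifold S is the integral of a nonnegative function, so Fatou's lemma gives S(u₀) ≤ m
  -- even though the norms need not converge.
  have hG : ∀ w ∈ nehariManifold c f,
      ∫ z, (1 / 2 * (w z * f (w z)) - primitive f (w z)) = action f w := fun w hw => by
    rw [← hf.action_sub_half_nehariFunctional, hw.1, mul_zero, sub_zero]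
  have hGi : ∀ w : EnergySpace c,
      Integrable fun z => 1 / 2 * (w z * f (w z)) - primitive f (w z) := fun w =>
    ((hf.integrable_mul_self w).const_mul _).sub (hf.integrable_primitive w)
  rw [← hG u₀ hmem]
  refine integral_le_of_tendsto_ae (fun n => hGi (v n)) (hGi u₀)
    (fun n z => hf.half_mul_sub_primitive_nonneg _) (fun z => hf.half_mul_sub_primitive_nonneg _)
    (fun n => ?_) (hlim.comp hi) ?_
  · rw [hG _ (hvmem n)]
    exact (action_translate f _ _).le
  · filter_upwards [hae] with z hz
    have hcont : Continuous fun s => 1 / 2 * (s * f s) - primitive f s :=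
      (continuous_const.mul (continuous_id.mul hf.continuous)).sub
        (continuous_primitive hf.continuous)
    exact (hcont.tendsto _).comp hz

/-- Every admissible path crosses the Nehari manifold. -/
theorem exists_mem_nehariManifold_of_path {γ : C(unitInterval, EnergySpace c)}
    (hγ : γ ∈ mountainPassPaths c f) : ∃ t, γ t ∈ nehariManifold c f := by
  by_contra! hnot
  obtain ⟨r, hr, hpos⟩ := hf.exists_nehariFunctional_pos
  have hI : Continuous fun t => nehariFunctional f (γ t) :=
    hf.continuous_nehariFunctional.comp γ.continuous
  -- I vanishes at the origin, so the small ball is included in the first open set. Without a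
  -- crossing the two sets cover the interval, yet no point can lie in both.
  have hU : IsOpen {t | ‖γ t‖ < r ∨ 0 < nehariFunctional f (γ t)} :=
    (isOpen_lt γ.continuous.norm continuous_const).union (isOpen_lt continuous_const hI)
  have hV : IsOpen {t | nehariFunctional f (γ t) < 0} := isOpen_lt hI continuous_const
  have hcover : (univ : Set unitInterval) ⊆ {t | ‖γ t‖ < r ∨ 0 < nehariFunctional f (γ t)} ∪
      {t | nehariFunctional f (γ t) < 0} := by
    intro t _
    rcases lt_trichotomy (nehariFunctional f (γ t)) 0 with h | h | h
    · exact Or.inr h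
    · refine Or.inl (Or.inl ?_)
      have : γ t = 0 := by
        by_contra h0
        exact hnot t ⟨h, h0⟩
      rwa [this, norm_zero]
    · exact Or.inl (Or.inr h)
  have h0 : (0 : unitInterval) ∈ {t | ‖γ t‖ < r ∨ 0 < nehariFunctional f (γ t)} :=
    Or.inl (by rwa [hγ.1, norm_zero])
  -- The endpoint has I < 0 because ½I ≤ S < 0 there.
  have h1 : (1 : unitInterval) ∈ {t | nehariFunctional f (γ t) < 0} := by
    have := hf.half_nehariFunctional_le_action (γ 1)
    have := hγ.2
    change nehariFunctional f (γ 1) < 0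
    linarith
  obtain ⟨t, -, ht1, ht2⟩ := isPreconnected_univ _ _ hU hV hcover ⟨0, trivial, h0⟩ ⟨1, trivial, h1⟩
  have ht2 : nehariFunctional f (γ t) < 0 := ht2
  rcases ht1 with h | h
  · refine (hpos _ (fun h0 => ?_) h).not_gt ht2
    rw [h0, nehariFunctional_zero] at ht2
    exact ht2.false
  · exact h.not_gt ht2

/-- A point of the manifold gives a straight path along its ray, on which it is the maximum;
conversely each path meets the manifold. -/
theorem mountainPassLevel_eq_nehariLevel : mountainPassLevel c f = nehariLevel c f := by
  refine le_antisymm (le_iInf₂ fun u hu => ?_) (le_iInf₂ fun γ hγ => ?_)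
  · obtain ⟨T, hT, hneg⟩ := hf.exists_action_smul_neg hu.2
    let γ : C(unitInterval, EnergySpace c) :=
      ⟨fun t => ((t : ℝ) * T) • u,
        (continuous_subtype_val.mul continuous_const).smul continuous_const⟩
    have hγ : γ ∈ mountainPassPaths c f := by
      constructor
      · change ((0 : ℝ) * T) • u = 0
        rw [zero_mul, zero_smul]
      · change action f (((1 : ℝ) * T) • u) < 0
        rwa [one_mul]
    refine (iInf₂_le γ hγ).trans (iSup_le fun t => EReal.coe_le_coe ?_)
    have h := hf.action_smul_le hu.2 (mul_nonneg t.2.1 hT.le) one_pos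
      (by rw [one_smul]; exact hu.1)
    rwa [one_smul] at h
  · obtain ⟨t, ht⟩ := hf.exists_mem_nehariManifold_of_path hγ
    exact (iInf₂_le (γ t) ht).trans (le_iSup (fun t => (action f (γ t) : EReal)) t)

/-- Each ray meets the manifold exactly where the action on it is largest, so the two infima run
over the same values. -/
theorem nehariLevel_eq_minimaxLevel : nehariLevel c f = minimaxLevel c f := by
  refine le_antisymm (le_iInf₂ fun u hu => ?_) (le_iInf₂ fun u hu => ?_)
  · refine (iInf₂_le (hf.scale u • u) (hf.scale_smul_mem hu)).trans ?_
    exact le_iSup₂ (f := fun t (_ : t ∈ Ici (0 : ℝ)) => (action f (t • u) : EReal))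
      (hf.scale u) (hf.scale_pos u).le
  · refine (iInf₂_le u hu.2).trans (iSup₂_le fun t ht => EReal.coe_le_coe ?_)
    have h := hf.action_smul_le hu.2 ht one_pos (by rw [one_smul]; exact hu.1)
    rwa [one_smul] at h

end NehariConditions

/-- For ω = 0 the integrals vanish, so divergence forces ω ≠ 0; projecting a nonzero element makes
the Nehari manifold nonempty. -/
theorem nontrivial_of_tendsto_primitive {f : ℝ → ℝ} {ω : EnergySpace c}
    (h : Tendsto (fun l : ℝ => (l ^ 2)⁻¹ * ∫ z, primitive f (l * ω z)) atTop atTop) :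
    Nontrivial (EnergySpace c) := by
  refine ⟨ω, 0, ?_⟩
  rintro rfl
  have e : ∀ l : ℝ, (l ^ 2)⁻¹ * ∫ z, primitive f (l * (0 : EnergySpace c) z) = 0 := fun l => by
    rw [integral_eq_zero_of_ae, mul_zero]
    rw [map_zero]
    filter_upwards [Lp.coeFn_zero ℝ 2 (volume : Measure Plane)] with z hz
    rw [hz]
    simp [primitive_zero]
  simp only [e] at h
  exact not_tendsto_const_atTop _ _ h

end Shrira
end

theorem theorem2p20 (c : ℝ) [Fact (0 < c)] (f : ℝ → ℝ)
    (hA1 : Continuous f ∧ f 0 = 0)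
    (hA2 : (∃ p ∈ Set.Ioo (2 : ℝ) 4, ∃ C > (0 : ℝ), ∀ u : ℝ, |f u| ≤ C * (|u| + |u| ^ (p - 1))) ∧
      f =o[𝓝 0] (fun u : ℝ => u))
    (hA3 : ∃ μ > (2 : ℝ), ∀ u : ℝ, u ≠ 0 →
      0 < μ * primitive f u ∧ μ * primitive f u ≤ u * f u)
    (hA4 : ∃ ω : EnergySpace c,
      Tendsto (fun l : ℝ => (l ^ 2)⁻¹ * ∫ z, primitive f (l * ω z)) atTop atTop)
    (hA5 : ∀ u : EnergySpace c, u ≠ 0 →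
      StrictMonoOn (fun t : ℝ => t⁻¹ * ∫ z, u z * f (t * u z)) (Set.Ioi 0) ∧
      Tendsto (fun t : ℝ => t⁻¹ * ∫ z, u z * f (t * u z)) atTop atTop) :
    (∃ u ∈ nehariManifold c f,
      (action f u : EReal) = nehariLevel c f ∧ IsGroundState f u) ∧
    mountainPassLevel c f = nehariLevel c f ∧
    nehariLevel c f = minimaxLevel c f := by
  obtain ⟨⟨p, hp, C, hC, hbound⟩, ho⟩ := hA2
  obtain ⟨μ, hμ, hAR⟩ := hA3
  obtain ⟨ω, hω⟩ := hA4
  have := nontrivial_of_tendsto_primitive hω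
  have hf : NehariConditions c f p C μ :=
    ⟨⟨hA1.1, hp.1, hp.2, hC, hbound⟩, ho, hμ, hAR, hA5⟩
  obtain ⟨u, hu, hmin, hsol⟩ := hf.exists_minimizer
  refine ⟨⟨u, hu, le_antisymm ?_ (iInf₂_le u hu), hu.2, hsol, fun v hv hvsol => ?_⟩,
    hf.mountainPassLevel_eq_nehariLevel, hf.nehariLevel_eq_minimaxLevel⟩
  · exact le_iInf₂ fun v hv => EReal.coe_le_coe (hmin v hv)
  · exact hmin v (hf.mem_nehariManifold_of_isSolution hv hvsol)
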